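/- Let $q=e^{\hbar}\in\mathbb C[[\hbar]]$ and let $U_\hbar=U_\hbar(\mathfrak{gl}(1|1))$ be the $\hbar$-adically complete $\mathbb C[[\hbar]]$-superalgebra topologically generated by even elements $H_1,H_2$ and odd elements $E,F$ subject to $$H_1H_2=H_2H_1,\quad [H_1,E]=E,\quad [H_2,E]=-E,\quad [H_1,F]=-F,\quad [H_2,F]=F,$$ $$EF+FE=\frac{e^{\hbar(H_1+H_2)}-e^{-\hbar(H_1+H_2)}}{e^{\hbar}-e^{-\hbar}},\qquad E^2=F^2=0$$ (that is, the quotient of the $\hbar$-adically complete free algebra by the closure of the two-sided ideal of these relations; $[x,y]=xy-yx$). Put $K=e^{\hbar(H_1+H_2)}$; it is invertible with $K^{-1}=e^{-\hbar(H_1+H_2)}$. The completed tensor product $U_\hbar\hat\otimes U_\hbar$ carries the product $(a\otimes b)(c\otimes d)=(-1)^{|b||c|}ac\otimes bd$, and $\sigma(a\otimes b)=(-1)^{|a||b|}b\otimes a$. There are unique $\mathbb C[[\hbar]]$-algebra homomorphisms $\Delta:U_\hbar\to U_\hbar\hat\otimes U_\hbar$, $\varepsilon:U_\hbar\to\mathbb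 C[[\hbar]]$ and a unique $\mathbb C[[\hbar]]$-linear map $S:U_\hbar\to U_\hbar$ with $S(1)=1$ and $S(xy)=(-1)^{|x||y|}S(y)S(x)$ for homogeneous $x,y$, such that $$\Delta(E)=E\otimes K^{-1}+1\otimes E,\quad \Delta(F)=F\otimes 1+K\otimes F,\quad \Delta(H_i)=H_i\otimes 1+1\otimes H_i,$$ $$\varepsilon(E)=\varepsilon(F)=\varepsilon(H_i)=0,\quad S(E)=-EK,\quad S(F)=-K^{-1}F,\quad S(H_i)=-H_i \qquad (i=1,2).$$ Let $R=\bigl(1+(q-q^{-1})F\otimes E\bigr)e^{\hbar(H_1\otimes H_1-H_2\otimes H_2)}=\sum_r a_r\otimes b_r\in U_\hbar\hat\otimes U_\hbar$, let $R_{12}=R$ and $R_{21}=\sigma(R)$, and let $u=\sum_r(-1)^{|a_r||b_r|}S(b_r)a_r$. Put $v=K^{-1}u$. Then $$v=K^{-1}u=uK^{-1}=\bigl(K^{-1}+(q-q^{-1})EF\bigr)e^{\hbar(H_2^2-H_1^2)},$$ and $U_\hbar$ with $\Delta,\varepsilon,S,R,v$ is a ribbon Hopf superalgebra. That is: 1.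 (Hopf superalgebra) $\Delta,\varepsilon,S$ preserve the $\mathbb Z/2$-degree, $\Delta$ is coassociative, $\varepsilon$ is a two-sided counit for $\Delta$, and $S$ satisfies $\nabla(S\otimes\mathrm{id})\Delta(x)=\varepsilon(x)1=\nabla(\mathrm{id}\otimes S)\Delta(x)$ for all $x$, where $\nabla$ is the multiplication; 2. (braided) $R$ is even and invertible, $\sigma(\Delta(x))=R\,\Delta(x)\,R^{-1}$ for all $x\in U_\hbar$, $(\Delta\otimes\mathrm{id})(R)=R_{13}R_{23}$ and $(\mathrm{id}\otimes\Delta)(R)=R_{13}R_{12}$; 3. (ribbon) $v$ is even and central, $v^2=uS(u)$, $\varepsilon(v)=1$, $S(v)=v$, the element $R_{21}R_{12}$ is invertible, and $\Delta(v)=(R_{21}R_{12})^{-1}(v\otimes v)$. -/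

import Mathlib

open scoped TensorProduct DirectSum

noncomputable section

namespace GL11

/-- The base ring `ℂ[[ħ]]`, with `ħ = PowerSeries.X`. -/
abbrev Kh : Type := PowerSeries ℂ

/-- The element `ħ`. -/
abbrev hbar : Kh := PowerSeries.X

/-! ### The `ħ`-adic completion of a (noncommutative) algebra -/

section Completion

variable (A : Type) [Ring A] [Algebra Kh A]

/-- The two-sided ideal `ħⁿ A`. -/
def hIdeal (n : ℕ) : Ideal A where
  carrier := {a | ∃ b : A, a = hbar ^ n • b}
  add_mem' := by
    rintro _ _ ⟨a, rfl⟩ ⟨b, rfl⟩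
    exact ⟨a + b, (smul_add _ _ _).symm⟩
  zero_mem' := ⟨0, (smul_zero _).symm⟩
  smul_mem' := by
    rintro c _ ⟨a, rfl⟩
    exact ⟨c * a, by rw [smul_eq_mul, mul_smul_comm]⟩

instance (n : ℕ) : (hIdeal A n).IsTwoSided :=
  ⟨by rintro _ b ⟨a, rfl⟩; exact ⟨a * b, by rw [smul_mul_assoc]⟩⟩

theorem hIdeal_anti {m n : ℕ} (h : m ≤ n) : hIdeal A n ≤ hIdeal A m := by
  rintro _ ⟨a, rfl⟩
  exact ⟨hbar ^ (n - m) • a, by rw [smul_smul, ← pow_add, Nat.add_sub_cancel' h]⟩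

/-- The inverse limit of the algebras `A / ħⁿ A`, as a subalgebra of their product. -/
def hLimit : Subalgebra Kh (∀ n : ℕ, A ⧸ hIdeal A n) where
  carrier := {x | ∀ (m n : ℕ) (h : m ≤ n),
    Ideal.Quotient.factorₐ Kh (hIdeal_anti A h) (x n) = x m}
  mul_mem' := by
    intro x y hx hy m n h
    simp only [Pi.mul_apply, map_mul, hx m n h, hy m n h]
  add_mem' := by
    intro x y hx hy m n h
    simp only [Pi.add_apply, map_add, hx m n h, hy m n h]
  algebraMap_mem' := by
    intro r m n h
    simp only [Pi.algebraMap_apply, AlgHom.commutes]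

/-- The `ħ`-adic completion `lim A / ħⁿ A`. -/
def HComp : Type := hLimit A

instance : Ring (HComp A) := inferInstanceAs (Ring (hLimit A))
instance : Algebra Kh (HComp A) := inferInstanceAs (Algebra Kh (hLimit A))

variable {A}

namespace HComp

/-- The `n`-th component of an element of the completion. -/
def proj (n : ℕ) : HComp A →ₐ[Kh] A ⧸ hIdeal A n :=
  (Pi.evalAlgHom Kh (fun n : ℕ => A ⧸ hIdeal A n) n).comp (hLimit A).val

theorem factor_proj (x : HComp A) {m n : ℕ} (h : m ≤ n) :
    Ideal.Quotient.factorₐ Kh (hIdeal_anti A h) (proj n x) = proj m x :=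
  x.2 m n h

@[ext]
theorem ext {x y : HComp A} (h : ∀ n, proj n x = proj n y) : x = y :=
  Subtype.ext (funext h)

/-- An element of the completion from a compatible family. -/
def mk (x : ∀ n : ℕ, A ⧸ hIdeal A n)
    (hx : ∀ (m n : ℕ) (h : m ≤ n),
      Ideal.Quotient.factorₐ Kh (hIdeal_anti A h) (x n) = x m) : HComp A :=
  ⟨x, hx⟩

theorem proj_mk (x : ∀ n : ℕ, A ⧸ hIdeal A n)
    (hx : ∀ (m n : ℕ) (h : m ≤ n),
      Ideal.Quotient.factorₐ Kh (hIdeal_anti A h) (x n) = x m) (n : ℕ) :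
    proj n (mk x hx) = x n := rfl

variable (A) in
/-- The canonical map from an algebra to its completion. -/
def of : A →ₐ[Kh] HComp A :=
  (AlgHom.pi (R := Kh) (A := fun n : ℕ => A ⧸ hIdeal A n)
    (fun n => Ideal.Quotient.mkₐ Kh (hIdeal A n))).codRestrict (hLimit A)
    (fun _ _ _ _ => rfl)

theorem proj_of (a : A) (n : ℕ) : proj n (of A a) = Ideal.Quotient.mkₐ Kh (hIdeal A n) a := rfl

theorem proj_hbar_pow_smul (n : ℕ) (x : HComp A) : proj n (hbar ^ n • x) = 0 := by
  rw [map_smul]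
  obtain ⟨a, ha⟩ := Ideal.Quotient.mk_surjective (proj n x)
  rw [← ha]
  exact Ideal.Quotient.eq_zero_iff_mem.mpr ⟨a, rfl⟩

/-- The sum `∑ ħⁱ aᵢ` in the completion. -/
def hsum (a : ℕ → HComp A) : HComp A :=
  mk (fun n => ∑ i ∈ Finset.range n, hbar ^ i • proj n (a i)) (by
    intro m n h
    rw [map_sum, ← Finset.sum_subset (Finset.range_mono h)]
    · exact Finset.sum_congr rfl fun i _ => by rw [map_smul, factor_proj _ h]
    · intro i _ hi
      rw [map_smul, factor_proj _ h, ← map_smul]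
      have hmi : m ≤ i := by simpa using hi
      rw [← Nat.add_sub_cancel' hmi, pow_add, mul_smul, proj_hbar_pow_smul])

/-- The exponential `e^{ħx} = ∑ ħⁱ xⁱ / i!`. -/
def hexp (x : HComp A) : HComp A :=
  hsum fun i => PowerSeries.C ((i.factorial : ℂ)⁻¹) • x ^ i

variable {B : Type} [Ring B] [Algebra Kh B]

/-- The map `A / ħⁿ A → B / ħⁿ B` induced by a linear map `A → lim B / ħⁿ B`. -/
def level (f : A →ₗ[Kh] HComp B) (n : ℕ) : (A ⧸ hIdeal A n) →ₗ[Kh] (B ⧸ hIdeal B n) :=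
  Submodule.liftQ ((hIdeal A n).restrictScalars Kh) ((proj n).toLinearMap ∘ₗ f) (by
    rintro _ ⟨a, rfl⟩
    simp only [LinearMap.mem_ker, LinearMap.comp_apply, AlgHom.toLinearMap_apply]
    rw [map_smul f, proj_hbar_pow_smul])

theorem level_mk (f : A →ₗ[Kh] HComp B) (n : ℕ) (a : A) :
    level f n (Ideal.Quotient.mk (hIdeal A n) a) = proj n (f a) := rfl

/-- The extension to the completion of a `ℂ[[ħ]]`-linear map with values in a complete module
(every `ℂ[[ħ]]`-linear map is `ħ`-adically continuous). -/
def liftₗ (f : A →ₗ[Kh] HComp B) : HComp A →ₗ[Kh] HComp B where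
  toFun x := mk (fun n => level f n (proj n x)) (by
    intro m n h
    rw [← factor_proj x h]
    obtain ⟨a, ha⟩ := Ideal.Quotient.mk_surjective (proj n x)
    rw [← ha]
    exact factor_proj (f a) h)
  map_add' x y := by
    ext n
    rw [map_add (proj n), proj_mk, proj_mk, proj_mk, map_add, map_add]
  map_smul' r x := by
    ext n
    rw [map_smul (proj n), proj_mk, proj_mk, map_smul, map_smul, RingHom.id_apply]

theorem proj_liftₗ (f : A →ₗ[Kh] HComp B) (n : ℕ) (x : HComp A) :
    proj n (liftₗ f x) = level f n (proj n x) := rfl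

theorem liftₗ_of (f : A →ₗ[Kh] HComp B) (a : A) : liftₗ f (of A a) = f a := rfl

/-- The extension to the completion of an algebra homomorphism. -/
def lift (f : A →ₐ[Kh] HComp B) : HComp A →ₐ[Kh] HComp B :=
  AlgHom.ofLinearMap (liftₗ f.toLinearMap)
    (by rw [← map_one (of A), liftₗ_of]; exact map_one f)
    (by
      intro x y
      ext n
      obtain ⟨a, ha⟩ := Ideal.Quotient.mk_surjective (proj n x)
      obtain ⟨b, hb⟩ := Ideal.Quotient.mk_surjective (proj n y)
      rw [map_mul (proj n), proj_liftₗ, proj_liftₗ, proj_liftₗ, map_mul (proj n), ← ha, ← hb,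
        ← map_mul (Ideal.Quotient.mk _), level_mk, level_mk, level_mk]
      simp only [AlgHom.toLinearMap_apply, map_mul])

theorem proj_lift (f : A →ₐ[Kh] HComp B) (n : ℕ) (x : HComp A) :
    proj n (lift f x) = level f.toLinearMap n (proj n x) := rfl

theorem lift_of (f : A →ₐ[Kh] HComp B) (a : A) : lift f (of A a) = f a := rfl

/-- The completion of an algebra homomorphism. -/
def map (f : A →ₐ[Kh] B) : HComp A →ₐ[Kh] HComp B := lift ((of B).comp f)

theorem map_of (f : A →ₐ[Kh] B) (a : A) : map f (of A a) = of B (f a) := rfl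

theorem map_hsum (f : A →ₐ[Kh] B) (a : ℕ → HComp A) :
    map f (hsum a) = hsum fun i => map f (a i) := by
  ext n
  change level _ n (∑ i ∈ Finset.range n, hbar ^ i • proj n (a i)) =
    ∑ i ∈ Finset.range n, hbar ^ i • proj n (map f (a i))
  rw [map_sum]
  exact Finset.sum_congr rfl fun i _ => map_smul _ _ _

end HComp

end Completion

/-! ### Superalgebras and completed super tensor products -/

/-- A superalgebra over `ℂ[[ħ]]`. Since `2` is invertible, a `ℤ/2`-grading is the same thing as
an involutive automorphism, acting by `(-1)^{|a|}` on homogeneous elements. -/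
class SuperAlgebra (A : Type) [Ring A] [Algebra Kh A] where
  parity : A →ₐ[Kh] A
  parity_parity : ∀ a, parity (parity a) = a

open SuperAlgebra

section Super

theorem half_add_half {A : Type} [Ring A] [Algebra Kh A] (a : A) :
    (PowerSeries.C (1 / 2 : ℂ) : Kh) • a + (PowerSeries.C (1 / 2 : ℂ) : Kh) • a = a := by
  rw [← add_smul, ← map_add, show (1 / 2 : ℂ) + 1 / 2 = 1 by norm_num, map_one, one_smul]

variable (A : Type) [Ring A] [Algebra Kh A] [SuperAlgebra A]

/-- The homogeneous elements of degree `i`, that is, those with `parity a = (-1)ⁱ a`. -/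
def part (i : ZMod 2) : Submodule Kh A where
  carrier := {a | parity a = (-1 : ℤˣ) ^ i • a}
  add_mem' := by
    intro a b ha hb
    simp only [Set.mem_ofPred_eq] at *
    rw [map_add, ha, hb, smul_add]
  zero_mem' := by simp
  smul_mem' := by
    intro c a ha
    simp only [Set.mem_ofPred_eq] at *
    rw [map_smul, ha, smul_comm]

variable {A}

theorem mem_part {i : ZMod 2} {a : A} : a ∈ part A i ↔ parity a = (-1 : ℤˣ) ^ i • a := Iff.rfl

theorem mem_part_zero {a : A} : a ∈ part A 0 ↔ parity a = a := by
  rw [mem_part, uzpow_zero, one_smul]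

theorem mem_part_one {a : A} : a ∈ part A 1 ↔ parity a = -a := by
  rw [mem_part, uzpow_one, Units.neg_smul, one_smul]

/-- The even component `(a + parity a) / 2`. -/
def evenPart : A →ₗ[Kh] part A 0 :=
  LinearMap.codRestrict (part A 0)
    ((PowerSeries.C (1 / 2 : ℂ) : Kh) • (LinearMap.id + (parity (A := A)).toLinearMap)) (by
      intro a
      rw [mem_part_zero]
      simp [parity_parity, add_comm])

/-- The odd component `(a - parity a) / 2`. -/
def oddPart : A →ₗ[Kh] part A 1 :=
  LinearMap.codRestrict (part A 1)
    ((PowerSeries.C (1 / 2 : ℂ) : Kh) • (LinearMap.id - (parity (A := A)).toLinearMap)) (by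
      intro a
      rw [mem_part_one]
      simp [parity_parity, ← smul_neg])

theorem evenPart_apply (a : A) :
    (evenPart a : A) = (PowerSeries.C (1 / 2 : ℂ) : Kh) • (a + parity a) := rfl

theorem oddPart_apply (a : A) :
    (oddPart a : A) = (PowerSeries.C (1 / 2 : ℂ) : Kh) • (a - parity a) := rfl

instance : SetLike.GradedMonoid (part A) where
  one_mem := by rw [mem_part_zero, map_one]
  mul_mem i j a b ha hb := by
    rw [mem_part] at *
    rw [map_mul, ha, hb, uzpow_add, smul_mul_smul_comm]

instance : GradedAlgebra (part A) where
  toDecomposition := DirectSum.Decomposition.ofLinearMap (part A)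
    (DirectSum.lof Kh (ZMod 2) (fun i => part A i) 0 ∘ₗ evenPart +
      DirectSum.lof Kh (ZMod 2) (fun i => part A i) 1 ∘ₗ oddPart)
    (by
      ext a
      simp only [LinearMap.comp_apply, LinearMap.add_apply, map_add, DirectSum.coeLinearMap_lof,
        evenPart_apply, oddPart_apply, LinearMap.id_apply]
      rw [← smul_add, add_add_sub_cancel, smul_add, half_add_half])
    (by
      ext i a : 2
      obtain ⟨a, ha⟩ := a
      simp only [LinearMap.comp_apply, LinearMap.add_apply, DirectSum.coeLinearMap_lof,
        LinearMap.id_apply]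
      have hi : i = 0 ∨ i = 1 := (by decide : ∀ i : ZMod 2, i = 0 ∨ i = 1) i
      rcases hi with rfl | rfl
      · have h0 : (evenPart a) = ⟨a, ha⟩ := Subtype.ext (by
          rw [evenPart_apply, mem_part_zero.mp ha, smul_add, half_add_half])
        have h1 : (oddPart a) = 0 := Subtype.ext (by
          rw [oddPart_apply, mem_part_zero.mp ha, sub_self, smul_zero]; rfl)
        rw [h0, h1, map_zero, add_zero]
      · have h0 : (evenPart a) = 0 := Subtype.ext (by
          rw [evenPart_apply, mem_part_one.mp ha, add_neg_cancel, smul_zero]; rfl)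
        have h1 : (oddPart a) = ⟨a, ha⟩ := Subtype.ext (by
          rw [oddPart_apply, mem_part_one.mp ha, sub_neg_eq_add, smul_add, half_add_half])
        rw [h0, h1, map_zero, zero_add])

instance : SuperAlgebra (HComp A) where
  parity := HComp.map parity
  parity_parity x := by
    ext n
    obtain ⟨a, ha⟩ := Ideal.Quotient.mk_surjective (HComp.proj n x)
    change HComp.level _ n (HComp.level _ n (HComp.proj n x)) = HComp.proj n x
    rw [← ha]
    exact congrArg (Ideal.Quotient.mk (hIdeal A n)) (parity_parity a)

variable (A) (B : Type) [Ring B] [Algebra Kh B] [SuperAlgebra B]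

/-- The super tensor product over `ℂ[[ħ]]`, with
`(a ⊗ b) (c ⊗ d) = (-1)^{|b||c|} ac ⊗ bd`. -/
abbrev STensor : Type := GradedTensorProduct Kh (part A) (part B)

theorem parity_anti ⦃i j : ZMod 2⦄ (a : part A i) (b : part B j) :
    (GradedTensorProduct.includeLeft (part A) (part B)).comp parity (a : A) *
      (GradedTensorProduct.includeRight (part A) (part B)).comp parity (b : B) =
    (-1 : ℤˣ) ^ (j * i) •
      ((GradedTensorProduct.includeRight (part A) (part B)).comp parity (b : B) *
        (GradedTensorProduct.includeLeft (part A) (part B)).comp parity (a : A)) := by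
  have h := ((GradedTensorProduct.liftEquiv (part A) (part B)).symm
    (AlgHom.id Kh (STensor A B))).prop a b
  change GradedTensorProduct.includeLeft (part A) (part B) (a : A) *
    GradedTensorProduct.includeRight (part A) (part B) (b : B) = (-1 : ℤˣ) ^ (j * i) •
    (GradedTensorProduct.includeRight (part A) (part B) (b : B) *
    GradedTensorProduct.includeLeft (part A) (part B) (a : A)) at h
  rw [AlgHom.comp_apply, AlgHom.comp_apply, mem_part.mp a.2, mem_part.mp b.2]
  simp only [Units.smul_def, map_zsmul, smul_mul_assoc, mul_smul_comm] at h ⊢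
  rw [h, smul_comm ((((-1 : ℤˣ) ^ i : ℤˣ) : ℤ)), smul_comm ((((-1 : ℤˣ) ^ i : ℤˣ) : ℤ)),
    smul_comm ((((-1 : ℤˣ) ^ j : ℤˣ) : ℤ)) ((((-1 : ℤˣ) ^ (j * i) : ℤˣ) : ℤ))]

instance : SuperAlgebra (STensor A B) where
  parity := GradedTensorProduct.lift (part A) (part B)
    ((GradedTensorProduct.includeLeft (part A) (part B)).comp parity)
    ((GradedTensorProduct.includeRight (part A) (part B)).comp parity)
    (parity_anti A B)
  parity_parity x := by
    rw [← AlgHom.comp_apply]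
    conv_rhs => rw [← AlgHom.id_apply (R := Kh) x]
    congr 1
    ext a
    · simp [parity_parity, GradedTensorProduct.tmul_one_mul_one_tmul]
    · simp [parity_parity, GradedTensorProduct.tmul_one_mul_one_tmul]

/-- The completed super tensor product. -/
abbrev CTensor : Type := HComp (STensor A B)

variable {A B}

/-- The element `a ⊗ b` of the completed tensor product. -/
def ct (a : A) (b : B) : CTensor A B :=
  HComp.of (STensor A B) (GradedTensorProduct.tmul Kh a b)

/-- The linear map `a ⊗ b ↦ f(a, b)` on the completed tensor product. -/
def ctLift {C : Type} [Ring C] [Algebra Kh C] (f : A →ₗ[Kh] B →ₗ[Kh] HComp C) :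
    CTensor A B →ₗ[Kh] HComp C :=
  HComp.liftₗ (TensorProduct.lift f ∘ₗ (GradedTensorProduct.of Kh (part A) (part B)).symm.toLinearMap)

theorem ctLift_ct {C : Type} [Ring C] [Algebra Kh C] (f : A →ₗ[Kh] B →ₗ[Kh] HComp C)
    (a : A) (b : B) : ctLift f (ct a b) = f a b := rfl

variable (A B) in
/-- The bilinear map `(a, b) ↦ a ⊗ b`. -/
def ctBilin : A →ₗ[Kh] B →ₗ[Kh] CTensor A B :=
  (TensorProduct.mk Kh A B).compr₂
    ((HComp.of (STensor A B)).toLinearMap ∘ₗ (GradedTensorProduct.of Kh (part A) (part B)).toLinearMap)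

theorem ctBilin_apply (a : A) (b : B) : ctBilin A B a b = ct a b := rfl

/-- The super flip `a ⊗ b ↦ (-1)^{|a||b|} b ⊗ a`. -/
def flip : CTensor A B →ₐ[Kh] CTensor B A :=
  HComp.map (GradedTensorProduct.comm (part A) (part B)).toAlgHom

theorem flip_ct {i j : ZMod 2} (a : part A i) (b : part B j) :
    flip (ct (a : A) (b : B)) = (-1 : ℤˣ) ^ (i * j) • ct (b : B) (a : A) := by
  have h := GradedTensorProduct.comm_coe_tmul_coe (R := Kh) (part A) (part B) a b
  rw [mul_comm] at h
  change HComp.of _ (GradedTensorProduct.comm (part A) (part B) _) = _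
  rw [h, Units.smul_def, Units.smul_def, map_zsmul]
  rfl

end Super

/-! ### Topological Hopf superalgebras, braided and ribbon structures -/

section Hopf

/-- A comultiplication, a counit and an antipode on the complete superalgebra `HComp T`
(every complete separated algebra is of this form). -/
structure HopfData (T : Type) [Ring T] [Algebra Kh T] [SuperAlgebra T] where
  comul : HComp T →ₐ[Kh] CTensor (HComp T) (HComp T)
  counit : HComp T →ₐ[Kh] Kh
  antipode : HComp T →ₗ[Kh] HComp T

variable (T : Type) [Ring T] [Algebra Kh T] [SuperAlgebra T]

/-- The completed triple tensor product of `HComp T`. -/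
abbrev CTensor3 : Type := CTensor (CTensor (HComp T) (HComp T)) (HComp T)

variable {T}

/-- `a ⊗ b ↦ a ⊗ b ⊗ 1`. -/
def leg12 : CTensor (HComp T) (HComp T) →ₗ[Kh] CTensor3 T :=
  (ctBilin (CTensor (HComp T) (HComp T)) (HComp T)).flip 1

/-- `a ⊗ b ↦ a ⊗ 1 ⊗ b`. -/
def leg13 : CTensor (HComp T) (HComp T) →ₗ[Kh] CTensor3 T :=
  ctLift (ctBilin (CTensor (HComp T) (HComp T)) (HComp T) ∘ₗ
    (ctBilin (HComp T) (HComp T)).flip 1)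

/-- `a ⊗ b ↦ 1 ⊗ a ⊗ b`. -/
def leg23 : CTensor (HComp T) (HComp T) →ₗ[Kh] CTensor3 T :=
  ctLift (ctBilin (CTensor (HComp T) (HComp T)) (HComp T) ∘ₗ
    ctBilin (HComp T) (HComp T) 1)

theorem leg12_apply (x : CTensor (HComp T) (HComp T)) : leg12 x = ct x 1 := rfl

theorem leg13_ct (a b : HComp T) : leg13 (ct a b) = ct (ct a 1) b := rfl

theorem leg23_ct (a b : HComp T) : leg23 (ct a b) = ct (ct 1 a) b := rfl

namespace HopfData

variable (D : HopfData T)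

/-- `Δ ⊗ id`. -/
def comulId : CTensor (HComp T) (HComp T) →ₗ[Kh] CTensor3 T :=
  ctLift (ctBilin (CTensor (HComp T) (HComp T)) (HComp T) ∘ₗ D.comul.toLinearMap)

/-- `id ⊗ Δ`, that is, `a ⊗ b ↦ (a ⊗ 1 ⊗ 1) (1 ⊗ Δ(b))`. -/
def idComul : CTensor (HComp T) (HComp T) →ₗ[Kh] CTensor3 T :=
  ctLift ((LinearMap.mul Kh (CTensor3 T)).compl₁₂
    (leg12 ∘ₗ (ctBilin (HComp T) (HComp T)).flip 1) (leg23 ∘ₗ D.comul.toLinearMap))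

theorem comulId_ct (a b : HComp T) : D.comulId (ct a b) = ct (D.comul a) b := rfl

theorem idComul_ct (a b : HComp T) :
    D.idComul (ct a b) = ct (ct a 1) 1 * leg23 (D.comul b) := rfl

/-- `a ⊗ b ↦ ε(a) b`. -/
def counitId : CTensor (HComp T) (HComp T) →ₗ[Kh] HComp T :=
  ctLift (LinearMap.lsmul Kh (HComp T) ∘ₗ D.counit.toLinearMap)

/-- `a ⊗ b ↦ ε(b) a`. -/
def idCounit : CTensor (HComp T) (HComp T) →ₗ[Kh] HComp T :=
  ctLift (LinearMap.lsmul Kh (HComp T) ∘ₗ D.counit.toLinearMap).flip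

/-- `a ⊗ b ↦ S(a) b`. -/
def antipodeMul : CTensor (HComp T) (HComp T) →ₗ[Kh] HComp T :=
  ctLift (LinearMap.mul Kh (HComp T) ∘ₗ D.antipode)

/-- `a ⊗ b ↦ a S(b)`. -/
def mulAntipode : CTensor (HComp T) (HComp T) →ₗ[Kh] HComp T :=
  ctLift ((LinearMap.mul Kh (HComp T)).compl₂ D.antipode)

theorem counitId_ct (a b : HComp T) : D.counitId (ct a b) = D.counit a • b := rfl

theorem idCounit_ct (a b : HComp T) : D.idCounit (ct a b) = D.counit b • a := rfl

theorem antipodeMul_ct (a b : HComp T) : D.antipodeMul (ct a b) = D.antipode a * b := rfl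

theorem mulAntipode_ct (a b : HComp T) : D.mulAntipode (ct a b) = a * D.antipode b := rfl

/-- The axioms of a (topological) Hopf superalgebra. -/
structure IsHopfSuperalgebra : Prop where
  comul_even : ∀ x, D.comul (parity x) = parity (D.comul x)
  counit_even : ∀ x, D.counit (parity x) = D.counit x
  antipode_even : ∀ x, D.antipode (parity x) = parity (D.antipode x)
  coassoc : ∀ x, D.comulId (D.comul x) = D.idComul (D.comul x)
  counit_left : ∀ x, D.counitId (D.comul x) = x
  counit_right : ∀ x, D.idCounit (D.comul x) = x
  antipode_left : ∀ x, D.antipodeMul (D.comul x) = algebraMap Kh (HComp T) (D.counit x)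
  antipode_right : ∀ x, D.mulAntipode (D.comul x) = algebraMap Kh (HComp T) (D.counit x)

/-- A braided (quasi-triangular) Hopf superalgebra with universal R-matrix `R`. -/
structure IsBraided (R : CTensor (HComp T) (HComp T)) : Prop extends D.IsHopfSuperalgebra where
  even_R : parity R = R
  isUnit_R : IsUnit R
  /-- `Δᵒᵖ(x) = R Δ(x) R⁻¹` -/
  comul_op : ∀ x, flip (D.comul x) = R * D.comul x * Ring.inverse R
  comul_id_R : D.comulId R = leg13 R * leg23 R
  id_comul_R : D.idComul R = leg13 R * leg12 R

/-- The Drinfeld element `u = ∑ (-1)^{|a||b|} S(b) a` for `R = ∑ a ⊗ b`. -/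
def drinfeld (R : CTensor (HComp T) (HComp T)) : HComp T := D.antipodeMul (flip R)

theorem drinfeld_ct {i j : ZMod 2} (a : part (HComp T) i) (b : part (HComp T) j) :
    D.drinfeld (ct (a : HComp T) (b : HComp T)) =
      (-1 : ℤˣ) ^ (i * j) • (D.antipode (b : HComp T) * (a : HComp T)) := by
  rw [drinfeld, flip_ct, Units.smul_def, Units.smul_def, map_zsmul, antipodeMul_ct]

/-- A ribbon Hopf superalgebra with universal R-matrix `R` and ribbon element `v`. -/
structure IsRibbon (R : CTensor (HComp T) (HComp T)) (v : HComp T) : Prop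
    extends D.IsBraided R where
  even_v : parity v = v
  central_v : ∀ x, v * x = x * v
  sq_v : v ^ 2 = D.drinfeld R * D.antipode (D.drinfeld R)
  counit_v : D.counit v = 1
  antipode_v : D.antipode v = v
  isUnit_monodromy : IsUnit (flip R * R)
  /-- `Δ(v) = (R₂₁ R₁₂)⁻¹ (v ⊗ v)` -/
  comul_v : D.comul v = Ring.inverse (flip R * R) * ct v v

end HopfData

end Hopf

/-! ### The algebra `U_ħ(gl(1|1))` -/

/-- `q = e^ħ`. -/
def q : Kh := PowerSeries.exp ℂ

/-- The power series `(q - q⁻¹) / ħ`, which is invertible. -/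
def qDiv : Kh := PowerSeries.mk fun i => PowerSeries.coeff (i + 1) (q - q⁻¹)

theorem hbar_mul_qDiv : hbar * qDiv = q - q⁻¹ := by
  ext n
  cases n with
  | zero => simp [q]
  | succ n => rw [mul_comm, PowerSeries.coeff_succ_mul_X, qDiv, PowerSeries.coeff_mk]

/-- The element `(e^{ħx} - e^{-ħx}) / (e^ħ - e^{-ħ})`, where both the numerator and the
denominator are divided by `ħ` first. -/
def qBracket {A : Type} [Ring A] [Algebra Kh A] (x : HComp A) : HComp A :=
  qDiv⁻¹ • HComp.hsum fun i =>
    PowerSeries.C (((i + 1).factorial : ℂ)⁻¹) • (x ^ (i + 1) - (-x) ^ (i + 1))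

theorem constantCoeff_qDiv : PowerSeries.constantCoeff qDiv ≠ 0 := by
  have h : q⁻¹ = PowerSeries.evalNegHom (PowerSeries.exp ℂ) := by
    rw [PowerSeries.inv_eq_iff_mul_eq_one (by simp [q]), mul_comm, q,
      PowerSeries.exp_mul_exp_neg_eq_one]
  rw [← PowerSeries.coeff_zero_eq_constantCoeff_apply, qDiv, PowerSeries.coeff_mk, h, q]
  simp [PowerSeries.evalNegHom, PowerSeries.coeff_rescale, PowerSeries.coeff_exp]

theorem hbar_smul_hsum {A : Type} [Ring A] [Algebra Kh A] (a : ℕ → HComp A) :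
    hbar • HComp.hsum (fun i => a (i + 1)) = HComp.hsum a - a 0 := by
  ext n
  rw [map_smul, map_sub]
  change hbar • ∑ i ∈ Finset.range n, hbar ^ i • HComp.proj n (a (i + 1)) =
    ∑ i ∈ Finset.range n, hbar ^ i • HComp.proj n (a i) - HComp.proj n (a 0)
  have h := Finset.sum_range_succ' (fun i => hbar ^ i • HComp.proj n (a i)) n
  rw [Finset.sum_range_succ, pow_zero, one_smul, ← map_smul (HComp.proj n) (hbar ^ n),
    HComp.proj_hbar_pow_smul, add_zero] at h
  rw [h, add_sub_cancel_right, Finset.smul_sum]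
  exact Finset.sum_congr rfl fun i _ => by rw [smul_smul, pow_succ']

theorem hsum_sub {A : Type} [Ring A] [Algebra Kh A] (a b : ℕ → HComp A) :
    HComp.hsum (fun i => a i - b i) = HComp.hsum a - HComp.hsum b := by
  ext n
  rw [map_sub]
  change ∑ i ∈ Finset.range n, hbar ^ i • HComp.proj n (a i - b i) =
    ∑ i ∈ Finset.range n, hbar ^ i • HComp.proj n (a i) -
      ∑ i ∈ Finset.range n, hbar ^ i • HComp.proj n (b i)
  simp only [map_sub, smul_sub, Finset.sum_sub_distrib]

/-- `qBracket x` is the quotient that it should be. -/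
theorem smul_qBracket {A : Type} [Ring A] [Algebra Kh A] (x : HComp A) :
    (q - q⁻¹) • qBracket x = HComp.hexp x - HComp.hexp (-x) := by
  rw [qBracket, smul_smul, ← hbar_mul_qDiv, mul_assoc,
    PowerSeries.mul_inv_cancel _ constantCoeff_qDiv, mul_one,
    hbar_smul_hsum (fun i => PowerSeries.C ((i.factorial : ℂ)⁻¹) • (x ^ i - (-x) ^ i))]
  simp only [smul_sub, hsum_sub, pow_zero, sub_self]
  rw [smul_zero, sub_zero]
  rfl

/-- The four generators. -/
inductive Gen : Type
  | E | F | H₁ | H₂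

/-- The `ħ`-adically complete free algebra on the generators. -/
abbrev FreeU : Type := HComp (FreeAlgebra Kh Gen)

/-- A generator in the complete free algebra. -/
def gen (g : Gen) : FreeU := HComp.of _ (FreeAlgebra.ι Kh g)

/-- The defining relations. -/
inductive Rel : FreeU → FreeU → Prop
  | H₁H₂ : Rel (gen .H₁ * gen .H₂) (gen .H₂ * gen .H₁)
  | H₁E : Rel (gen .H₁ * gen .E - gen .E * gen .H₁) (gen .E)
  | H₂E : Rel (gen .H₂ * gen .E - gen .E * gen .H₂) (-gen .E)
  | H₁F : Rel (gen .H₁ * gen .F - gen .F * gen .H₁) (-gen .F)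
  | H₂F : Rel (gen .H₂ * gen .F - gen .F * gen .H₂) (gen .F)
  | EF : Rel (gen .E * gen .F + gen .F * gen .E) (qBracket (gen .H₁ + gen .H₂))
  | EE : Rel (gen .E ^ 2) 0
  | FF : Rel (gen .F ^ 2) 0

/-- The quotient of the complete free algebra by the two-sided ideal of the relations. -/
abbrev PreU : Type := RingQuot Rel

/-- The quotient of the complete free algebra `P` by the closure of the two-sided ideal `I` of the
relations, as the completion `lim P / (I + ħⁿ P)` of `P / I`. -/
abbrev U : Type := HComp PreU

/-- The parity automorphism on the generators: `E` and `F` are odd, `H₁` and `H₂` are even. -/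
def genParity : Gen → FreeAlgebra Kh Gen
  | .E => -FreeAlgebra.ι Kh .E
  | .F => -FreeAlgebra.ι Kh .F
  | .H₁ => FreeAlgebra.ι Kh .H₁
  | .H₂ => FreeAlgebra.ι Kh .H₂

/-- The parity automorphism of the complete free algebra. -/
def freeParity : FreeU →ₐ[Kh] FreeU := HComp.map (FreeAlgebra.lift Kh genParity)

theorem freeParity_gen (g : Gen) : freeParity (gen g) = HComp.of _ (genParity g) := by
  rw [freeParity, gen, HComp.map_of, FreeAlgebra.lift_ι_apply]

theorem freeParity_E : freeParity (gen .E) = -gen .E := by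
  rw [freeParity_gen]; exact map_neg _ _

theorem freeParity_F : freeParity (gen .F) = -gen .F := by
  rw [freeParity_gen]; exact map_neg _ _

theorem freeParity_H₁ : freeParity (gen .H₁) = gen .H₁ := freeParity_gen _

theorem freeParity_H₂ : freeParity (gen .H₂) = gen .H₂ := freeParity_gen _

theorem freeParity_freeParity (x : FreeU) : freeParity (freeParity x) = x := by
  have h : ∀ a : FreeAlgebra Kh Gen,
      FreeAlgebra.lift Kh genParity (FreeAlgebra.lift Kh genParity a) = a := by
    intro a
    rw [← AlgHom.comp_apply]
    conv_rhs => rw [← AlgHom.id_apply (R := Kh) a]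
    congr 1
    ext g
    cases g <;> simp [genParity]
  ext n
  obtain ⟨a, ha⟩ := Ideal.Quotient.mk_surjective (HComp.proj n x)
  change HComp.level _ n (HComp.level _ n (HComp.proj n x)) = HComp.proj n x
  rw [← ha]
  exact congrArg (Ideal.Quotient.mk _) (h a)

theorem freeParity_qBracket (x : FreeU) : freeParity (qBracket x) = qBracket (freeParity x) := by
  rw [qBracket, qBracket, map_smul, freeParity, HComp.map_hsum]
  simp only [map_smul, map_sub, map_pow, map_neg]

/-- The parity automorphism of the quotient by the relations. -/
def preParity : PreU →ₐ[Kh] PreU :=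
  RingQuot.liftAlgHom Kh ⟨(RingQuot.mkAlgHom Kh Rel).comp freeParity, by
    intro x y h
    have key : ∀ {a b : FreeU}, Rel a b → RingQuot.mkAlgHom Kh Rel a = RingQuot.mkAlgHom Kh Rel b :=
      fun h => RingQuot.mkAlgHom_rel Kh h
    rw [AlgHom.comp_apply, AlgHom.comp_apply]
    have h' := key h
    cases h <;>
      simp only [map_mul, map_sub, map_add, map_neg, map_pow, map_zero, freeParity_E, freeParity_F,
        freeParity_H₁, freeParity_H₂, freeParity_qBracket, mul_neg, neg_mul, neg_neg, even_two,
        Even.neg_pow] at h' ⊢ <;>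
      first
        | exact h'
        | rw [neg_sub_neg, ← neg_sub, h', neg_neg]
        | rw [neg_sub_neg, ← neg_sub, h']⟩

instance : SuperAlgebra PreU where
  parity := preParity
  parity_parity x := by
    rw [← AlgHom.comp_apply]
    conv_rhs => rw [← AlgHom.id_apply (R := Kh) x]
    congr 1
    apply RingQuot.ringQuot_ext'
    ext x
    simp [preParity, freeParity_freeParity]

/-- The image in `U` of a generator. -/
def genU (g : Gen) : U := HComp.of PreU (RingQuot.mkAlgHom Kh Rel (gen g))

/-- `E` -/
def E : U := genU .E

/-- `F` -/
def F : U := genU .F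

/-- `H₁` -/
def H₁ : U := genU .H₁

/-- `H₂` -/
def H₂ : U := genU .H₂

/-- `K = e^{ħ(H₁ + H₂)}` -/
def K : U := HComp.hexp (H₁ + H₂)

/-- `K⁻¹ = e^{-ħ(H₁ + H₂)}` -/
def Kinv : U := HComp.hexp (-(H₁ + H₂))

/-- The maps `Δ`, `ε`, `S` of `U`, given by their values on the generators; `Δ` and `ε` are
algebra homomorphisms and `S` is an anti-homomorphism of superalgebras. -/
structure IsStandard (D : HopfData PreU) : Prop where
  comul_E : D.comul E = ct E Kinv + ct 1 E
  comul_F : D.comul F = ct F 1 + ct K F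
  comul_H₁ : D.comul H₁ = ct H₁ 1 + ct 1 H₁
  comul_H₂ : D.comul H₂ = ct H₂ 1 + ct 1 H₂
  counit_E : D.counit E = 0
  counit_F : D.counit F = 0
  counit_H₁ : D.counit H₁ = 0
  counit_H₂ : D.counit H₂ = 0
  antipode_E : D.antipode E = -(E * K)
  antipode_F : D.antipode F = -(Kinv * F)
  antipode_H₁ : D.antipode H₁ = -H₁
  antipode_H₂ : D.antipode H₂ = -H₂
  antipode_one : D.antipode 1 = 1
  antipode_mul : ∀ (i j : ZMod 2), ∀ x ∈ part U i, ∀ y ∈ part U j,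
    D.antipode (x * y) = (-1 : ℤˣ) ^ (i * j) • (D.antipode y * D.antipode x)

/-- `Υ = e^{ħ(H₁ ⊗ H₁ - H₂ ⊗ H₂)}` -/
def Upsilon : CTensor U U := HComp.hexp (ct H₁ H₁ - ct H₂ H₂)

/-- `Θ = 1 + (q - q⁻¹) F ⊗ E` -/
def Theta : CTensor U U := 1 + (q - q⁻¹) • ct F E

/-- The universal R-matrix. -/
def R : CTensor U U := Theta * Upsilon

/-- `v = (K⁻¹ + (q - q⁻¹) E F) e^{ħ(H₂² - H₁²)}` -/
def v : U := (Kinv + (q - q⁻¹) • (E * F)) * HComp.hexp (H₂ ^ 2 - H₁ ^ 2)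

end GL11

end

open scoped TensorProduct DirectSum

noncomputable section

namespace GL11

open SuperAlgebra

/-! Since every `ℂ[[ħ]]`-linear map preserves `ħⁿ`-multiples, linear maps into separated modules are
determined on dense subsets and commute with `ħ`-adic series. Thus homomorphisms from `U` to
complete algebras can be built, and compared, on the four generators (`uLift`, `u_algHom_ext`). This
yields `Δ` and `ε`, and the coassociativity, counit and parity axioms. The antipode is a super
anti-homomorphism, so it is first built as an ordinary anti-homomorphism by multiplying odd
generators by `i`. Its axioms are checked on generators multiplied by arbitrary tensors, because
`∇(S ⊗ id)` is not multiplicative.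

The structural fact behind everything else is that `H₁ + H₂`, hence `K`, is central, while `E` and
`F` have opposite weights for `H₁` and `H₂`. Moving `H₁ ⊗ H₁ - H₂ ⊗ H₂` past `E` or `F` in one leg
therefore adds `±(H₁ + H₂)` in the other leg, and conjugation by `Υ` only inserts powers of `K`
(`Upsilon_mul_E_left` and its variants). Consequently `Υ` turns `Δ(E)` and `Δ(F)` into expressions
that differ from the opposite coproducts by powers of `K`; multiplication by `Θ`, with `(F ⊗ E)² =
0`, corrects the difference through `(q - q⁻¹)(EF + FE) = K - K⁻¹` (`R_mul_E`, `R_mul_F`). Both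
hexagon identities reduce to one lemma on square-zero perturbations of `1`
(`one_add_smul_mul_conj`), since the exponents of `Υ` add under the coproduct.

For the ribbon element, `S(H_i) = -H_i` converts `Υ` into `e^{ħ(H₂² - H₁²)}`, which gives `u = Kv`
(`drinfeld_R`). The element `v` is central because its two factors shift `E` and `F` by opposite
powers of `K` (`v_commute`). The coproduct of the exponential factor contains `Υ⁻²`, which cancels
the two `Υ` of the monodromy, and a finite identity in `E`, `F`, `K` remains
(`monodromy_factor_mul`).

No basis or torsion-freeness of `U` is used: identities involving `q - q⁻¹` are kept multiplied out,
and the coproduct of the bracket is obtained from a universal torsion-free case (`qBracket_add`). -/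

/-- A `ℂ[[ħ]]`-module is `ħ`-adically separated if `⋂ ħⁿ M = 0`. -/
class HSeparated (M : Type*) [AddCommGroup M] [Module Kh M] : Prop where
  eq_zero : ∀ x : M, (∀ n : ℕ, ∃ y, x = hbar ^ n • y) → x = 0

theorem eq_of_hbar_pow {M : Type*} [AddCommGroup M] [Module Kh M] [HSeparated M] {x y : M}
    (h : ∀ n : ℕ, ∃ z, x = y + hbar ^ n • z) : x = y := by
  refine sub_eq_zero.mp (HSeparated.eq_zero _ fun n => ?_)
  obtain ⟨z, hz⟩ := h n
  exact ⟨z, by rw [hz, add_sub_cancel_left]⟩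

instance : HSeparated Kh where
  eq_zero x h := by
    ext n
    obtain ⟨y, rfl⟩ := h (n + 1)
    rw [smul_eq_mul, PowerSeries.coeff_X_pow_mul', if_neg (by omega), map_zero]

/-! ### Completions: density, `ħ`-adic series and exponentials -/

section

variable {A : Type} [Ring A] [Algebra Kh A] {B : Type} [Ring B] [Algebra Kh B]

namespace HComp

theorem proj_surjective (n : ℕ) (x : HComp A) :
    ∃ a : A, proj n x = Ideal.Quotient.mk (hIdeal A n) a := by
  obtain ⟨a, ha⟩ := Ideal.Quotient.mk_surjective (proj n x)
  exact ⟨a, ha.symm⟩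

instance : HSeparated (HComp A) where
  eq_zero x h := by
    ext n
    obtain ⟨y, rfl⟩ := h n
    rw [proj_hbar_pow_smul, map_zero]

theorem proj_hsum (a : ℕ → HComp A) (n : ℕ) :
    proj n (hsum a) = ∑ i ∈ Finset.range n, hbar ^ i • proj n (a i) := rfl

/-- Successive representatives of `x` differ by multiples of `ħᵐ`. Telescoping from level `n` on
writes `x` as `ħⁿ` times a convergent series. Hence the kernel of `proj n` is no larger than `ħⁿ`
times the completion, and the inverse limit topology is the `ħ`-adic one. -/
theorem exists_of_proj_eq_zero {n : ℕ} {x : HComp A} (hx : proj n x = 0) :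
    ∃ y, x = hbar ^ n • y := by
  choose b hb using fun m => proj_surjective m x
  have hstep : ∀ m, ∃ a, b (m + 1) - b m = hbar ^ m • a := by
    intro m
    have h := factor_proj x (Nat.le_succ m)
    rw [hb, hb] at h
    exact Ideal.Quotient.eq.mp h
  choose a ha using hstep
  obtain ⟨a', ha'⟩ : ∃ a', b n = hbar ^ n • a' := by
    rw [hb] at hx
    exact Ideal.Quotient.eq_zero_iff_mem.mp hx
  have htel : ∀ m, b (n + m) = b n + hbar ^ n • ∑ i ∈ Finset.range m, hbar ^ i • a (n + i) := by
    intro m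
    induction m with
    | zero => simp
    | succ m ih =>
      rw [Finset.sum_range_succ, smul_add, ← add_assoc (b n), ← ih, smul_smul, ← pow_add, ← ha,
        add_sub_cancel, add_assoc]
  refine ⟨of A a' + hsum fun i => of A (a (n + i)), ?_⟩
  ext m
  have h := factor_proj x (Nat.le_add_left m n)
  rw [hb] at h
  rw [← h]
  change Ideal.Quotient.mk (hIdeal A m) (b (n + m)) = _
  rw [htel, ha', ← smul_add, map_smul (proj m), map_add (proj m), proj_hsum]
  change Ideal.Quotient.mkₐ Kh (hIdeal A m) _ = _
  rw [map_smul, map_add, map_sum]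
  simp only [map_smul]
  rfl

/-- The image of an algebra is dense in its completion. -/
theorem exists_of_add (x : HComp A) (n : ℕ) : ∃ a y, x = of A a + hbar ^ n • y := by
  obtain ⟨a, ha⟩ := proj_surjective n x
  obtain ⟨y, hy⟩ := exists_of_proj_eq_zero (n := n) (x := x - of A a)
    (by rw [map_sub, ha]; exact sub_self _)
  exact ⟨a, y, by rw [← hy, add_sub_cancel]⟩

/-- Modulo `ħⁿ` every element comes from `A`, and linear maps respect `ħⁿ`-multiples. Continuity is
therefore automatic. -/
theorem linearMap_ext {M : Type*} [AddCommGroup M] [Module Kh M] [HSeparated M]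
    {f g : HComp A →ₗ[Kh] M} (h : ∀ a, f (of A a) = g (of A a)) : f = g := by
  ext x
  refine eq_of_hbar_pow fun n => ?_
  obtain ⟨a, y, rfl⟩ := exists_of_add x n
  exact ⟨f y - g y, by simp only [map_add, map_smul, h, smul_sub]; abel⟩

theorem hsum_eq_add (a : ℕ → HComp A) (n : ℕ) :
    hsum a = ∑ i ∈ Finset.range n, hbar ^ i • a i + hbar ^ n • hsum fun i => a (i + n) := by
  induction n with
  | zero => simp
  | succ n ih =>
    rw [ih, Finset.sum_range_succ, add_assoc, pow_succ, mul_smul]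
    have h := hbar_smul_hsum fun i => a (i + n)
    simp only [add_right_comm _ 1 n, add_assoc _ n 1] at h
    rw [h, smul_sub, zero_add, add_sub_cancel]

/-- Together with `hsum_eq_add` this characterises a series by its partial sums modulo `ħⁿ`, so
components of the inverse limit need not be inspected again. -/
theorem eq_hsum {a : ℕ → HComp A} {x : HComp A}
    (h : ∀ n, ∃ y, x = ∑ i ∈ Finset.range n, hbar ^ i • a i + hbar ^ n • y) : x = hsum a := by
  refine eq_of_hbar_pow fun n => ?_
  obtain ⟨y, hy⟩ := h n
  refine ⟨y - hsum fun i => a (i + n), ?_⟩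
  rw [hy, hsum_eq_add a n, smul_sub]
  abel

theorem linearMap_hsum (f : HComp A →ₗ[Kh] HComp B) (a : ℕ → HComp A) :
    f (hsum a) = hsum fun i => f (a i) := by
  refine eq_hsum fun n => ⟨f (hsum fun i => a (i + n)), ?_⟩
  conv_lhs => rw [hsum_eq_add a n]
  simp only [map_add, map_sum, map_smul]

theorem algHom_hsum (f : HComp A →ₐ[Kh] HComp B) (a : ℕ → HComp A) :
    f (hsum a) = hsum fun i => f (a i) :=
  linearMap_hsum f.toLinearMap a

theorem algHom_hexp (f : HComp A →ₐ[Kh] HComp B) (x : HComp A) : f (hexp x) = hexp (f x) := by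
  rw [hexp, algHom_hsum]
  simp only [map_smul, map_pow]
  rfl

theorem algHom_qBracket (f : HComp A →ₐ[Kh] HComp B) (x : HComp A) :
    f (qBracket x) = qBracket (f x) := by
  rw [qBracket, qBracket, map_smul, algHom_hsum]
  simp only [map_smul, map_sub, map_pow, map_neg]

theorem hsum_mul (a : ℕ → HComp A) (x : HComp A) : hsum a * x = hsum fun i => a i * x :=
  linearMap_hsum (LinearMap.mulRight Kh x) a

theorem mul_hsum (a : ℕ → HComp A) (x : HComp A) : x * hsum a = hsum fun i => x * a i :=
  linearMap_hsum (LinearMap.mulLeft Kh x) a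

/-- This is the tool for all later conjugations: if moving `y` across an exponent shifts the
exponent, moving `y` across the exponential shifts it in the same way. -/
theorem hexp_semiconj {x y z : HComp A} (h : x * y = y * z) : hexp x * y = y * hexp z := by
  rw [hexp, hexp, hsum_mul, mul_hsum]
  congr 1
  ext1 i
  rw [smul_mul_assoc, mul_smul_comm]
  congr 1
  have h' : SemiconjBy y z x := h.symm
  exact (h'.pow_right i).symm

theorem hexp_commute {x y : HComp A} (h : Commute x y) : Commute (hexp x) y :=
  hexp_semiconj h

theorem hexp_zero : hexp (0 : HComp A) = 1 := by
  symm
  refine eq_hsum fun n => ?_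
  cases n with
  | zero => exact ⟨1, by simp⟩
  | succ n =>
    refine ⟨0, ?_⟩
    rw [Finset.sum_range_succ']
    simp

theorem isNilpotent_hbar_smul (n : ℕ) (x : HComp A) : IsNilpotent (hbar • proj n x) :=
  ⟨n, by rw [smul_pow, ← map_pow, ← map_smul, proj_hbar_pow_smul]⟩

/-- Modulo `ħⁿ` the element `ħx` is nilpotent, so the series becomes the finite exponential of a
nilpotent element. The two scalings by `1/i!`, over `ℚ` and over `ℂ[[ħ]]`, agree because both invert
multiplication by the integer `i!`. -/
theorem proj_hexp {n : ℕ} [Module ℚ (A ⧸ hIdeal A n)] (x : HComp A) :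
    proj n (hexp x) = IsNilpotent.exp (hbar • proj n x) := by
  rw [IsNilpotent.exp_eq_sum (k := n)
    (by rw [smul_pow, ← map_pow, ← map_smul, proj_hbar_pow_smul]), hexp, proj_hsum]
  refine Finset.sum_congr rfl fun i _ => ?_
  rw [smul_pow, map_smul, map_pow, smul_comm]
  generalize hbar ^ i • proj n x ^ i = z
  have hi : (i.factorial : ℚ) ≠ 0 := by positivity
  have h1 : (i.factorial : ℚ) • ((i.factorial : ℚ)⁻¹ • z) = z := by
    rw [smul_smul, mul_inv_cancel₀ hi, one_smul]
  rw [Nat.cast_smul_eq_nsmul ℚ] at h1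
  conv_lhs => rw [← h1]
  rw [← Nat.cast_smul_eq_nsmul Kh, smul_smul]
  have h2 : (PowerSeries.C ((i.factorial : ℂ)⁻¹) : Kh) * (i.factorial : Kh) = 1 := by
    rw [← map_natCast (PowerSeries.C (R := ℂ)), ← map_mul, inv_mul_cancel₀ (by
      exact_mod_cast i.factorial_ne_zero), map_one]
  rw [h2, one_smul]

theorem hexp_add {x y : HComp A} (h : Commute x y) : hexp (x + y) = hexp x * hexp y := by
  ext n
  -- The rational structure needed for nilpotent exponentials is restricted from `ℂ[[ħ]]`.
  let _ : Module ℚ (A ⧸ hIdeal A n) := Module.compHom _ (algebraMap ℚ Kh)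
  rw [map_mul, proj_hexp, proj_hexp, proj_hexp, map_add, smul_add]
  exact IsNilpotent.exp_add_of_commute
    (((h.map (proj n)).smul_left _).smul_right _)
    (isNilpotent_hbar_smul n x) (isNilpotent_hbar_smul n y)

theorem hexp_mul_hexp_neg (x : HComp A) : hexp x * hexp (-x) = 1 := by
  rw [← hexp_add (Commute.refl x).neg_right, add_neg_cancel, hexp_zero]

theorem hexp_neg_mul_hexp (x : HComp A) : hexp (-x) * hexp x = 1 := by
  rw [← hexp_add (Commute.refl x).neg_left, neg_add_cancel, hexp_zero]

/-- Dividing by `ħ` costs one level of precision: level `n + 1` of `ħx` determines level `n` of `x`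
when `A` has no `ħ`-torsion. -/
theorem hbar_smul_injective (hA : ∀ a : A, hbar • a = 0 → a = 0) {x : HComp A}
    (hx : hbar • x = 0) : x = 0 := by
  ext n
  obtain ⟨a, ha⟩ := proj_surjective (n + 1) x
  have h : proj (n + 1) (hbar • x) = 0 := by rw [hx, map_zero]
  rw [map_smul, ha] at h
  obtain ⟨b, hb⟩ := Ideal.Quotient.eq_zero_iff_mem.mp
    (show Ideal.Quotient.mk (hIdeal A (n + 1)) (hbar • a) = 0 from h)
  have hab : a = hbar ^ n • b := by
    refine sub_eq_zero.mp (hA _ ?_)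
    rw [smul_sub, hb, smul_smul, ← pow_succ', sub_self]
  rw [← factor_proj x (Nat.le_succ n), ha, hab, map_zero]
  exact Ideal.Quotient.eq_zero_iff_mem.mpr ⟨b, rfl⟩

end HComp

theorem q_sub_smul_injective (hA : ∀ a : A, hbar • a = 0 → a = 0) {x y : HComp A}
    (h : (q - q⁻¹) • x = (q - q⁻¹) • y) : x = y := by
  rw [← sub_eq_zero, ← smul_sub, ← hbar_mul_qDiv, mul_smul] at h
  have h' := HComp.hbar_smul_injective hA h
  have h'' := congrArg (qDiv⁻¹ • ·) h'
  simp only [smul_smul, PowerSeries.inv_mul_cancel _ constantCoeff_qDiv, one_smul, smul_zero] at h''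
  exact sub_eq_zero.mp h''

theorem qBracket_neg (x : HComp A) : qBracket (-x) = -qBracket x := by
  have h := HComp.linearMap_hsum (-LinearMap.id : HComp A →ₗ[Kh] HComp A) fun i =>
    PowerSeries.C (((i + 1).factorial : ℂ)⁻¹) • (x ^ (i + 1) - (-x) ^ (i + 1))
  simp only [LinearMap.neg_apply, LinearMap.id_apply, ← smul_neg, neg_sub] at h
  rw [qBracket, qBracket, ← smul_neg, h, neg_neg]

/-- After multiplication by `q - q⁻¹` this is the multiplicativity of exponentials, but `HComp A`
may have torsion. The identity is therefore proved for the generators of a polynomial algebra in two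
variables, the monoid algebra of `ℕ × ℕ`, where `q - q⁻¹` can be cancelled, and then transported
along the map sending them to `x` and `y`. -/
theorem qBracket_add {x y : HComp A} (h : Commute x y) :
    qBracket (x + y) = qBracket x * HComp.hexp (-y) + HComp.hexp x * qBracket y := by
  classical
  let P := MonoidAlgebra Kh (Multiplicative ℕ × Multiplicative ℕ)
  let φ : P →ₐ[Kh] HComp A := MonoidAlgebra.lift Kh (HComp A) _
    (MonoidHom.noncommCoprod (powersHom _ x) (powersHom _ y) fun m n => by
      simpa [powersHom_apply] using h.pow_pow _ _)
  let X : P := MonoidAlgebra.of Kh _ (Multiplicative.ofAdd 1, 1)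
  let Y : P := MonoidAlgebra.of Kh _ (1, Multiplicative.ofAdd 1)
  have hX : HComp.lift φ (HComp.of P X) = x := by
    rw [HComp.lift_of, MonoidAlgebra.lift_of]; simp
  have hY : HComp.lift φ (HComp.of P Y) = y := by
    rw [HComp.lift_of, MonoidAlgebra.lift_of]; simp
  have hP : ∀ a : P, hbar • a = 0 → a = 0 := by
    intro a ha
    exact (smul_eq_zero.mp ha).resolve_left PowerSeries.X_ne_zero
  have hXY : Commute (HComp.of P X) (HComp.of P Y) := (Commute.all X Y).map (HComp.of P)
  have key : qBracket (HComp.of P X + HComp.of P Y) =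
      qBracket (HComp.of P X) * HComp.hexp (-HComp.of P Y) +
        HComp.hexp (HComp.of P X) * qBracket (HComp.of P Y) := by
    refine q_sub_smul_injective hP ?_
    rw [smul_add, ← smul_mul_assoc, ← mul_smul_comm, smul_qBracket, smul_qBracket, smul_qBracket,
      neg_add, HComp.hexp_add hXY, HComp.hexp_add hXY.neg_left.neg_right]
    noncomm_ring
  have := congrArg (HComp.lift φ) key
  simpa only [map_add, map_mul, map_neg, HComp.algHom_hexp, HComp.algHom_qBracket, hX, hY] using this

end

/-! ### Completed super tensor products: sign rules and homomorphisms -/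

section

variable {A : Type} [Ring A] [Algebra Kh A] [SuperAlgebra A]
variable {B : Type} [Ring B] [Algebra Kh B] [SuperAlgebra B]
variable {C : Type} [Ring C] [Algebra Kh C]

theorem exists_even_add_odd (a : A) : ∃ b c, parity b = b ∧ parity c = -c ∧ a = b + c := by
  refine ⟨evenPart a, oddPart a, mem_part_zero.mp (evenPart a).2, mem_part_one.mp (oddPart a).2, ?_⟩
  rw [evenPart_apply, oddPart_apply, ← smul_add, add_add_sub_cancel, smul_add, half_add_half]

theorem ct_add (a : A) (b b' : B) : ct a (b + b') = ct a b + ct a b' :=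
  map_add (ctBilin A B a) b b'

theorem add_ct (a a' : A) (b : B) : ct (a + a') b = ct a b + ct a' b :=
  LinearMap.map_add₂ (ctBilin A B) a a' b

theorem ct_sub (a : A) (b b' : B) : ct a (b - b') = ct a b - ct a b' :=
  map_sub (ctBilin A B a) b b'

theorem sub_ct (a a' : A) (b : B) : ct (a - a') b = ct a b - ct a' b :=
  LinearMap.map_sub₂ (ctBilin A B) a a' b

theorem ct_neg (a : A) (b : B) : ct a (-b) = -ct a b := map_neg (ctBilin A B a) b

theorem neg_ct (a : A) (b : B) : ct (-a) b = -ct a b := LinearMap.map_neg₂ (ctBilin A B) a b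

theorem ct_smul (r : Kh) (a : A) (b : B) : ct a (r • b) = r • ct a b :=
  map_smul (ctBilin A B a) r b

theorem smul_ct (r : Kh) (a : A) (b : B) : ct (r • a) b = r • ct a b :=
  LinearMap.map_smul₂ (ctBilin A B) r a b

theorem ct_zero (a : A) : ct a (0 : B) = 0 := map_zero (ctBilin A B a)

theorem zero_ct (b : B) : ct (0 : A) b = 0 := LinearMap.map_zero₂ (ctBilin A B) b

theorem ct_one_one : ct (1 : A) (1 : B) = 1 := rfl

theorem ct_mul_ct {i j : ZMod 2} (a : A) {b : B} (hb : b ∈ part B i) {c : A} (hc : c ∈ part A j)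
    (d : B) : ct a b * ct c d = (-1 : ℤˣ) ^ (i * j) • ct (a * c) (b * d) := by
  have h := GradedTensorProduct.tmul_coe_mul_coe_tmul (R := Kh) (part A) (part B) a ⟨b, hb⟩
    ⟨c, hc⟩ d
  rw [ct, ct, ← map_mul, h, Units.smul_def, Units.smul_def, map_zsmul]
  rfl

/-- The product `(a ⊗ b) (c ⊗ d)` for `b` even. -/
theorem ct_mul_of_even_left (a c : A) {b : B} (hb : parity b = b) (d : B) :
    ct a b * ct c d = ct (a * c) (b * d) := by
  obtain ⟨c₀, c₁, h₀, h₁, rfl⟩ := exists_even_add_odd c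
  rw [add_ct, mul_add, mul_add, add_ct, ct_mul_ct a (mem_part_zero.mpr hb) (mem_part_zero.mpr h₀),
    ct_mul_ct a (mem_part_zero.mpr hb) (mem_part_one.mpr h₁)]
  simp only [zero_mul, uzpow_zero, one_smul]

/-- The product `(a ⊗ b) (c ⊗ d)` for `b` odd. -/
theorem ct_mul_of_odd_left (a c : A) {b : B} (hb : parity b = -b) (d : B) :
    ct a b * ct c d = ct (a * parity c) (b * d) := by
  obtain ⟨c₀, c₁, h₀, h₁, rfl⟩ := exists_even_add_odd c
  rw [add_ct, mul_add, map_add, mul_add, add_ct,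
    ct_mul_ct a (mem_part_one.mpr hb) (mem_part_zero.mpr h₀),
    ct_mul_ct a (mem_part_one.mpr hb) (mem_part_one.mpr h₁), h₀, h₁]
  simp only [mul_zero, mul_one, uzpow_zero, uzpow_one, one_smul, Units.neg_smul, mul_neg, neg_ct]

/-- The product `(a ⊗ b) (c ⊗ d)` for `c` even. -/
theorem ct_mul_of_even_right (a : A) {c : A} (hc : parity c = c) (b d : B) :
    ct a b * ct c d = ct (a * c) (b * d) := by
  obtain ⟨b₀, b₁, h₀, h₁, rfl⟩ := exists_even_add_odd b
  rw [ct_add, add_mul, add_mul, ct_add, ct_mul_of_even_left _ _ h₀, ct_mul_of_odd_left _ _ h₁, hc]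

/-- The product `(a ⊗ b) (c ⊗ d)` for `c` odd. -/
theorem ct_mul_of_odd_right (a : A) {c : A} (hc : parity c = -c) (b d : B) :
    ct a b * ct c d = ct (a * c) (parity b * d) := by
  obtain ⟨b₀, b₁, h₀, h₁, rfl⟩ := exists_even_add_odd b
  rw [ct_add, add_mul, map_add, add_mul, ct_add, ct_mul_of_even_left _ _ h₀,
    ct_mul_of_odd_left _ _ h₁, hc, h₀, h₁]
  simp only [mul_neg, neg_mul, neg_ct, ct_neg]

theorem ct_mul_of_odd_odd (a : A) {c : A} (hc : parity c = -c) {b : B} (hb : parity b = -b)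
    (d : B) : ct a b * ct c d = -ct (a * c) (b * d) := by
  rw [ct_mul_of_odd_right _ hc, hb, neg_mul, ct_neg]

theorem parity_ct (a : A) (b : B) : parity (ct a b) = ct (parity a) (parity b) := by
  change HComp.of _ (GradedTensorProduct.lift _ _ _ _ (parity_anti A B) _) = _
  rw [GradedTensorProduct.lift_tmul]
  simp only [AlgHom.comp_apply, GradedTensorProduct.includeLeft_apply,
    GradedTensorProduct.includeRight_apply]
  rw [GradedTensorProduct.tmul_one_mul_one_tmul]
  rfl

theorem flip_ct_of_even_left {a : A} (ha : parity a = a) (b : B) : flip (ct a b) = ct b a := by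
  obtain ⟨b₀, b₁, h₀, h₁, rfl⟩ := exists_even_add_odd b
  have e₀ := flip_ct (⟨a, mem_part_zero.mpr ha⟩ : part A 0) (⟨b₀, mem_part_zero.mpr h₀⟩ : part B 0)
  have e₁ := flip_ct (⟨a, mem_part_zero.mpr ha⟩ : part A 0) (⟨b₁, mem_part_one.mpr h₁⟩ : part B 1)
  simp only [zero_mul, uzpow_zero, one_smul] at e₀ e₁
  rw [ct_add, map_add, e₀, e₁, add_ct]

theorem flip_ct_of_even_right (a : A) {b : B} (hb : parity b = b) : flip (ct a b) = ct b a := by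
  obtain ⟨a₀, a₁, h₀, h₁, rfl⟩ := exists_even_add_odd a
  have e₁ := flip_ct (⟨a₁, mem_part_one.mpr h₁⟩ : part A 1) (⟨b, mem_part_zero.mpr hb⟩ : part B 0)
  simp only [mul_zero, uzpow_zero, one_smul] at e₁
  rw [add_ct, map_add, flip_ct_of_even_left h₀, e₁, ct_add]

theorem flip_ct_of_odd_odd {a : A} (ha : parity a = -a) {b : B} (hb : parity b = -b) :
    flip (ct a b) = -ct b a := by
  have e := flip_ct (⟨a, mem_part_one.mpr ha⟩ : part A 1) (⟨b, mem_part_one.mpr hb⟩ : part B 1)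
  simpa only [mul_one, uzpow_one, Units.neg_smul, one_smul] using e

/-- Pure tensors span the uncompleted tensor product, which is dense. -/
theorem ctensor_linearMap_ext {M : Type*} [AddCommGroup M] [Module Kh M] [HSeparated M]
    {f g : CTensor A B →ₗ[Kh] M} (h : ∀ a b, f (ct a b) = g (ct a b)) : f = g := by
  refine HComp.linearMap_ext fun x => ?_
  have : (f ∘ₗ (HComp.of (STensor A B)).toLinearMap) ∘ₗ
      (GradedTensorProduct.of Kh (part A) (part B)).toLinearMap =
      (g ∘ₗ (HComp.of (STensor A B)).toLinearMap) ∘ₗ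
      (GradedTensorProduct.of Kh (part A) (part B)).toLinearMap :=
    TensorProduct.ext' h
  exact LinearMap.congr_fun this x

theorem ctensor_ext_apply {M : Type*} [AddCommGroup M] [Module Kh M] [HSeparated M]
    {f g : CTensor A B →ₗ[Kh] M} (h : ∀ a b, f (ct a b) = g (ct a b)) (x : CTensor A B) :
    f x = g x := by
  rw [ctensor_linearMap_ext h]

variable (A B) in
/-- The embedding `a ↦ a ⊗ 1`. -/
def ctLeft : A →ₐ[Kh] CTensor A B :=
  (HComp.of (STensor A B)).comp (GradedTensorProduct.includeLeft (part A) (part B))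

variable (A B) in
/-- The embedding `b ↦ 1 ⊗ b`. -/
def ctRight : B →ₐ[Kh] CTensor A B :=
  (HComp.of (STensor A B)).comp (GradedTensorProduct.includeRight (part A) (part B))

theorem ctLeft_apply (a : A) : ctLeft A B a = ct a 1 := rfl

theorem ctRight_apply (b : B) : ctRight A B b = ct 1 b := rfl

theorem parity_ctLeft (a : A) : ctLeft A B (parity a) = parity (ctLeft A B a) := by
  rw [ctLeft_apply, ctLeft_apply, parity_ct, map_one]

theorem parity_ctRight (b : B) : ctRight A B (parity b) = parity (ctRight A B b) := by
  rw [ctRight_apply, ctRight_apply, parity_ct, map_one]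

/-- The algebra homomorphism `a ⊗ b ↦ f(a) g(b)` for supercommuting `f` and `g`. -/
def ctAlgLift (f : A →ₐ[Kh] HComp C) (g : B →ₐ[Kh] HComp C)
    (h₀ : ∀ a, parity a = a → ∀ b, f a * g b = g b * f a)
    (h₁ : ∀ a, parity a = -a → ∀ b, f a * g b = g (parity b) * f a) :
    CTensor A B →ₐ[Kh] HComp C :=
  HComp.lift (GradedTensorProduct.lift (part A) (part B) f g (by
    intro i j a b
    rcases (by decide : ∀ i : ZMod 2, i = 0 ∨ i = 1) i with rfl | rfl
    · rw [h₀ a (mem_part_zero.mp a.2), mul_zero, uzpow_zero, one_smul]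
    · rw [h₁ a (mem_part_one.mp a.2), mem_part.mp b.2, mul_one, Units.smul_def, Units.smul_def,
        map_zsmul, smul_mul_assoc]))

theorem ctAlgLift_ct (f : A →ₐ[Kh] HComp C) (g : B →ₐ[Kh] HComp C) (h₀ h₁) (a : A) (b : B) :
    ctAlgLift f g h₀ h₁ (ct a b) = f a * g b := rfl

variable {A' : Type} [Ring A'] [Algebra Kh A'] [SuperAlgebra A']

/-- The algebra homomorphism `a ⊗ b ↦ f(a) ⊗ b`. -/
def ctMapLeft (f : A →ₐ[Kh] A') (hf : ∀ a, f (parity a) = parity (f a)) :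
    CTensor A B →ₐ[Kh] CTensor A' B :=
  ctAlgLift ((ctLeft A' B).comp f) (ctRight A' B)
    (by
      intro a ha b
      rw [AlgHom.comp_apply, ctLeft_apply, ctRight_apply, ct_mul_of_even_right _ (map_one _),
        ct_mul_of_even_right _ (by rw [← hf, ha])]
      simp only [one_mul, mul_one])
    (by
      intro a ha b
      rw [AlgHom.comp_apply, ctLeft_apply, ctRight_apply, ctRight_apply,
        ct_mul_of_even_right _ (map_one _),
        ct_mul_of_odd_right _ (by rw [← hf, ha, map_neg]), parity_parity]
      simp only [one_mul, mul_one])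

theorem ctMapLeft_ct (f : A →ₐ[Kh] A') (hf : ∀ a, f (parity a) = parity (f a)) (a : A) (b : B) :
    ctMapLeft f hf (ct a b) = ct (f a) b := by
  rw [ctMapLeft, ctAlgLift_ct, AlgHom.comp_apply, ctLeft_apply, ctRight_apply,
    ct_mul_of_even_right _ (map_one _), one_mul, mul_one]

/-- The first leg supercommutes with the last two legs. This is the hypothesis under which
`ctAlgLift` makes `id ⊗ Δ` an algebra homomorphism. -/
theorem ct_one_mul_leg23 {D : Type} [Ring D] [Algebra Kh D] [SuperAlgebra D] (a : A)
    (z : CTensor B D) :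
    (parity a = a → ct (ct a 1) 1 * ctMapLeft (ctRight A B) parity_ctRight z =
      ctMapLeft (ctRight A B) parity_ctRight z * ct (ct a 1) 1) ∧
    (parity a = -a → ct (ct a 1) 1 * ctMapLeft (ctRight A B) parity_ctRight z =
      ctMapLeft (ctRight A B) parity_ctRight (parity z) * ct (ct a 1) 1) := by
  have hpar : parity (ct a (1 : B)) = ct (parity a) 1 := by rw [parity_ct, map_one]
  constructor
  · intro ha
    refine ctensor_ext_apply
      (f := LinearMap.mulLeft Kh (ct (ct a 1) 1) ∘ₗ
        (ctMapLeft (B := D) (ctRight A B) parity_ctRight).toLinearMap)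
      (g := LinearMap.mulRight Kh (ct (ct a 1) 1) ∘ₗ
        (ctMapLeft (B := D) (ctRight A B) parity_ctRight).toLinearMap)
      (fun b d => ?_) z
    simp only [LinearMap.comp_apply, LinearMap.mulLeft_apply, LinearMap.mulRight_apply,
      AlgHom.toLinearMap_apply, ctMapLeft_ct, ctRight_apply]
    rw [ct_mul_of_even_left _ _ (map_one _), ct_mul_of_even_left _ _ (map_one _),
      ct_mul_of_even_right _ (by rw [hpar, ha]), ct_mul_of_even_right _ ha]
    simp only [one_mul, mul_one]
  · intro ha
    refine ctensor_ext_apply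
      (f := LinearMap.mulLeft Kh (ct (ct a 1) 1) ∘ₗ
        (ctMapLeft (B := D) (ctRight A B) parity_ctRight).toLinearMap)
      (g := LinearMap.mulRight Kh (ct (ct a 1) 1) ∘ₗ
        (ctMapLeft (B := D) (ctRight A B) parity_ctRight).toLinearMap ∘ₗ
        (parity (A := CTensor B D)).toLinearMap)
      (fun b d => ?_) z
    simp only [LinearMap.comp_apply, LinearMap.mulLeft_apply, LinearMap.mulRight_apply,
      AlgHom.toLinearMap_apply, ctMapLeft_ct, ctRight_apply, parity_ct]
    rw [ct_mul_of_even_left _ _ (map_one _), ct_mul_of_even_left _ _ (map_one _),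
      ct_mul_of_odd_right _ (by rw [hpar, ha, neg_ct]), ct_mul_of_odd_right _ ha]
    simp only [one_mul, mul_one, parity_parity]

end

/-! ### Leg embeddings and structure maps as algebra homomorphisms -/

section

variable {T : Type} [Ring T] [Algebra Kh T] [SuperAlgebra T]

variable (T) in
/-- `leg13` as an algebra homomorphism. -/
def leg13Alg : CTensor (HComp T) (HComp T) →ₐ[Kh] CTensor3 T :=
  ctMapLeft (ctLeft (HComp T) (HComp T)) parity_ctLeft

variable (T) in
/-- `leg23` as an algebra homomorphism. -/
def leg23Alg : CTensor (HComp T) (HComp T) →ₐ[Kh] CTensor3 T :=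
  ctMapLeft (ctRight (HComp T) (HComp T)) parity_ctRight

variable (T) in
/-- `leg12` as an algebra homomorphism. -/
def leg12Alg : CTensor (HComp T) (HComp T) →ₐ[Kh] CTensor3 T :=
  ctLeft (CTensor (HComp T) (HComp T)) (HComp T)

theorem leg12_eq (x : CTensor (HComp T) (HComp T)) : leg12 x = leg12Alg T x := rfl

theorem leg13_eq (x : CTensor (HComp T) (HComp T)) : leg13 x = leg13Alg T x := by
  refine ctensor_ext_apply (f := leg13) (g := (leg13Alg T).toLinearMap) (fun a b => ?_) x
  rw [leg13_ct, AlgHom.toLinearMap_apply, leg13Alg, ctMapLeft_ct, ctLeft_apply]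

theorem leg23_eq (x : CTensor (HComp T) (HComp T)) : leg23 x = leg23Alg T x := by
  refine ctensor_ext_apply (f := leg23) (g := (leg23Alg T).toLinearMap) (fun a b => ?_) x
  rw [leg23_ct, AlgHom.toLinearMap_apply, leg23Alg, ctMapLeft_ct, ctRight_apply]

namespace HopfData

variable (D : HopfData T)

/-- `Δ ⊗ id` as an algebra homomorphism. -/
def comulIdAlg (h : ∀ x, D.comul (parity x) = parity (D.comul x)) :
    CTensor (HComp T) (HComp T) →ₐ[Kh] CTensor3 T :=
  ctMapLeft D.comul h

theorem comulId_eq (h : ∀ x, D.comul (parity x) = parity (D.comul x))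
    (x : CTensor (HComp T) (HComp T)) : D.comulId x = D.comulIdAlg h x := by
  refine ctensor_ext_apply (f := D.comulId) (g := (D.comulIdAlg h).toLinearMap) (fun a b => ?_) x
  rw [comulId_ct, AlgHom.toLinearMap_apply, comulIdAlg, ctMapLeft_ct]

/-- `id ⊗ Δ` as an algebra homomorphism. -/
def idComulAlg (h : ∀ x, D.comul (parity x) = parity (D.comul x)) :
    CTensor (HComp T) (HComp T) →ₐ[Kh] CTensor3 T :=
  ctAlgLift ((leg12Alg T).comp (ctLeft _ _)) ((leg23Alg T).comp D.comul)
    (by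
      intro a ha b
      rw [AlgHom.comp_apply, AlgHom.comp_apply]
      exact (ct_one_mul_leg23 a (D.comul b)).1 ha)
    (by
      intro a ha b
      rw [AlgHom.comp_apply, AlgHom.comp_apply, AlgHom.comp_apply, h]
      exact (ct_one_mul_leg23 a (D.comul b)).2 ha)

theorem idComul_eq (h : ∀ x, D.comul (parity x) = parity (D.comul x))
    (x : CTensor (HComp T) (HComp T)) : D.idComul x = D.idComulAlg h x := by
  refine ctensor_ext_apply (f := D.idComul) (g := (D.idComulAlg h).toLinearMap) (fun a b => ?_) x
  rw [idComul_ct, AlgHom.toLinearMap_apply, idComulAlg, ctAlgLift_ct, leg23_eq]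
  rfl

theorem counit_eq_zero_of_odd (h : ∀ x, D.counit (parity x) = D.counit x) {a : HComp T}
    (ha : parity a = -a) : D.counit a = 0 := by
  have h' := h a
  rw [ha, map_neg, neg_eq_iff_add_eq_zero, ← two_mul] at h'
  refine (mul_eq_zero.mp h').resolve_left fun h2 => ?_
  have h3 := congrArg PowerSeries.constantCoeff h2
  rw [map_ofNat, map_zero] at h3
  exact two_ne_zero h3

/-- `ε ⊗ id` as an algebra homomorphism. -/
def counitIdAlg (h : ∀ x, D.counit (parity x) = D.counit x) :
    CTensor (HComp T) (HComp T) →ₐ[Kh] HComp T :=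
  ctAlgLift ((Algebra.ofId Kh (HComp T)).comp D.counit) (AlgHom.id _ _)
    (by
      intro a _ b
      rw [AlgHom.comp_apply, Algebra.ofId_apply, Algebra.commutes])
    (by
      intro a ha b
      rw [AlgHom.comp_apply, D.counit_eq_zero_of_odd h ha, map_zero, zero_mul, mul_zero])

theorem counitId_eq (h : ∀ x, D.counit (parity x) = D.counit x)
    (x : CTensor (HComp T) (HComp T)) : D.counitId x = D.counitIdAlg h x := by
  refine ctensor_ext_apply (f := D.counitId) (g := (D.counitIdAlg h).toLinearMap) (fun a b => ?_) x
  rw [counitId_ct, AlgHom.toLinearMap_apply, counitIdAlg, ctAlgLift_ct, AlgHom.comp_apply,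
    Algebra.ofId_apply, Algebra.smul_def, AlgHom.id_apply]

/-- `id ⊗ ε` as an algebra homomorphism. -/
def idCounitAlg (h : ∀ x, D.counit (parity x) = D.counit x) :
    CTensor (HComp T) (HComp T) →ₐ[Kh] HComp T :=
  ctAlgLift (AlgHom.id _ _) ((Algebra.ofId Kh (HComp T)).comp D.counit)
    (by
      intro a _ b
      rw [AlgHom.comp_apply, Algebra.ofId_apply, Algebra.commutes])
    (by
      intro a ha b
      rw [AlgHom.comp_apply, AlgHom.comp_apply, h, Algebra.ofId_apply, Algebra.commutes])

theorem idCounit_eq (h : ∀ x, D.counit (parity x) = D.counit x)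
    (x : CTensor (HComp T) (HComp T)) : D.idCounit x = D.idCounitAlg h x := by
  refine ctensor_ext_apply (f := D.idCounit) (g := (D.idCounitAlg h).toLinearMap) (fun a b => ?_) x
  rw [idCounit_ct, AlgHom.toLinearMap_apply, idCounitAlg, ctAlgLift_ct, AlgHom.comp_apply,
    Algebra.ofId_apply, Algebra.smul_def, AlgHom.id_apply, Algebra.commutes]

end HopfData

end

/-! ### Complete algebras and the universal property of `U` -/

/-- An algebra is `ħ`-adically complete if it agrees with its completion. -/
class HComplete (C : Type) [Ring C] [Algebra Kh C] : Prop where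
  of_bijective : Function.Bijective (HComp.of C)

section

variable {A : Type} [Ring A] [Algebra Kh A] {C : Type} [Ring C] [Algebra Kh C]

/-- Separatedness is injectivity of the map to the completion. For surjectivity, a compatible family
of representatives is summed as the telescoping series of its differences. -/
theorem HComplete.of_sums [HSeparated C] (h : ∀ a : ℕ → C, ∃ s, ∀ n : ℕ, ∃ y,
    s = ∑ i ∈ Finset.range n, hbar ^ i • a i + hbar ^ n • y) : HComplete C := by
  refine ⟨(injective_iff_map_eq_zero (HComp.of C)).mpr fun a ha => HSeparated.eq_zero a fun n => ?_,
    fun x => ?_⟩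
  · have h' : HComp.proj n (HComp.of C a) = 0 := by rw [ha, map_zero]
    exact Ideal.Quotient.eq_zero_iff_mem.mp h'
  · choose b hb using fun m => HComp.proj_surjective m x
    have hstep : ∀ m, ∃ a, b (m + 1) - b m = hbar ^ m • a := by
      intro m
      have h := HComp.factor_proj x (Nat.le_succ m)
      rw [hb, hb] at h
      exact Ideal.Quotient.eq.mp h
    choose a ha using hstep
    obtain ⟨s, hs⟩ := h a
    refine ⟨b 0 + s, HComp.ext fun n => ?_⟩
    obtain ⟨y, hy⟩ := hs n
    have htel : ∑ i ∈ Finset.range n, hbar ^ i • a i = b n - b 0 := by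
      rw [← Finset.sum_range_sub]
      exact Finset.sum_congr rfl fun i _ => (ha i).symm
    rw [hb, hy, htel]
    change Ideal.Quotient.mk _ _ = _
    refine Ideal.Quotient.eq.mpr ⟨y, ?_⟩
    abel

instance : HComplete (HComp A) :=
  HComplete.of_sums fun a => ⟨HComp.hsum a, fun n => ⟨_, HComp.hsum_eq_add a n⟩⟩

instance : HSeparated (HComp A)ᵐᵒᵖ where
  eq_zero x h := MulOpposite.unop_injective <| HSeparated.eq_zero _ fun n => by
    obtain ⟨y, rfl⟩ := h n
    exact ⟨y.unop, rfl⟩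

instance : HComplete (HComp A)ᵐᵒᵖ :=
  HComplete.of_sums fun a => ⟨.op (HComp.hsum fun i => (a i).unop), fun n =>
    ⟨.op (HComp.hsum fun i => (a (i + n)).unop), MulOpposite.unop_injective <| by
      rw [MulOpposite.unop_add, Finset.unop_sum]
      exact HComp.hsum_eq_add (fun i => (a i).unop) n⟩⟩

instance : HComplete Kh :=
  HComplete.of_sums fun a => by
    -- In `∑ ħⁱ aᵢ` only the terms with `i ≤ m` contribute to the coefficient of `ħᵐ`.
    refine ⟨PowerSeries.mk fun m => ∑ i ∈ Finset.range (m + 1), PowerSeries.coeff (m - i) (a i),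
      fun n => ?_⟩
    suffices h : (hbar ^ n : Kh) ∣
        (PowerSeries.mk fun m => ∑ i ∈ Finset.range (m + 1), PowerSeries.coeff (m - i) (a i)) -
          ∑ i ∈ Finset.range n, hbar ^ i • a i by
      obtain ⟨y, hy⟩ := h
      exact ⟨y, by rw [smul_eq_mul, ← hy, add_sub_cancel]⟩
    refine PowerSeries.X_pow_dvd_iff.mpr fun m hm => ?_
    rw [map_sub, PowerSeries.coeff_mk, map_sum, sub_eq_zero]
    rw [← Finset.sum_subset (Finset.range_mono (show m + 1 ≤ n from hm))]
    · refine Finset.sum_congr rfl fun i hi => ?_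
      rw [smul_eq_mul, PowerSeries.coeff_X_pow_mul', if_pos (by simpa [Nat.lt_succ_iff] using hi)]
    · intro i _ hi
      rw [smul_eq_mul, PowerSeries.coeff_X_pow_mul', if_neg (by simp at hi; omega)]

/-- The extension to the completion of an algebra homomorphism to a complete algebra. -/
def completeLift [HComplete C] (f : A →ₐ[Kh] C) : HComp A →ₐ[Kh] C :=
  (AlgEquiv.ofBijective (HComp.of C) HComplete.of_bijective).symm.toAlgHom.comp (HComp.map f)

theorem completeLift_of [HComplete C] (f : A →ₐ[Kh] C) (a : A) :
    completeLift f (HComp.of A a) = f a := by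
  rw [completeLift, AlgHom.comp_apply, HComp.map_of]
  exact (AlgEquiv.ofBijective (HComp.of C) HComplete.of_bijective).symm_apply_apply (f a)

end

section UniversalProperty

variable {C : Type} [Ring C] [Algebra Kh C] [HComplete C]

/-- The homomorphism from the complete free algebra with given values on the generators. -/
def freeLift (g : Gen → C) : FreeU →ₐ[Kh] C := completeLift (FreeAlgebra.lift Kh g)

theorem freeLift_gen (g : Gen → C) (x : Gen) : freeLift g (gen x) = g x := by
  rw [freeLift, gen, completeLift_of, FreeAlgebra.lift_ι_apply]

/-- The homomorphism from `U` with given values on the generators. -/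
def uLift (g : Gen → C) (h : ∀ ⦃x y⦄, Rel x y → freeLift g x = freeLift g y) : U →ₐ[Kh] C :=
  completeLift (RingQuot.liftAlgHom Kh ⟨freeLift g, h⟩)

theorem uLift_genU (g : Gen → C) (h : ∀ ⦃x y⦄, Rel x y → freeLift g x = freeLift g y) (x : Gen) :
    uLift g h (genU x) = g x := by
  rw [uLift, genU, completeLift_of, RingQuot.liftAlgHom_mkAlgHom_apply, freeLift_gen]

end UniversalProperty

/-- The canonical map from the complete free algebra to `U`. -/
def freeToU : FreeU →ₐ[Kh] U := (HComp.of PreU).comp (RingQuot.mkAlgHom Kh Rel)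

theorem freeToU_gen (g : Gen) : freeToU (gen g) = genU g := rfl

theorem freeToU_rel {x y : FreeU} (h : Rel x y) : freeToU x = freeToU y :=
  congrArg (HComp.of PreU) (RingQuot.mkAlgHom_rel Kh h)

/-- Two completions are involved, that of the free algebra and that of its quotient. Approximating
in both to order `n` leaves a polynomial in the generators. -/
theorem exists_adjoin_add (x : U) (n : ℕ) :
    ∃ a ∈ Algebra.adjoin Kh (Set.range genU), ∃ y, x = a + hbar ^ n • y := by
  obtain ⟨p, y, rfl⟩ := HComp.exists_of_add x n
  obtain ⟨w, rfl⟩ := RingQuot.mkAlgHom_surjective Kh Rel p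
  obtain ⟨f, z, rfl⟩ := HComp.exists_of_add w n
  refine ⟨freeToU (HComp.of _ f), ?_, freeToU z + y, ?_⟩
  · have h : f ∈ Algebra.adjoin Kh (Set.range (FreeAlgebra.ι Kh (X := Gen))) := by
      rw [FreeAlgebra.adjoin_range_ι]; trivial
    have h' : freeToU.comp (HComp.of _) f ∈ (Algebra.adjoin Kh _).map (freeToU.comp (HComp.of _)) :=
      Subalgebra.mem_map.mpr ⟨f, h, rfl⟩
    rw [AlgHom.map_adjoin, ← Set.range_comp] at h'
    exact h'
  · rw [smul_add, ← add_assoc, ← map_smul, ← map_add]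
    rfl

/-- The subalgebra `V` is left free because for maps that are only linear the locus of agreement
need not be a subalgebra; a stronger multiplicative condition can then be used as `V`. -/
theorem u_linearMap_ext {M : Type*} [AddCommGroup M] [Module Kh M] [HSeparated M]
    {f g : U →ₗ[Kh] M} (V : Subalgebra Kh U) (hV : ∀ x, genU x ∈ V)
    (h : ∀ x ∈ V, f x = g x) (x : U) : f x = g x := by
  refine eq_of_hbar_pow fun n => ?_
  obtain ⟨a, ha, y, rfl⟩ := exists_adjoin_add x n
  have ha' : a ∈ V := Algebra.adjoin_le (Set.range_subset_iff.mpr hV) ha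
  exact ⟨f y - g y, by simp only [map_add, map_smul, h a ha', smul_sub]; abel⟩

theorem u_algHom_ext {C : Type*} [Ring C] [Algebra Kh C] [HSeparated C] {f g : U →ₐ[Kh] C}
    (h : ∀ x, f (genU x) = g (genU x)) : f = g := by
  ext x
  exact u_linearMap_ext (f := f.toLinearMap) (g := g.toLinearMap) (AlgHom.equalizer f g) h
    (fun _ hx => hx) x

/-! ### Relations in `U` -/

theorem freeToU_E : freeToU (gen .E) = E := rfl

theorem freeToU_F : freeToU (gen .F) = F := rfl

theorem freeToU_H₁ : freeToU (gen .H₁) = H₁ := rfl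

theorem freeToU_H₂ : freeToU (gen .H₂) = H₂ := rfl

theorem H₁_mul_H₂ : H₁ * H₂ = H₂ * H₁ := by
  simpa only [freeToU_E, freeToU_F, freeToU_H₁, freeToU_H₂, map_mul] using freeToU_rel Rel.H₁H₂

theorem H₁_mul_E : H₁ * E = E * (H₁ + 1) := by
  have h : H₁ * E - E * H₁ = E := by
    simpa only [freeToU_E, freeToU_F, freeToU_H₁, freeToU_H₂, map_mul, map_sub] using freeToU_rel Rel.H₁E
  rw [mul_add, mul_one, ← sub_eq_iff_eq_add', h]

theorem H₂_mul_E : H₂ * E = E * (H₂ - 1) := by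
  have h : H₂ * E - E * H₂ = -E := by
    simpa only [freeToU_E, freeToU_F, freeToU_H₁, freeToU_H₂, map_mul, map_sub, map_neg] using freeToU_rel Rel.H₂E
  rw [mul_sub, mul_one, sub_eq_add_neg, ← sub_eq_iff_eq_add', h]

theorem H₁_mul_F : H₁ * F = F * (H₁ - 1) := by
  have h : H₁ * F - F * H₁ = -F := by
    simpa only [freeToU_E, freeToU_F, freeToU_H₁, freeToU_H₂, map_mul, map_sub, map_neg] using freeToU_rel Rel.H₁F
  rw [mul_sub, mul_one, sub_eq_add_neg, ← sub_eq_iff_eq_add', h]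

theorem H₂_mul_F : H₂ * F = F * (H₂ + 1) := by
  have h : H₂ * F - F * H₂ = F := by
    simpa only [freeToU_E, freeToU_F, freeToU_H₁, freeToU_H₂, map_mul, map_sub] using freeToU_rel Rel.H₂F
  rw [mul_add, mul_one, ← sub_eq_iff_eq_add', h]

theorem E_mul_F_add : E * F + F * E = qBracket (H₁ + H₂) := by
  have h := freeToU_rel Rel.EF
  rw [HComp.algHom_qBracket] at h
  simpa only [freeToU_E, freeToU_F, freeToU_H₁, freeToU_H₂, map_mul, map_add] using h

theorem E_mul_E : E * E = 0 := by
  have h := freeToU_rel Rel.EE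
  rw [sq] at h
  simpa only [freeToU_E, freeToU_F, freeToU_H₁, freeToU_H₂, map_mul, map_zero] using h

theorem F_mul_F : F * F = 0 := by
  have h := freeToU_rel Rel.FF
  rw [sq] at h
  simpa only [freeToU_E, freeToU_F, freeToU_H₁, freeToU_H₂, map_mul, map_zero] using h

theorem q_smul_E_mul_F_add : (q - q⁻¹) • (E * F + F * E) = K - Kinv := by
  rw [E_mul_F_add, smul_qBracket, K, Kinv]

theorem H_commute (x : U) : Commute (H₁ + H₂) x := by
  refine u_linearMap_ext (f := LinearMap.mulLeft Kh (H₁ + H₂)) (g := LinearMap.mulRight Kh (H₁ + H₂))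
    (Subalgebra.centralizer Kh {H₁ + H₂}) (fun g => ?_) (fun y hy => ?_) x
  · refine Subalgebra.mem_centralizer_iff Kh |>.mpr fun y hy => ?_
    rw [Set.mem_singleton_iff] at hy
    subst hy
    cases g
    · change (H₁ + H₂) * E = E * (H₁ + H₂)
      rw [add_mul, H₁_mul_E, H₂_mul_E]; noncomm_ring
    · change (H₁ + H₂) * F = F * (H₁ + H₂)
      rw [add_mul, H₁_mul_F, H₂_mul_F]; noncomm_ring
    · change (H₁ + H₂) * H₁ = H₁ * (H₁ + H₂)
      rw [add_mul, mul_add, H₁_mul_H₂]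
    · change (H₁ + H₂) * H₂ = H₂ * (H₁ + H₂)
      rw [add_mul, mul_add, H₁_mul_H₂]
  · exact Subalgebra.mem_centralizer_iff Kh |>.mp hy _ rfl

theorem K_commute (x : U) : Commute K x := HComp.hexp_commute (H_commute x)

theorem Kinv_commute (x : U) : Commute Kinv x := HComp.hexp_commute (H_commute x).neg_left

theorem K_mul_Kinv : K * Kinv = 1 := HComp.hexp_mul_hexp_neg _

theorem Kinv_mul_K : Kinv * K = 1 := HComp.hexp_neg_mul_hexp _

/-! ### Parity -/

theorem parity_of {A : Type} [Ring A] [Algebra Kh A] [SuperAlgebra A] (a : A) :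
    parity (HComp.of A a) = HComp.of A (parity a) := rfl

theorem preParity_mk (x : FreeU) :
    preParity (RingQuot.mkAlgHom Kh Rel x) = RingQuot.mkAlgHom Kh Rel (freeParity x) := by
  rw [preParity, RingQuot.liftAlgHom_mkAlgHom_apply, AlgHom.comp_apply]

theorem parity_preU (x : PreU) : parity x = preParity x := rfl

theorem parity_genU (g : Gen) : parity (genU g) = freeToU (freeParity (gen g)) := by
  rw [genU, parity_of, parity_preU, preParity_mk, freeToU, AlgHom.comp_apply]

theorem parity_E : parity E = -E := by
  rw [E, parity_genU, freeParity_E, map_neg, freeToU_gen]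

theorem parity_F : parity F = -F := by
  rw [F, parity_genU, freeParity_F, map_neg, freeToU_gen]

theorem parity_H₁ : parity H₁ = H₁ := by
  rw [H₁, parity_genU, freeParity_H₁, freeToU_gen]

theorem parity_H₂ : parity H₂ = H₂ := by
  rw [H₂, parity_genU, freeParity_H₂, freeToU_gen]

theorem parity_K : parity K = K := by
  rw [K, HComp.algHom_hexp, map_add, parity_H₁, parity_H₂]

theorem parity_Kinv : parity Kinv = Kinv := by
  rw [Kinv, HComp.algHom_hexp, map_neg, map_add, parity_H₁, parity_H₂]

theorem hsum_zero {A : Type} [Ring A] [Algebra Kh A] : HComp.hsum (fun _ => (0 : HComp A)) = 0 :=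
  (HComp.eq_hsum fun n => ⟨0, by simp⟩).symm

theorem qBracket_zero {A : Type} [Ring A] [Algebra Kh A] : qBracket (0 : HComp A) = 0 := by
  simp [qBracket, hsum_zero]

theorem Kinv_mul (x : U) : Kinv * x = x * Kinv := (Kinv_commute x).eq

theorem K_mul (x : U) : K * x = x * K := (K_commute x).eq

/-! ### The comultiplication -/

/-- The values of `Δ` on the generators. -/
def comulGen : Gen → CTensor U U
  | .E => ct E Kinv + ct 1 E
  | .F => ct F 1 + ct K F
  | .H₁ => ct H₁ 1 + ct 1 H₁
  | .H₂ => ct H₂ 1 + ct 1 H₂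

theorem parity_one_eq : parity (1 : U) = 1 := map_one _

theorem hexp_ct_left (x : U) : HComp.hexp (ct x (1 : U)) = ct (HComp.hexp x) 1 := by
  rw [← ctLeft_apply, ← ctLeft_apply, HComp.algHom_hexp]

theorem hexp_ct_right (x : U) : HComp.hexp (ct (1 : U) x) = ct 1 (HComp.hexp x) := by
  rw [← ctRight_apply, ← ctRight_apply, HComp.algHom_hexp]

theorem qBracket_ct_left (x : U) : qBracket (ct x (1 : U)) = ct (qBracket x) 1 := by
  rw [← ctLeft_apply, ← ctLeft_apply, HComp.algHom_qBracket]

theorem qBracket_ct_right (x : U) : qBracket (ct (1 : U) x) = ct 1 (qBracket x) := by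
  rw [← ctRight_apply, ← ctRight_apply, HComp.algHom_qBracket]

theorem ct_left_commute_right {x : U} (hx : parity x = x) (y : U) : Commute (ct x 1) (ct 1 y) := by
  rw [Commute, SemiconjBy, ct_mul_of_even_left _ _ parity_one_eq, ct_mul_of_even_right _ hx]
  simp only [one_mul, mul_one]

theorem comulGen_rel ⦃x y : FreeU⦄ (h : Rel x y) : freeLift comulGen x = freeLift comulGen y := by
  cases h
  case H₁H₂ =>
    simp only [map_mul, freeLift_gen, comulGen, mul_add, add_mul,
      ct_mul_of_even_left _ _ parity_one_eq, ct_mul_of_even_left _ _ parity_H₁,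
      ct_mul_of_even_left _ _ parity_H₂, one_mul, mul_one, H₁_mul_H₂]
    abel
  case H₁E =>
    simp only [map_mul, map_sub, freeLift_gen, comulGen, mul_add, add_mul,
      ct_mul_of_even_left _ _ parity_one_eq, ct_mul_of_even_left _ _ parity_H₁,
      ct_mul_of_even_right _ parity_one_eq, ct_mul_of_even_right _ parity_H₁,
      one_mul, mul_one, H₁_mul_E, add_ct, ct_add, Kinv_mul H₁]
    abel
  case H₂E =>
    simp only [map_mul, map_sub, map_neg, freeLift_gen, comulGen, mul_add, add_mul, mul_sub,
      ct_mul_of_even_left _ _ parity_one_eq, ct_mul_of_even_left _ _ parity_H₂,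
      ct_mul_of_even_right _ parity_one_eq, ct_mul_of_even_right _ parity_H₂,
      one_mul, mul_one, H₂_mul_E, sub_ct, ct_sub, Kinv_mul H₂]
    abel
  case H₁F =>
    simp only [map_mul, map_sub, map_neg, freeLift_gen, comulGen, mul_add, add_mul, mul_sub,
      ct_mul_of_even_left _ _ parity_one_eq, ct_mul_of_even_left _ _ parity_H₁,
      ct_mul_of_even_right _ parity_one_eq, ct_mul_of_even_right _ parity_H₁,
      one_mul, mul_one, H₁_mul_F, sub_ct, ct_sub, K_mul H₁]
    abel
  case H₂F =>
    simp only [map_mul, map_sub, freeLift_gen, comulGen, mul_add, add_mul,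
      ct_mul_of_even_left _ _ parity_one_eq, ct_mul_of_even_left _ _ parity_H₂,
      ct_mul_of_even_right _ parity_one_eq, ct_mul_of_even_right _ parity_H₂,
      one_mul, mul_one, H₂_mul_F, add_ct, ct_add, K_mul H₂]
    abel
  -- The mixed terms of the anticommutator cancel by the sign rule and the centrality of `K`. What
  -- remains is `(EF + FE) ⊗ K⁻¹ + K ⊗ (EF + FE)`, which is the addition formula for the bracket.
  case EF =>
    have hH : ct H₁ 1 + ct (1 : U) H₁ + (ct H₂ 1 + ct 1 H₂) =
        ct (H₁ + H₂) (1 : U) + ct 1 (H₁ + H₂) := by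
      rw [add_ct, ct_add]; abel
    rw [HComp.algHom_qBracket]
    simp only [map_mul, map_add, freeLift_gen, comulGen]
    rw [hH, qBracket_add (ct_left_commute_right
      (by rw [map_add, parity_H₁, parity_H₂]) _), ← ct_neg, hexp_ct_left,
      hexp_ct_right, qBracket_ct_left, qBracket_ct_right, ← E_mul_F_add]
    change _ = _ * ct 1 Kinv + ct K 1 * _
    simp only [mul_add, add_mul, ct_mul_of_even_left _ _ parity_one_eq,
      ct_mul_of_even_left _ _ parity_Kinv, ct_mul_of_even_right _ parity_K,
      ct_mul_of_odd_odd _ parity_F parity_E, ct_mul_of_even_right _ parity_one_eq,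
      ct_mul_of_odd_odd _ parity_E parity_F,
      one_mul, mul_one, add_ct, ct_add, Kinv_mul F, K_mul E]
    abel
  case EE =>
    rw [sq]
    simp only [map_mul, map_zero, freeLift_gen, comulGen, mul_add, add_mul,
      ct_mul_of_even_left _ _ parity_Kinv,
      ct_mul_of_even_right _ parity_one_eq, ct_mul_of_odd_odd _ parity_E parity_E,
      one_mul, mul_one, E_mul_E, zero_ct, ct_zero, Kinv_mul E]
    abel
  case FF =>
    rw [sq]
    simp only [map_mul, map_zero, freeLift_gen, comulGen, mul_add, add_mul,
      ct_mul_of_even_left _ _ parity_one_eq, ct_mul_of_even_right _ parity_K,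
      ct_mul_of_odd_odd _ parity_F parity_F,
      one_mul, mul_one, F_mul_F, zero_ct, ct_zero, K_mul F]
    abel

/-! ### The counit -/

theorem counitGen_rel ⦃x y : FreeU⦄ (h : Rel x y) :
    freeLift (fun _ => (0 : Kh)) x = freeLift (fun _ => (0 : Kh)) y := by
  cases h
  case EF =>
    have h : freeLift (fun _ => (0 : Kh)) (qBracket (gen .H₁ + gen .H₂)) = 0 := by
      -- `algHom_qBracket` needs a completion as target, so the counit is followed by the injection
      -- of `ℂ[[ħ]]` into its completion.
      refine (HComplete.of_bijective (C := Kh)).injective ?_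
      have h' := HComp.algHom_qBracket ((HComp.of Kh).comp (freeLift fun _ => (0 : Kh)))
        (gen .H₁ + gen .H₂)
      rw [AlgHom.comp_apply, AlgHom.comp_apply, map_add, freeLift_gen, freeLift_gen, add_zero,
        map_zero, qBracket_zero] at h'
      rw [h', map_zero]
    rw [h]
    simp [freeLift_gen]
  all_goals simp [freeLift_gen]

/-! ### The antipode -/

/-- The imaginary unit as a constant power series. -/
def imag : Kh := PowerSeries.C Complex.I

theorem imag_mul_imag : imag * imag = -1 := by
  rw [imag, ← map_mul, Complex.I_mul_I, map_neg, map_one]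

/-- The values on the generators of an ordinary anti-homomorphism that agrees with the antipode up
to a factor `i` on odd elements. -/
def antiGen : Gen → Uᵐᵒᵖ
  | .E => .op (imag • -(E * K))
  | .F => .op (imag • -(Kinv * F))
  | .H₁ => .op (-H₁)
  | .H₂ => .op (-H₂)

theorem unop_algHom_qBracket {A B : Type} [Ring A] [Algebra Kh A] [Ring B] [Algebra Kh B]
    (f : HComp A →ₐ[Kh] (HComp B)ᵐᵒᵖ) (x : HComp A) :
    (f (qBracket x)).unop = qBracket (f x).unop := by
  have h := HComp.linearMap_hsum
    ((MulOpposite.opLinearEquiv Kh (M := HComp B)).symm.toLinearMap ∘ₗ f.toLinearMap)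
    fun i => PowerSeries.C (((i + 1).factorial : ℂ)⁻¹) • (x ^ (i + 1) - (-x) ^ (i + 1))
  simp only [LinearMap.comp_apply, AlgHom.toLinearMap_apply, LinearEquiv.coe_coe,
    MulOpposite.coe_opLinearEquiv_symm] at h
  rw [qBracket, qBracket, map_smul, MulOpposite.unop_smul, h]
  simp only [map_smul, map_sub, map_pow, map_neg, MulOpposite.unop_smul, MulOpposite.unop_sub,
    MulOpposite.unop_pow, MulOpposite.unop_neg]

theorem imag_smul_mul (x y : U) : (imag • x) * (imag • y) = -(x * y) := by
  rw [smul_mul_smul_comm, imag_mul_imag, neg_one_smul]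

/-- The sign of a super anti-homomorphism appears only on two odd factors, where `i · i = -1`
supplies it. The rescaled map is thus an ordinary homomorphism to the opposite algebra, and in the
`EF` relation this sign matches the oddness of the bracket. -/
theorem antiGen_rel ⦃x y : FreeU⦄ (h : Rel x y) : freeLift antiGen x = freeLift antiGen y := by
  refine MulOpposite.unop_injective ?_
  have hEK : E * K * (Kinv * F) = E * F := by
    rw [mul_assoc, ← mul_assoc K, K_mul_Kinv, one_mul]
  have hKE : Kinv * F * (E * K) = F * E := by
    rw [Kinv_mul F, mul_assoc, ← mul_assoc Kinv, Kinv_mul E, mul_assoc, Kinv_mul_K, mul_one]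
  cases h
  case EF =>
    rw [unop_algHom_qBracket]
    simp only [map_mul, map_add, freeLift_gen, antiGen, MulOpposite.unop_mul, MulOpposite.unop_add,
      MulOpposite.unop_op, imag_smul_mul, neg_mul_neg, hEK, hKE]
    rw [← neg_add, ← neg_add, qBracket_neg, ← E_mul_F_add, add_comm]
  case H₁H₂ =>
    simp only [map_mul, freeLift_gen, antiGen, MulOpposite.unop_mul, MulOpposite.unop_op,
      neg_mul_neg, H₁_mul_H₂]
  case H₁E =>
    simp only [map_mul, map_sub, freeLift_gen, antiGen, MulOpposite.unop_mul, MulOpposite.unop_sub,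
      MulOpposite.unop_op, smul_mul_assoc, mul_smul_comm, neg_mul_neg]
    rw [← smul_sub, mul_assoc, K_mul H₁, ← mul_assoc, ← mul_assoc, H₁_mul_E]
    congr 1
    noncomm_ring
  case H₂E =>
    simp only [map_mul, map_sub, map_neg, freeLift_gen, antiGen, MulOpposite.unop_mul,
      MulOpposite.unop_sub, MulOpposite.unop_neg,
      MulOpposite.unop_op, smul_mul_assoc, mul_smul_comm, neg_mul_neg]
    rw [← smul_sub, mul_assoc, K_mul H₂, ← mul_assoc, ← mul_assoc, H₂_mul_E, ← smul_neg]
    congr 1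
    noncomm_ring
  case H₁F =>
    simp only [map_mul, map_sub, map_neg, freeLift_gen, antiGen, MulOpposite.unop_mul,
      MulOpposite.unop_sub, MulOpposite.unop_neg,
      MulOpposite.unop_op, smul_mul_assoc, mul_smul_comm, neg_mul_neg]
    rw [← smul_sub, ← mul_assoc, ← Kinv_mul H₁, mul_assoc, mul_assoc, H₁_mul_F, ← smul_neg]
    congr 1
    noncomm_ring
  case H₂F =>
    simp only [map_mul, map_sub, freeLift_gen, antiGen, MulOpposite.unop_mul,
      MulOpposite.unop_sub,
      MulOpposite.unop_op, smul_mul_assoc, mul_smul_comm, neg_mul_neg]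
    rw [← smul_sub, ← mul_assoc, ← Kinv_mul H₂, mul_assoc, mul_assoc, H₂_mul_F]
    congr 1
    noncomm_ring
  case EE =>
    rw [sq]
    simp only [map_mul, map_zero, freeLift_gen, antiGen, MulOpposite.unop_mul,
      MulOpposite.unop_op, MulOpposite.unop_zero, imag_smul_mul, neg_mul_neg]
    rw [mul_assoc, ← mul_assoc K, K_mul E, mul_assoc E, ← mul_assoc, E_mul_E, zero_mul, neg_zero]
  case FF =>
    rw [sq]
    simp only [map_mul, map_zero, freeLift_gen, antiGen, MulOpposite.unop_mul,
      MulOpposite.unop_op, MulOpposite.unop_zero, imag_smul_mul, neg_mul_neg]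
    rw [mul_assoc, ← mul_assoc F, ← Kinv_mul F, mul_assoc Kinv F, F_mul_F, mul_zero, mul_zero,
      neg_zero]

/-- The ordinary anti-homomorphism given by `antiGen`. -/
def antiHom : U →ₐ[Kh] Uᵐᵒᵖ := uLift antiGen antiGen_rel

theorem antiHom_parity (x : U) : (antiHom (parity x)).unop = parity (antiHom x).unop := by
  have h : antiHom.comp parity = (AlgHom.op parity).comp antiHom := by
    refine u_algHom_ext fun g => ?_
    rw [AlgHom.comp_apply, AlgHom.comp_apply]
    cases g
    · change antiHom (parity E) = AlgHom.op parity (antiHom (genU .E))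
      rw [parity_E, map_neg]
      change -antiHom (genU .E) = _
      rw [antiHom, uLift_genU]
      refine MulOpposite.unop_injective ?_
      simp [antiGen, parity_E, parity_K]
    · change antiHom (parity F) = AlgHom.op parity (antiHom (genU .F))
      rw [parity_F, map_neg]
      change -antiHom (genU .F) = _
      rw [antiHom, uLift_genU]
      refine MulOpposite.unop_injective ?_
      simp [antiGen, parity_F, parity_Kinv]
    · change antiHom (parity H₁) = AlgHom.op parity (antiHom (genU .H₁))
      rw [parity_H₁]
      change antiHom (genU .H₁) = _
      rw [antiHom, uLift_genU]
      refine MulOpposite.unop_injective ?_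
      simp [antiGen, parity_H₁]
    · change antiHom (parity H₂) = AlgHom.op parity (antiHom (genU .H₂))
      rw [parity_H₂]
      change antiHom (genU .H₂) = _
      rw [antiHom, uLift_genU]
      refine MulOpposite.unop_injective ?_
      simp [antiGen, parity_H₂]
  exact congrArg MulOpposite.unop (DFunLike.congr_fun h x)

/-- The linear map that is `1` on even and `-i` on odd elements. -/
def twist : U →ₗ[Kh] U :=
  (part U 0).subtype ∘ₗ evenPart + (-imag) • ((part U 1).subtype ∘ₗ oddPart)

theorem twist_even {x : U} (hx : parity x = x) : twist x = x := by
  simp only [twist, LinearMap.add_apply, LinearMap.smul_apply, LinearMap.comp_apply,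
    Submodule.subtype_apply, evenPart_apply, oddPart_apply, hx, sub_self, smul_zero, add_zero]
  rw [smul_add, half_add_half]

theorem twist_odd {x : U} (hx : parity x = -x) : twist x = -imag • x := by
  simp only [twist, LinearMap.add_apply, LinearMap.smul_apply, LinearMap.comp_apply,
    Submodule.subtype_apply, evenPart_apply, oddPart_apply, hx, add_neg_cancel, smul_zero, zero_add,
    sub_neg_eq_add]
  rw [smul_add (PowerSeries.C _), half_add_half]

/-- The antipode. -/
def antipodeMap : U →ₗ[Kh] U :=
  twist ∘ₗ (MulOpposite.opLinearEquiv Kh (M := U)).symm.toLinearMap ∘ₗ antiHom.toLinearMap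

theorem antipodeMap_apply (x : U) : antipodeMap x = twist (antiHom x).unop := rfl

theorem antipodeMap_even {x : U} (hx : parity x = x) : antipodeMap x = (antiHom x).unop := by
  rw [antipodeMap_apply, twist_even]
  rw [← antiHom_parity, hx]

theorem antipodeMap_odd {x : U} (hx : parity x = -x) :
    antipodeMap x = -imag • (antiHom x).unop := by
  rw [antipodeMap_apply, twist_odd]
  rw [← antiHom_parity, hx, map_neg, MulOpposite.unop_neg]

/-- The structure maps of `U`. -/
def stdHopf : HopfData PreU where
  comul := uLift comulGen comulGen_rel
  counit := uLift (fun _ => 0) counitGen_rel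
  antipode := antipodeMap

theorem neg_imag_smul_imag_smul (x : U) : -imag • imag • x = x := by
  rw [neg_smul, smul_smul, imag_mul_imag, neg_one_smul, neg_neg]

theorem isStandard_stdHopf : IsStandard stdHopf where
  comul_E := uLift_genU _ _ _
  comul_F := uLift_genU _ _ _
  comul_H₁ := uLift_genU _ _ _
  comul_H₂ := uLift_genU _ _ _
  counit_E := uLift_genU _ _ _
  counit_F := uLift_genU _ _ _
  counit_H₁ := uLift_genU _ _ _
  counit_H₂ := uLift_genU _ _ _
  antipode_E := by
    change antipodeMap E = _
    rw [antipodeMap_odd parity_E, antiHom, E, uLift_genU, antiGen, MulOpposite.unop_op,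
      neg_imag_smul_imag_smul]
    rfl
  antipode_F := by
    change antipodeMap F = _
    rw [antipodeMap_odd parity_F, antiHom, F, uLift_genU, antiGen, MulOpposite.unop_op,
      neg_imag_smul_imag_smul]
    rfl
  antipode_H₁ := by
    change antipodeMap H₁ = _
    rw [antipodeMap_even parity_H₁, antiHom, H₁, uLift_genU, antiGen, MulOpposite.unop_op]
    rfl
  antipode_H₂ := by
    change antipodeMap H₂ = _
    rw [antipodeMap_even parity_H₂, antiHom, H₂, uLift_genU, antiGen, MulOpposite.unop_op]
    rfl
  antipode_one := by
    change antipodeMap 1 = 1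
    rw [antipodeMap_even parity_one_eq, map_one, MulOpposite.unop_one]
  antipode_mul := by
    intro i j x hx y hy
    change antipodeMap (x * y) = _ • (antipodeMap y * antipodeMap x)
    rcases (by decide : ∀ i : ZMod 2, i = 0 ∨ i = 1) i with rfl | rfl <;>
    rcases (by decide : ∀ i : ZMod 2, i = 0 ∨ i = 1) j with rfl | rfl <;>
    simp only [mem_part_zero, mem_part_one] at hx hy
    · rw [antipodeMap_even hx, antipodeMap_even hy,
        antipodeMap_even (by rw [map_mul, hx, hy]), map_mul, MulOpposite.unop_mul, mul_zero,
        uzpow_zero, one_smul]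
    · rw [antipodeMap_even hx, antipodeMap_odd hy,
        antipodeMap_odd (by rw [map_mul, hx, hy, mul_neg]), map_mul, MulOpposite.unop_mul, zero_mul,
        uzpow_zero, one_smul, smul_mul_assoc]
    · rw [antipodeMap_odd hx, antipodeMap_even hy,
        antipodeMap_odd (by rw [map_mul, hx, hy, neg_mul]), map_mul, MulOpposite.unop_mul, mul_zero,
        uzpow_zero, one_smul, mul_smul_comm]
    · rw [antipodeMap_odd hx, antipodeMap_odd hy,
        antipodeMap_even (by rw [map_mul, hx, hy, neg_mul_neg]), map_mul, MulOpposite.unop_mul,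
        mul_one, uzpow_one, Units.neg_smul, one_smul, neg_smul, neg_smul, neg_mul_neg,
        imag_smul_mul, neg_neg]

/-- Since `idComul` is defined by a product, this returns its values to pure tensors. -/
theorem leg1_mul_leg23_ct {T : Type} [Ring T] [Algebra Kh T] [SuperAlgebra T] (a b c : HComp T) :
    ct (ct a 1) 1 * leg23 (ct b c) = ct (ct a b) c := by
  have h1 : parity (1 : HComp T) = 1 := map_one _
  rw [leg23_ct, ct_mul_of_even_left _ _ h1, ct_mul_of_even_left _ _ h1, one_mul, one_mul, mul_one]

/-! ### Uniqueness of the structure maps and the Hopf axioms -/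

namespace IsStandard

variable {D D' : HopfData PreU}

theorem comul_genU (hD : IsStandard D) (g : Gen) : D.comul (genU g) = comulGen g := by
  cases g
  exacts [hD.comul_E, hD.comul_F, hD.comul_H₁, hD.comul_H₂]

theorem counit_genU (hD : IsStandard D) (g : Gen) : D.counit (genU g) = 0 := by
  cases g
  exacts [hD.counit_E, hD.counit_F, hD.counit_H₁, hD.counit_H₂]

theorem antipode_mul_of_even_left (hD : IsStandard D) {x : U} (hx : parity x = x) (y : U) :
    D.antipode (x * y) = D.antipode y * D.antipode x := by
  obtain ⟨y₀, y₁, h₀, h₁, rfl⟩ := exists_even_add_odd y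
  rw [mul_add, map_add, map_add, add_mul,
    hD.antipode_mul 0 0 x (mem_part_zero.mpr hx) y₀ (mem_part_zero.mpr h₀),
    hD.antipode_mul 0 1 x (mem_part_zero.mpr hx) y₁ (mem_part_one.mpr h₁)]
  simp only [zero_mul, uzpow_zero, one_smul]

theorem antipode_mul_of_odd_left (hD : IsStandard D) {x : U} (hx : parity x = -x) (y : U) :
    D.antipode (x * y) = D.antipode (parity y) * D.antipode x := by
  obtain ⟨y₀, y₁, h₀, h₁, rfl⟩ := exists_even_add_odd y
  rw [mul_add, map_add, map_add, map_add, add_mul, h₀, h₁,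
    hD.antipode_mul 1 0 x (mem_part_one.mpr hx) y₀ (mem_part_zero.mpr h₀),
    hD.antipode_mul 1 1 x (mem_part_one.mpr hx) y₁ (mem_part_one.mpr h₁)]
  simp only [mul_zero, mul_one, uzpow_zero, uzpow_one, one_smul, Units.neg_smul, map_neg, neg_mul]

theorem antipode_mul_of_even_right (hD : IsStandard D) (x : U) {y : U} (hy : parity y = y) :
    D.antipode (x * y) = D.antipode y * D.antipode x := by
  obtain ⟨x₀, x₁, h₀, h₁, rfl⟩ := exists_even_add_odd x
  rw [add_mul, map_add, map_add, mul_add, hD.antipode_mul_of_even_left h₀,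
    hD.antipode_mul_of_odd_left h₁, hy]

theorem antipode_mul_of_odd_right (hD : IsStandard D) (x : U) {y : U} (hy : parity y = -y) :
    D.antipode (x * y) = D.antipode y * D.antipode (parity x) := by
  obtain ⟨x₀, x₁, h₀, h₁, rfl⟩ := exists_even_add_odd x
  rw [add_mul, map_add, map_add, map_add, mul_add, hD.antipode_mul_of_even_left h₀,
    hD.antipode_mul_of_odd_left h₁, hy, h₀, h₁]
  simp only [map_neg, neg_mul, mul_neg]

theorem antipode_mul_genU (hD : IsStandard D) (hD' : IsStandard D') (g : Gen) (y : U)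
    (h : D.antipode y = D'.antipode y) (h' : D.antipode (parity y) = D'.antipode (parity y)) :
    D.antipode (genU g * y) = D'.antipode (genU g * y) ∧
      D.antipode (parity (genU g * y)) = D'.antipode (parity (genU g * y)) := by
  cases g
  · change D.antipode (E * y) = D'.antipode (E * y) ∧
      D.antipode (parity (E * y)) = D'.antipode (parity (E * y))
    rw [map_mul parity, parity_E, neg_mul, map_neg, map_neg, hD.antipode_mul_of_odd_left parity_E,
      hD.antipode_mul_of_odd_left parity_E, hD'.antipode_mul_of_odd_left parity_E,
      hD'.antipode_mul_of_odd_left parity_E, parity_parity, h, h', hD.antipode_E, hD'.antipode_E]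
    exact ⟨rfl, rfl⟩
  · change D.antipode (F * y) = D'.antipode (F * y) ∧
      D.antipode (parity (F * y)) = D'.antipode (parity (F * y))
    rw [map_mul parity, parity_F, neg_mul, map_neg, map_neg, hD.antipode_mul_of_odd_left parity_F,
      hD.antipode_mul_of_odd_left parity_F, hD'.antipode_mul_of_odd_left parity_F,
      hD'.antipode_mul_of_odd_left parity_F, parity_parity, h, h', hD.antipode_F, hD'.antipode_F]
    exact ⟨rfl, rfl⟩
  · change D.antipode (H₁ * y) = D'.antipode (H₁ * y) ∧
      D.antipode (parity (H₁ * y)) = D'.antipode (parity (H₁ * y))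
    rw [map_mul parity, parity_H₁, hD.antipode_mul_of_even_left parity_H₁,
      hD.antipode_mul_of_even_left parity_H₁, hD'.antipode_mul_of_even_left parity_H₁,
      hD'.antipode_mul_of_even_left parity_H₁, h, h', hD.antipode_H₁, hD'.antipode_H₁]
    exact ⟨rfl, rfl⟩
  · change D.antipode (H₂ * y) = D'.antipode (H₂ * y) ∧
      D.antipode (parity (H₂ * y)) = D'.antipode (parity (H₂ * y))
    rw [map_mul parity, parity_H₂, hD.antipode_mul_of_even_left parity_H₂,
      hD.antipode_mul_of_even_left parity_H₂, hD'.antipode_mul_of_even_left parity_H₂,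
      hD'.antipode_mul_of_even_left parity_H₂, h, h', hD.antipode_H₂, hD'.antipode_H₂]
    exact ⟨rfl, rfl⟩

theorem antipode_unique (hD : IsStandard D) (hD' : IsStandard D') : D.antipode = D'.antipode := by
  -- Moving an odd generator past `y` replaces `S(y)` by `S(parity y)`, so agreement must be carried
  -- along at both `y` and `parity y`.
  let W : Submodule Kh U := LinearMap.eqLocus D.antipode D'.antipode ⊓
    LinearMap.eqLocus (D.antipode ∘ₗ parity.toLinearMap) (D'.antipode ∘ₗ parity.toLinearMap)
  -- The left multipliers that preserve `W` form a subalgebra. It contains the generators, and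
  -- applying its elements to `1` recovers the agreement of the antipodes.
  let V : Subalgebra Kh U :=
    { carrier := {x | ∀ y ∈ W, x * y ∈ W}
      mul_mem' := fun {a b} ha hb y hy => by rw [mul_assoc]; exact ha _ (hb _ hy)
      add_mem' := fun {a b} ha hb y hy => by rw [add_mul]; exact W.add_mem (ha _ hy) (hb _ hy)
      algebraMap_mem' := fun r y hy => by rw [← Algebra.smul_def]; exact W.smul_mem r hy }
  have h1 : (1 : U) ∈ W := by
    have h : D.antipode 1 = D'.antipode 1 := by rw [hD.antipode_one, hD'.antipode_one]
    exact ⟨h, by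
      change D.antipode (parity 1) = D'.antipode (parity 1)
      rw [parity_one_eq, h]⟩
  refine LinearMap.ext fun x => ?_
  refine u_linearMap_ext (f := D.antipode) (g := D'.antipode) V (fun g y hy => ?_)
    (fun x hx => ?_) x
  · exact hD.antipode_mul_genU hD' g y hy.1 hy.2
  · have h := (hx 1 h1).1
    rw [mul_one] at h
    exact h

theorem unique (hD : IsStandard D) (hD' : IsStandard D') : D = D' := by
  have h₁ : D.comul = D'.comul :=
    u_algHom_ext fun g => by rw [hD.comul_genU, hD'.comul_genU]
  have h₂ : D.counit = D'.counit :=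
    u_algHom_ext fun g => by rw [hD.counit_genU, hD'.counit_genU]
  have h₃ := hD.antipode_unique hD'
  cases D
  cases D'
  congr

theorem antipode_even (hD : IsStandard D) (x : U) :
    D.antipode (parity x) = parity (D.antipode x) := by
  -- By uniqueness it suffices to treat the explicit antipode, whose compatibility with parity is
  -- visible.
  rw [hD.unique isStandard_stdHopf]
  change antipodeMap (parity x) = parity (antipodeMap x)
  obtain ⟨x₀, x₁, h₀, h₁, rfl⟩ := exists_even_add_odd x
  simp only [map_add, h₀, h₁, antipodeMap_even h₀, map_neg, antipodeMap_odd h₁, map_smul,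
    ← antiHom_parity, MulOpposite.unop_neg, smul_neg]

theorem comul_even (hD : IsStandard D) (x : U) : D.comul (parity x) = parity (D.comul x) := by
  refine DFunLike.congr_fun (u_algHom_ext (f := D.comul.comp parity)
    (g := parity.comp D.comul) fun g => ?_) x
  rw [AlgHom.comp_apply, AlgHom.comp_apply]
  cases g
  · change D.comul (parity E) = parity (D.comul E)
    rw [parity_E, map_neg, hD.comul_E, map_add, parity_ct, parity_ct, parity_E, parity_Kinv,
      parity_one_eq, neg_ct, ct_neg, neg_add]
  · change D.comul (parity F) = parity (D.comul F)
    rw [parity_F, map_neg, hD.comul_F, map_add, parity_ct, parity_ct, parity_F, parity_K,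
      parity_one_eq, neg_ct, ct_neg, neg_add]
  · change D.comul (parity H₁) = parity (D.comul H₁)
    rw [parity_H₁, hD.comul_H₁, map_add, parity_ct, parity_ct, parity_H₁, parity_one_eq]
  · change D.comul (parity H₂) = parity (D.comul H₂)
    rw [parity_H₂, hD.comul_H₂, map_add, parity_ct, parity_ct, parity_H₂, parity_one_eq]

theorem counit_even (hD : IsStandard D) (x : U) : D.counit (parity x) = D.counit x := by
  refine DFunLike.congr_fun (u_algHom_ext (f := D.counit.comp parity) (g := D.counit)
    fun g => ?_) x
  rw [AlgHom.comp_apply, hD.counit_genU]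
  cases g
  · exact (congrArg D.counit parity_E).trans (by rw [map_neg, hD.counit_E, neg_zero])
  · exact (congrArg D.counit parity_F).trans (by rw [map_neg, hD.counit_F, neg_zero])
  · exact (congrArg D.counit parity_H₁).trans hD.counit_H₁
  · exact (congrArg D.counit parity_H₂).trans hD.counit_H₂

theorem comul_H (hD : IsStandard D) :
    D.comul (H₁ + H₂) = ct (H₁ + H₂) 1 + ct 1 (H₁ + H₂) := by
  rw [map_add, hD.comul_H₁, hD.comul_H₂, add_ct, ct_add]; abel

theorem parity_H : parity (H₁ + H₂) = H₁ + H₂ := by rw [map_add, parity_H₁, parity_H₂]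

theorem comul_K (hD : IsStandard D) : D.comul K = ct K K := by
  rw [K, HComp.algHom_hexp, hD.comul_H, HComp.hexp_add (ct_left_commute_right parity_H _),
    hexp_ct_left, hexp_ct_right, ct_mul_of_even_left _ _ parity_one_eq, one_mul, mul_one]

theorem comul_Kinv (hD : IsStandard D) : D.comul Kinv = ct Kinv Kinv := by
  rw [Kinv, HComp.algHom_hexp, map_neg, hD.comul_H, neg_add, ← neg_ct, ← ct_neg,
    HComp.hexp_add (ct_left_commute_right (by rw [map_neg, parity_H]) _),
    hexp_ct_left, hexp_ct_right, ct_mul_of_even_left _ _ parity_one_eq, one_mul, mul_one]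

theorem counit_hexp (x : U) (hx : D.counit x = 0) : D.counit (HComp.hexp x) = 1 := by
  -- Exponentials live in completions, so the computation takes place in the completion of `ℂ[[ħ]]`.
  refine (HComplete.of_bijective (C := Kh)).injective ?_
  have h := HComp.algHom_hexp ((HComp.of Kh).comp D.counit) x
  rw [AlgHom.comp_apply, AlgHom.comp_apply, hx, map_zero, HComp.hexp_zero] at h
  rw [h, map_one]

theorem counit_K (hD : IsStandard D) : D.counit K = 1 :=
  counit_hexp _ (by rw [map_add, hD.counit_H₁, hD.counit_H₂, add_zero])

theorem counit_Kinv (hD : IsStandard D) : D.counit Kinv = 1 :=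
  counit_hexp _ (by rw [map_neg, map_add, hD.counit_H₁, hD.counit_H₂, add_zero, neg_zero])

theorem antipode_hexp (hD : IsStandard D) {x : U} (hx : parity x = x) :
    D.antipode (HComp.hexp x) = HComp.hexp (D.antipode x) := by
  have h : ∀ i : ℕ, D.antipode (x ^ i) = D.antipode x ^ i := by
    intro i
    induction i with
    | zero => rw [pow_zero, pow_zero, hD.antipode_one]
    | succ i ih => rw [pow_succ, hD.antipode_mul_of_even_right _ hx, ih, pow_succ']
  rw [HComp.hexp, HComp.linearMap_hsum]
  simp only [map_smul, h]
  rfl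

theorem antipode_H (hD : IsStandard D) : D.antipode (H₁ + H₂) = -(H₁ + H₂) := by
  rw [map_add, hD.antipode_H₁, hD.antipode_H₂, neg_add]

theorem antipode_K (hD : IsStandard D) : D.antipode K = Kinv := by
  rw [K, hD.antipode_hexp parity_H, hD.antipode_H, Kinv]

theorem antipode_Kinv (hD : IsStandard D) : D.antipode Kinv = K := by
  rw [Kinv, hD.antipode_hexp (by rw [map_neg, parity_H]), map_neg, hD.antipode_H, neg_neg, K]

theorem comul_one : D.comul 1 = ct 1 1 := by rw [map_one, ct_one_one]

theorem coassoc (hD : IsStandard D) (x : U) : D.comulId (D.comul x) = D.idComul (D.comul x) := by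
  rw [D.comulId_eq hD.comul_even, D.idComul_eq hD.comul_even]
  refine DFunLike.congr_fun (u_algHom_ext (f := (D.comulIdAlg hD.comul_even).comp D.comul)
    (g := (D.idComulAlg hD.comul_even).comp D.comul) fun g => ?_) x
  rw [AlgHom.comp_apply, AlgHom.comp_apply, ← D.comulId_eq, ← D.idComul_eq]
  cases g
  · change D.comulId (D.comul E) = D.idComul (D.comul E)
    simp only [hD.comul_E, map_add, D.comulId_ct, D.idComul_ct, comul_one, hD.comul_Kinv, mul_add,
      leg1_mul_leg23_ct, add_ct]
    abel
  · change D.comulId (D.comul F) = D.idComul (D.comul F)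
    simp only [hD.comul_F, map_add, D.comulId_ct, D.idComul_ct, comul_one, hD.comul_K, mul_add,
      leg1_mul_leg23_ct, add_ct]
    abel
  · change D.comulId (D.comul H₁) = D.idComul (D.comul H₁)
    simp only [hD.comul_H₁, map_add, D.comulId_ct, D.idComul_ct, comul_one, mul_add,
      leg1_mul_leg23_ct, add_ct]
    abel
  · change D.comulId (D.comul H₂) = D.idComul (D.comul H₂)
    simp only [hD.comul_H₂, map_add, D.comulId_ct, D.idComul_ct, comul_one, mul_add,
      leg1_mul_leg23_ct, add_ct]
    abel

theorem counit_left (hD : IsStandard D) (x : U) : D.counitId (D.comul x) = x := by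
  rw [D.counitId_eq hD.counit_even]
  refine DFunLike.congr_fun (u_algHom_ext (f := (D.counitIdAlg hD.counit_even).comp D.comul)
    (g := AlgHom.id Kh U) fun g => ?_) x
  rw [AlgHom.comp_apply, ← D.counitId_eq, AlgHom.id_apply, hD.comul_genU]
  cases g <;> rw [comulGen, map_add, D.counitId_ct, D.counitId_ct]
  · rw [hD.counit_E, zero_smul, map_one, one_smul, zero_add, E]
  · rw [hD.counit_F, zero_smul, hD.counit_K, one_smul, zero_add, F]
  · rw [hD.counit_H₁, zero_smul, map_one, one_smul, zero_add, H₁]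
  · rw [hD.counit_H₂, zero_smul, map_one, one_smul, zero_add, H₂]

theorem counit_right (hD : IsStandard D) (x : U) : D.idCounit (D.comul x) = x := by
  rw [D.idCounit_eq hD.counit_even]
  refine DFunLike.congr_fun (u_algHom_ext (f := (D.idCounitAlg hD.counit_even).comp D.comul)
    (g := AlgHom.id Kh U) fun g => ?_) x
  rw [AlgHom.comp_apply, ← D.idCounit_eq, AlgHom.id_apply, hD.comul_genU]
  cases g <;> rw [comulGen, map_add, D.idCounit_ct, D.idCounit_ct]
  · rw [hD.counit_E, zero_smul, hD.counit_Kinv, one_smul, add_zero, E]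
  · rw [hD.counit_F, zero_smul, map_one, one_smul, add_zero, F]
  · rw [hD.counit_H₁, zero_smul, map_one, one_smul, add_zero, H₁]
  · rw [hD.counit_H₂, zero_smul, map_one, one_smul, add_zero, H₂]

/-- In `S(g'c)g''d` the anti-homomorphism rule places `S(g')` next to `g''`, with `S(c)` outside, so
the antipode identity for `g` applies in the middle. Allowing an arbitrary `z` is what makes the
property pass to products. -/
theorem antipodeMul_comul_genU_mul (hD : IsStandard D) (g : Gen) (z : CTensor U U) :
    D.antipodeMul (D.comul (genU g) * z) = 0 := by
  refine ctensor_ext_apply (f := D.antipodeMul ∘ₗ LinearMap.mulLeft Kh (D.comul (genU g)))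
    (g := 0) (fun c d => ?_) z
  rw [LinearMap.comp_apply, LinearMap.mulLeft_apply, hD.comul_genU, LinearMap.zero_apply]
  cases g <;> rw [comulGen, add_mul, map_add]
  · rw [ct_mul_of_even_left _ _ parity_Kinv, ct_mul_of_odd_left _ _ parity_E, D.antipodeMul_ct,
      D.antipodeMul_ct, hD.antipode_mul_of_odd_left parity_E, hD.antipode_E, one_mul, mul_neg,
      neg_mul, mul_assoc, mul_assoc E, ← mul_assoc K, K_mul_Kinv, one_mul, neg_add_cancel]
  · rw [ct_mul_of_even_left _ _ parity_one_eq, ct_mul_of_odd_left _ _ parity_F, D.antipodeMul_ct,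
      D.antipodeMul_ct, hD.antipode_mul_of_odd_left parity_F, hD.antipode_F,
      hD.antipode_mul_of_even_left parity_K, hD.antipode_K, one_mul, mul_neg, neg_mul, mul_assoc,
      mul_assoc, mul_assoc, neg_add_cancel]
  · rw [ct_mul_of_even_left _ _ parity_one_eq, ct_mul_of_even_left _ _ parity_H₁, D.antipodeMul_ct,
      D.antipodeMul_ct, hD.antipode_mul_of_even_left parity_H₁, hD.antipode_H₁, one_mul, one_mul,
      mul_neg, neg_mul, mul_assoc, neg_add_cancel]
  · rw [ct_mul_of_even_left _ _ parity_one_eq, ct_mul_of_even_left _ _ parity_H₂, D.antipodeMul_ct,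
      D.antipodeMul_ct, hD.antipode_mul_of_even_left parity_H₂, hD.antipode_H₂, one_mul, one_mul,
      mul_neg, neg_mul, mul_assoc, neg_add_cancel]

/-- Here the multiplier stands on the left: in `c g' S(d g'')` the factors `g'` and `S(g'')` become
adjacent. -/
theorem mulAntipode_mul_comul_genU (hD : IsStandard D) (g : Gen) (z : CTensor U U) :
    D.mulAntipode (z * D.comul (genU g)) = 0 := by
  refine ctensor_ext_apply (f := D.mulAntipode ∘ₗ LinearMap.mulRight Kh (D.comul (genU g)))
    (g := 0) (fun c d => ?_) z
  rw [LinearMap.comp_apply, LinearMap.mulRight_apply, hD.comul_genU, LinearMap.zero_apply]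
  cases g <;> rw [comulGen, mul_add, map_add]
  · rw [ct_mul_of_odd_right _ parity_E, ct_mul_of_even_right _ parity_one_eq, D.mulAntipode_ct,
      D.mulAntipode_ct, hD.antipode_mul_of_even_right _ parity_Kinv, hD.antipode_Kinv,
      hD.antipode_mul_of_odd_right _ parity_E, hD.antipode_E, mul_one, neg_mul, mul_neg, mul_assoc,
      mul_assoc, add_neg_cancel]
  · rw [ct_mul_of_odd_right _ parity_F, ct_mul_of_even_right _ parity_K, D.mulAntipode_ct,
      D.mulAntipode_ct, hD.antipode_mul_of_odd_right _ parity_F, hD.antipode_F, mul_one, neg_mul,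
      mul_neg, mul_assoc, mul_assoc, mul_assoc, ← mul_assoc K, K_mul_Kinv, one_mul, add_neg_cancel]
  · rw [ct_mul_of_even_right _ parity_H₁, ct_mul_of_even_right _ parity_one_eq, D.mulAntipode_ct,
      D.mulAntipode_ct, hD.antipode_mul_of_even_right _ parity_H₁, hD.antipode_H₁, mul_one, mul_one,
      neg_mul, mul_neg, mul_assoc, add_neg_cancel]
  · rw [ct_mul_of_even_right _ parity_H₂, ct_mul_of_even_right _ parity_one_eq, D.mulAntipode_ct,
      D.mulAntipode_ct, hD.antipode_mul_of_even_right _ parity_H₂, hD.antipode_H₂, mul_one, mul_one,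
      neg_mul, mul_neg, mul_assoc, add_neg_cancel]

theorem antipode_left (hD : IsStandard D) (x : U) :
    D.antipodeMul (D.comul x) = algebraMap Kh U (D.counit x) := by
  -- With `z` universally quantified the condition is closed under products, the second factor being
  -- absorbed into `z`; `z = 1` gives the axiom.
  let V : Subalgebra Kh U :=
    { carrier := {x | ∀ z, D.antipodeMul (D.comul x * z) = D.counit x • D.antipodeMul z}
      mul_mem' := fun {a b} ha hb z => by
        rw [map_mul D.comul, map_mul D.counit, mul_assoc, ha, hb, smul_smul]
      add_mem' := fun {a b} ha hb z => by
        rw [map_add, map_add, add_mul, map_add, ha, hb, add_smul]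
      algebraMap_mem' := fun r z => by
        rw [AlgHom.commutes, AlgHom.commutes, ← Algebra.smul_def, map_smul]; rfl }
  refine u_linearMap_ext (f := D.antipodeMul ∘ₗ D.comul.toLinearMap)
    (g := Algebra.linearMap Kh U ∘ₗ D.counit.toLinearMap) V (fun g z => ?_) (fun x hx => ?_) x
  · rw [hD.antipodeMul_comul_genU_mul, hD.counit_genU, zero_smul]
  · have h := hx 1
    rw [mul_one, ← ct_one_one, D.antipodeMul_ct, hD.antipode_one, mul_one] at h
    exact h.trans (Algebra.algebraMap_eq_smul_one _).symm

theorem antipode_right (hD : IsStandard D) (x : U) :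
    D.mulAntipode (D.comul x) = algebraMap Kh U (D.counit x) := by
  let V : Subalgebra Kh U :=
    { carrier := {x | ∀ z, D.mulAntipode (z * D.comul x) = D.counit x • D.mulAntipode z}
      mul_mem' := fun {a b} ha hb z => by
        rw [map_mul D.comul, map_mul D.counit, ← mul_assoc, hb, ha, smul_smul, mul_comm]
      add_mem' := fun {a b} ha hb z => by
        rw [map_add, map_add, mul_add, map_add, ha, hb, add_smul]
      algebraMap_mem' := fun r z => by
        rw [AlgHom.commutes, AlgHom.commutes, ← Algebra.commutes, ← Algebra.smul_def, map_smul]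
        rfl }
  refine u_linearMap_ext (f := D.mulAntipode ∘ₗ D.comul.toLinearMap)
    (g := Algebra.linearMap Kh U ∘ₗ D.counit.toLinearMap) V (fun g z => ?_) (fun x hx => ?_) x
  · rw [hD.mulAntipode_mul_comul_genU, hD.counit_genU, zero_smul]
  · have h := hx 1
    rw [one_mul, ← ct_one_one, D.mulAntipode_ct, hD.antipode_one, mul_one] at h
    exact h.trans (Algebra.algebraMap_eq_smul_one _).symm

theorem isHopfSuperalgebra (hD : IsStandard D) : D.IsHopfSuperalgebra where
  comul_even := hD.comul_even
  counit_even := hD.counit_even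
  antipode_even := hD.antipode_even
  coassoc := hD.coassoc
  counit_left := hD.counit_left
  counit_right := hD.counit_right
  antipode_left := hD.antipode_left
  antipode_right := hD.antipode_right

end IsStandard

/-! ### Conjugation by `Υ` -/

/-- The exponent `H₁ ⊗ H₁ - H₂ ⊗ H₂` of `Υ`. -/
def upsilonLog : CTensor U U := ct H₁ H₁ - ct H₂ H₂

theorem Upsilon_eq : Upsilon = HComp.hexp upsilonLog := rfl

/-- `Υ⁻¹` -/
def UpsilonInv : CTensor U U := HComp.hexp (-upsilonLog)

theorem Upsilon_mul_inv : Upsilon * UpsilonInv = 1 := HComp.hexp_mul_hexp_neg _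

theorem UpsilonInv_mul : UpsilonInv * Upsilon = 1 := HComp.hexp_neg_mul_hexp _

theorem ct_commute {x y : U} (hx : ∀ z, Commute x z) (hy : ∀ z, Commute y z) (hx' : parity x = x)
    (hy' : parity y = y) (z : CTensor U U) : Commute (ct x y) z := by
  refine ctensor_ext_apply (f := LinearMap.mulLeft Kh (ct x y))
    (g := LinearMap.mulRight Kh (ct x y)) (fun a b => ?_) z
  rw [LinearMap.mulLeft_apply, LinearMap.mulRight_apply, ct_mul_of_even_left _ _ hy',
    ct_mul_of_even_right _ hx', (hx a).eq, (hy b).eq]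

theorem one_commute_all (z : U) : Commute 1 z := Commute.one_left z

theorem parity_ct_even {x y : U} (hx : parity x = x) (hy : parity y = y) :
    parity (ct x y) = ct x y := by
  rw [parity_ct, hx, hy]

theorem parity_upsilonLog : parity upsilonLog = upsilonLog := by
  rw [upsilonLog, map_sub, parity_ct_even parity_H₁ parity_H₁, parity_ct_even parity_H₂ parity_H₂]

theorem flip_upsilonLog : flip upsilonLog = upsilonLog := by
  rw [upsilonLog, map_sub, flip_ct_of_even_left parity_H₁, flip_ct_of_even_left parity_H₂]

/-- The weights `1` and `-1` of `E` for `H₁` and `H₂` combine with the minus sign in the exponent to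
give the central element `H₁ + H₂` in the other leg. -/
theorem upsilonLog_mul_E_left :
    upsilonLog * ct E 1 = ct E 1 * (ct 1 (H₁ + H₂) + upsilonLog) := by
  simp only [upsilonLog, sub_mul, mul_add, mul_sub, ct_mul_of_even_left _ _ parity_one_eq,
    ct_mul_of_even_left _ _ parity_H₁, ct_mul_of_even_left _ _ parity_H₂, H₁_mul_E, H₂_mul_E,
    add_ct, sub_ct, ct_add, mul_one, one_mul]
  abel

theorem upsilonLog_mul_F_left :
    upsilonLog * ct F 1 = ct F 1 * (ct 1 (-(H₁ + H₂)) + upsilonLog) := by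
  simp only [upsilonLog, sub_mul, mul_add, mul_sub, ct_mul_of_even_left _ _ parity_one_eq,
    ct_mul_of_even_left _ _ parity_H₁, ct_mul_of_even_left _ _ parity_H₂, H₁_mul_F, H₂_mul_F,
    add_ct, sub_ct, ct_add, mul_one, one_mul, ct_neg, mul_neg]
  abel

theorem upsilonLog_mul_E_right :
    upsilonLog * ct 1 E = ct 1 E * (ct (H₁ + H₂) 1 + upsilonLog) := by
  simp only [upsilonLog, sub_mul, mul_add, mul_sub, ct_mul_of_even_right _ parity_one_eq,
    ct_mul_of_even_right _ parity_H₁, ct_mul_of_even_right _ parity_H₂, H₁_mul_E, H₂_mul_E,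
    add_ct, ct_sub, ct_add, mul_one, one_mul]
  abel

theorem upsilonLog_mul_F_right :
    upsilonLog * ct 1 F = ct 1 F * (ct (-(H₁ + H₂)) 1 + upsilonLog) := by
  simp only [upsilonLog, sub_mul, mul_add, mul_sub, ct_mul_of_even_right _ parity_one_eq,
    ct_mul_of_even_right _ parity_H₁, ct_mul_of_even_right _ parity_H₂, H₁_mul_F, H₂_mul_F,
    add_ct, ct_sub, ct_add, mul_one, one_mul, neg_ct, mul_neg]
  abel

/-- The shift of the exponent is central, so its exponential splits off as `1 ⊗ K`. -/
theorem Upsilon_mul_E_left : Upsilon * ct E 1 = ct E K * Upsilon := by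
  rw [Upsilon_eq, HComp.hexp_semiconj upsilonLog_mul_E_left,
    HComp.hexp_add (ct_commute one_commute_all H_commute parity_one_eq IsStandard.parity_H _),
    hexp_ct_right, ← mul_assoc, ct_mul_of_even_left _ _ parity_one_eq, mul_one, one_mul, K]

theorem Upsilon_mul_F_left : Upsilon * ct F 1 = ct F Kinv * Upsilon := by
  rw [Upsilon_eq, HComp.hexp_semiconj upsilonLog_mul_F_left,
    HComp.hexp_add (ct_commute one_commute_all (fun z => (H_commute z).neg_left) parity_one_eq
      (by rw [map_neg, IsStandard.parity_H]) _),
    hexp_ct_right, ← mul_assoc, ct_mul_of_even_left _ _ parity_one_eq, mul_one, one_mul, Kinv]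

theorem Upsilon_mul_E_right : Upsilon * ct 1 E = ct K E * Upsilon := by
  rw [Upsilon_eq, HComp.hexp_semiconj upsilonLog_mul_E_right,
    HComp.hexp_add (ct_commute H_commute one_commute_all IsStandard.parity_H parity_one_eq _),
    hexp_ct_left, ← mul_assoc, ← K, ct_mul_of_even_right _ parity_K, mul_one, one_mul]

theorem Upsilon_mul_F_right : Upsilon * ct 1 F = ct Kinv F * Upsilon := by
  rw [Upsilon_eq, HComp.hexp_semiconj upsilonLog_mul_F_right,
    HComp.hexp_add (ct_commute (fun z => (H_commute z).neg_left) one_commute_all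
      (by rw [map_neg, IsStandard.parity_H]) parity_one_eq _),
    hexp_ct_left, ← mul_assoc, ← Kinv, ct_mul_of_even_right _ parity_Kinv, mul_one, one_mul]

theorem Upsilon_mul_ct_left {x x' y : U} (h : Upsilon * ct x 1 = ct x x' * Upsilon)
    (hx' : parity x' = x') (hy : ∀ z, Commute y z) (hy' : parity y = y) :
    Upsilon * ct x y = ct x (x' * y) * Upsilon := by
  have h1 : ct x y = ct x 1 * ct 1 y := by
    rw [ct_mul_of_even_right _ parity_one_eq, mul_one, one_mul]
  rw [h1, ← mul_assoc, h, mul_assoc,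
    (ct_commute one_commute_all hy parity_one_eq hy' Upsilon).symm.eq, ← mul_assoc,
    ct_mul_of_even_left _ _ hx', mul_one]

theorem Upsilon_mul_ct_right {x x' y : U} (h : Upsilon * ct 1 x = ct x' x * Upsilon)
    (hy : ∀ z, Commute y z) (hy' : parity y = y) :
    Upsilon * ct y x = ct (x' * y) x * Upsilon := by
  have h1 : ct y x = ct 1 x * ct y 1 := by
    rw [ct_mul_of_even_right _ hy', mul_one, one_mul]
  rw [h1, ← mul_assoc, h, mul_assoc,
    (ct_commute hy one_commute_all hy' parity_one_eq Upsilon).symm.eq, ← mul_assoc,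
    ct_mul_of_even_right _ hy', mul_one]

theorem upsilonLog_commute_H₁ : Commute upsilonLog (ct H₁ 1 + ct 1 H₁) := by
  rw [Commute, SemiconjBy]
  simp only [upsilonLog, sub_mul, mul_add, add_mul, mul_sub, ct_mul_of_even_left _ _ parity_one_eq,
    ct_mul_of_even_left _ _ parity_H₁, ct_mul_of_even_left _ _ parity_H₂, mul_one, one_mul,
    H₁_mul_H₂]
  abel

theorem upsilonLog_commute_H₂ : Commute upsilonLog (ct H₂ 1 + ct 1 H₂) := by
  rw [Commute, SemiconjBy]
  simp only [upsilonLog, sub_mul, mul_add, add_mul, mul_sub, ct_mul_of_even_left _ _ parity_one_eq,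
    ct_mul_of_even_left _ _ parity_H₁, ct_mul_of_even_left _ _ parity_H₂, mul_one, one_mul,
    H₁_mul_H₂]
  abel

theorem ctFE_commute_H₁ : Commute (ct F E) (ct H₁ 1 + ct 1 H₁) := by
  rw [Commute, SemiconjBy]
  simp only [mul_add, add_mul, mul_sub, ct_mul_of_even_left _ _ parity_one_eq,
    ct_mul_of_even_left _ _ parity_H₁, ct_mul_of_even_right _ parity_H₁,
    ct_mul_of_even_right _ parity_one_eq, mul_one, one_mul, H₁_mul_E, H₁_mul_F, sub_ct, ct_add]
  abel

theorem ctFE_commute_H₂ : Commute (ct F E) (ct H₂ 1 + ct 1 H₂) := by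
  rw [Commute, SemiconjBy]
  simp only [mul_add, add_mul, mul_sub, ct_mul_of_even_left _ _ parity_one_eq,
    ct_mul_of_even_left _ _ parity_H₂, ct_mul_of_even_right _ parity_H₂,
    ct_mul_of_even_right _ parity_one_eq, mul_one, one_mul, H₂_mul_E, H₂_mul_F, add_ct, ct_sub]
  abel

/-! ### The R-matrix -/

theorem ctFE_sq : ct F E * ct F E = 0 := by
  rw [ct_mul_of_odd_odd _ parity_F parity_E, F_mul_F, zero_ct, neg_zero]

theorem mul_one_add_smul {A : Type*} [Ring A] [Algebra Kh A] (c : Kh) (t x : A) :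
    x * (1 + c • t) = x + c • (x * t) := by
  rw [mul_add, mul_one, mul_smul_comm]

theorem one_add_smul_mul {A : Type*} [Ring A] [Algebra Kh A] (c : Kh) (t x : A) :
    (1 + c • t) * x = x + c • (t * x) := by
  rw [add_mul, one_mul, smul_mul_assoc]

theorem isUnit_one_add_smul {A : Type*} [Ring A] [Algebra Kh A] (c : Kh) {t : A} (ht : t * t = 0) :
    IsUnit (1 + c • t) := by
  have h : ∀ d : Kh, (1 + d • t) * (1 + -d • t) = 1 := by
    intro d
    rw [mul_one_add_smul, one_add_smul_mul, ht, smul_zero, add_zero, neg_smul,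
      add_neg_cancel_right]
  exact ⟨⟨1 + c • t, 1 + -c • t, h c, by simpa only [neg_neg] using h (-c)⟩, rfl⟩

theorem isUnit_Theta : IsUnit Theta := isUnit_one_add_smul _ ctFE_sq

theorem isUnit_Upsilon : IsUnit Upsilon :=
  ⟨⟨Upsilon, UpsilonInv, Upsilon_mul_inv, UpsilonInv_mul⟩, rfl⟩

theorem isUnit_R : IsUnit R := isUnit_Theta.mul isUnit_Upsilon

theorem parity_R : parity R = R := by
  rw [R, map_mul, Theta, map_add, map_one, map_smul, parity_ct, parity_F, parity_E, neg_ct, ct_neg,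
    neg_neg, Upsilon_eq, HComp.algHom_hexp, parity_upsilonLog]

theorem R_mul_H₁ : (ct H₁ 1 + ct 1 H₁) * R = R * (ct H₁ 1 + ct 1 H₁) := by
  have h1 : Commute Theta (ct H₁ 1 + ct 1 H₁) :=
    (Commute.one_left _).add_left (ctFE_commute_H₁.smul_left _)
  exact (h1.mul_left (HComp.hexp_commute upsilonLog_commute_H₁)).symm.eq

theorem R_mul_H₂ : (ct H₂ 1 + ct 1 H₂) * R = R * (ct H₂ 1 + ct 1 H₂) := by
  have h1 : Commute Theta (ct H₂ 1 + ct 1 H₂) :=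
    (Commute.one_left _).add_left (ctFE_commute_H₂.smul_left _)
  exact (h1.mul_left (HComp.hexp_commute upsilonLog_commute_H₂)).symm.eq

/-- This form of the relation orders `E` before `F` without dividing by `q - q⁻¹`. -/
theorem q_smul_F_mul_E : (q - q⁻¹) • (F * E) = K - Kinv - (q - q⁻¹) • (E * F) := by
  rw [← q_smul_E_mul_F_add, smul_add, add_sub_cancel_left]

/-- Conjugation by `Υ` turns `Δ(E)` into `E ⊗ 1 + K ⊗ E`. The corrections due to `Θ` on the two
sides then differ by `(q - q⁻¹)(EF + FE) ⊗ E = (K - K⁻¹) ⊗ E`, which is the remaining discrepancy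
with the opposite coproduct; the other terms vanish by `E² = 0`. -/
theorem R_mul_E : (ct Kinv E + ct E 1) * R = R * (ct E Kinv + ct 1 E) := by
  have h : Upsilon * (ct E Kinv + ct 1 E) = (ct E 1 + ct K E) * Upsilon := by
    rw [mul_add, Upsilon_mul_ct_left Upsilon_mul_E_left parity_K Kinv_commute parity_Kinv,
      K_mul_Kinv, Upsilon_mul_E_right, add_mul]
  have h₁ : (q - q⁻¹) • ((ct Kinv E + ct E 1) * ct F E) = ct ((q - q⁻¹) • (E * F)) E := by
    rw [add_mul, ct_mul_of_odd_left _ _ parity_E, E_mul_E, ct_zero, zero_add,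
      ct_mul_of_even_left _ _ parity_one_eq, one_mul, smul_ct]
  have h₂ : (q - q⁻¹) • (ct F E * (ct E 1 + ct K E)) = -ct ((q - q⁻¹) • (F * E)) E := by
    rw [mul_add, ct_mul_of_odd_odd _ parity_E parity_E, ct_mul_of_even_right _ parity_K, E_mul_E,
      ct_zero, add_zero, mul_one, smul_neg, smul_ct]
  rw [R, mul_assoc Theta, h, ← mul_assoc, ← mul_assoc, Theta, mul_one_add_smul, one_add_smul_mul,
    h₁, h₂, q_smul_F_mul_E, sub_ct, sub_ct]
  congr 1
  abel

theorem R_mul_F : (ct 1 F + ct F K) * R = R * (ct F 1 + ct K F) := by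
  have h : Upsilon * (ct F 1 + ct K F) = (ct F Kinv + ct 1 F) * Upsilon := by
    rw [mul_add, Upsilon_mul_F_left, Upsilon_mul_ct_right Upsilon_mul_F_right K_commute parity_K,
      Kinv_mul_K, add_mul]
  have h₁ : (q - q⁻¹) • ((ct 1 F + ct F K) * ct F E) = -ct F ((q - q⁻¹) • (F * E)) := by
    rw [add_mul, ct_mul_of_odd_odd _ parity_F parity_F, ct_mul_of_even_left _ _ parity_K, F_mul_F,
      zero_ct, add_zero, one_mul, smul_neg, ct_smul]
  have h₂ : (q - q⁻¹) • (ct F E * (ct F Kinv + ct 1 F)) = ct F ((q - q⁻¹) • (E * F)) := by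
    rw [mul_add, ct_mul_of_odd_odd _ parity_F parity_E, F_mul_F, zero_ct, neg_zero, zero_add,
      ct_mul_of_even_right _ parity_one_eq, mul_one, ct_smul]
  rw [R, mul_assoc Theta, h, ← mul_assoc, ← mul_assoc, Theta, mul_one_add_smul, one_add_smul_mul,
    h₁, h₂, q_smul_F_mul_E, ct_sub, ct_sub]
  congr 1
  abel

namespace IsStandard

variable {D : HopfData PreU}

theorem comul_op (hD : IsStandard D) (x : U) :
    flip (D.comul x) = R * D.comul x * Ring.inverse R := by
  have key : flip (D.comul x) * R = R * D.comul x := by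
    -- The intertwining relation, written without `R⁻¹`, is stable under products because both sides
    -- involve algebra homomorphisms.
    let V : Subalgebra Kh U :=
      { carrier := {x | flip (D.comul x) * R = R * D.comul x}
        mul_mem' := fun {a b} ha hb => by
          change flip (D.comul (a * b)) * R = R * D.comul (a * b)
          rw [map_mul, map_mul, mul_assoc, hb, ← mul_assoc, ha, mul_assoc]
        add_mem' := fun {a b} ha hb => by
          change flip (D.comul (a + b)) * R = R * D.comul (a + b)
          rw [map_add, map_add, add_mul, mul_add, ha, hb]
        algebraMap_mem' := fun r => by
          change flip (D.comul (algebraMap Kh U r)) * R = R * D.comul (algebraMap Kh U r)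
          rw [AlgHom.commutes, AlgHom.commutes, Algebra.commutes] }
    refine u_linearMap_ext
      (f := LinearMap.mulRight Kh R ∘ₗ (flip (A := U) (B := U)).toLinearMap ∘ₗ D.comul.toLinearMap)
      (g := LinearMap.mulLeft Kh R ∘ₗ D.comul.toLinearMap) V (fun g => ?_) (fun x hx => hx) x
    change flip (D.comul (genU g)) * R = R * D.comul (genU g)
    rw [hD.comul_genU]
    cases g <;> rw [comulGen, map_add]
    · rw [flip_ct_of_even_right _ parity_Kinv, flip_ct_of_even_left parity_one_eq, R_mul_E]
    · rw [flip_ct_of_even_right _ parity_one_eq, flip_ct_of_even_left parity_K, R_mul_F]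
    · rw [flip_ct_of_even_right _ parity_one_eq, flip_ct_of_even_left parity_one_eq, add_comm,
        R_mul_H₁]
    · rw [flip_ct_of_even_right _ parity_one_eq, flip_ct_of_even_left parity_one_eq, add_comm,
        R_mul_H₂]
  rw [← key, Ring.mul_inverse_cancel_right _ _ isUnit_R]

end IsStandard

/-- This is the common core of both hexagon identities. The vanishing of `s * t'` factors `1 + c(s +
t')`, and `y`, which becomes `Υ₁₃`, carries the second factor from `t'` back to `t`. -/
theorem one_add_smul_mul_conj {A : Type*} [Ring A] [Algebra Kh A] (c : Kh) {s t t' y y' : A}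
    (hz : s * t' = 0) (hy : y * t = t' * y) :
    (1 + c • (s + t')) * (y * y') = (1 + c • s) * y * ((1 + c • t) * y') := by
  have h1 : (1 + c • s) * (1 + c • t') = 1 + c • (s + t') := by
    rw [mul_one_add_smul, one_add_smul_mul, hz, smul_zero, add_zero, smul_add, add_assoc]
  have h2 : y * (1 + c • t) = (1 + c • t') * y := by
    rw [mul_one_add_smul, one_add_smul_mul, hy]
  rw [← h1, mul_assoc (1 + c • s) y, ← mul_assoc y, h2, mul_assoc, mul_assoc]

/-! ### Triple tensor products and the hexagon identities -/

section Legs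

variable {T : Type} [Ring T] [Algebra Kh T] [SuperAlgebra T]

theorem leg13_mul (x y : CTensor (HComp T) (HComp T)) : leg13 (x * y) = leg13 x * leg13 y := by
  rw [leg13_eq, leg13_eq, leg13_eq, map_mul]

theorem leg13_hexp (x : CTensor (HComp T) (HComp T)) :
    leg13 (HComp.hexp x) = HComp.hexp (leg13 x) := by
  rw [leg13_eq, leg13_eq, HComp.algHom_hexp]

theorem leg13_one : leg13 (1 : CTensor (HComp T) (HComp T)) = 1 := by rw [leg13_eq, map_one]

theorem leg23_mul (x y : CTensor (HComp T) (HComp T)) : leg23 (x * y) = leg23 x * leg23 y := by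
  rw [leg23_eq, leg23_eq, leg23_eq, map_mul]

theorem leg23_hexp (x : CTensor (HComp T) (HComp T)) :
    leg23 (HComp.hexp x) = HComp.hexp (leg23 x) := by
  rw [leg23_eq, leg23_eq, HComp.algHom_hexp]

theorem leg23_one : leg23 (1 : CTensor (HComp T) (HComp T)) = 1 := by rw [leg23_eq, map_one]

theorem leg12_mul (x y : CTensor (HComp T) (HComp T)) : leg12 (x * y) = leg12 x * leg12 y := by
  rw [leg12_eq, leg12_eq, leg12_eq, map_mul]

theorem leg12_hexp (x : CTensor (HComp T) (HComp T)) :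
    leg12 (HComp.hexp x) = HComp.hexp (leg12 x) := by
  rw [leg12_eq, leg12_eq, HComp.algHom_hexp]

theorem leg12_one : leg12 (1 : CTensor (HComp T) (HComp T)) = 1 := by rw [leg12_eq, map_one]

theorem leg12_ct (a b : HComp T) : leg12 (ct a b) = ct (ct a b) 1 := rfl

/-- The product of `a ⊗ b ⊗ c` and `a' ⊗ b' ⊗ c'` for even `c`, `b`. -/
theorem ct3_mul_of_even_left (a a' : HComp T) {b : HComp T} (hb : parity b = b) (b' : HComp T)
    {c : HComp T} (hc : parity c = c) (c' : HComp T) :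
    ct (ct a b) c * ct (ct a' b') c' = ct (ct (a * a') (b * b')) (c * c') := by
  rw [ct_mul_of_even_left _ _ hc, ct_mul_of_even_left _ _ hb]

/-- The product of `a ⊗ b ⊗ c` and `a' ⊗ b' ⊗ c'` for even `a'`, `b'`. -/
theorem ct3_mul_of_even_right (a : HComp T) {a' : HComp T} (ha : parity a' = a') (b : HComp T)
    {b' : HComp T} (hb : parity b' = b') (c c' : HComp T) :
    ct (ct a b) c * ct (ct a' b') c' = ct (ct (a * a') (b * b')) (c * c') := by
  rw [ct_mul_of_even_right _ (by rw [parity_ct, ha, hb]), ct_mul_of_even_right _ ha]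

end Legs

theorem leg13_upsilonLog :
    leg13 upsilonLog = ct (ct H₁ 1) H₁ - ct (ct H₂ 1) H₂ := by
  rw [upsilonLog, map_sub, leg13_ct, leg13_ct]

theorem leg23_upsilonLog :
    leg23 upsilonLog = ct (ct 1 H₁) H₁ - ct (ct 1 H₂) H₂ := by
  rw [upsilonLog, map_sub, leg23_ct, leg23_ct]

theorem leg12_upsilonLog :
    leg12 upsilonLog = ct (ct H₁ H₁) 1 - ct (ct H₂ H₂) 1 := by
  rw [upsilonLog, map_sub, leg12_ct, leg12_ct]

theorem leg13_upsilonLog_commute_mid (x : U) :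
    Commute (leg13 upsilonLog) (ct (ct 1 x) 1) := by
  rw [leg13_upsilonLog, Commute, SemiconjBy, sub_mul, mul_sub,
    ct3_mul_of_even_left _ _ parity_one_eq _ parity_H₁,
    ct3_mul_of_even_left _ _ parity_one_eq _ parity_H₂,
    ct3_mul_of_even_right _ parity_H₁ _ parity_one_eq,
    ct3_mul_of_even_right _ parity_H₂ _ parity_one_eq]
  simp only [one_mul, mul_one]

theorem leg13_commute_leg23 : Commute (leg13 upsilonLog) (leg23 upsilonLog) := by
  rw [leg13_upsilonLog, leg23_upsilonLog, Commute, SemiconjBy]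
  simp only [sub_mul, mul_sub, ct3_mul_of_even_left _ _ parity_one_eq _ parity_H₁,
    ct3_mul_of_even_left _ _ parity_one_eq _ parity_H₂,
    ct3_mul_of_even_left _ _ parity_H₁ _ parity_H₁,
    ct3_mul_of_even_left _ _ parity_H₂ _ parity_H₂, one_mul, mul_one, H₁_mul_H₂]
  abel

theorem leg12_commute_leg13 : Commute (leg12 upsilonLog) (leg13 upsilonLog) := by
  rw [leg13_upsilonLog, leg12_upsilonLog, Commute, SemiconjBy]
  simp only [sub_mul, mul_sub, ct3_mul_of_even_left _ _ parity_one_eq _ parity_H₁,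
    ct3_mul_of_even_left _ _ parity_one_eq _ parity_H₂,
    ct3_mul_of_even_left _ _ parity_H₁ _ parity_one_eq,
    ct3_mul_of_even_left _ _ parity_H₂ _ parity_one_eq, one_mul, mul_one, H₁_mul_H₂]
  abel

theorem leg13_Upsilon_commute_mid (x : U) : Commute (leg13 Upsilon) (ct (ct 1 x) 1) := by
  rw [Upsilon_eq, leg13_hexp]
  exact HComp.hexp_commute (leg13_upsilonLog_commute_mid x)

/-- Conjugation by `Υ₁₃` creates the `K` in the first leg that occurs in the second term of `(Δ ⊗
id)(F ⊗ E)`. The middle leg is untouched because `Υ₁₃` is even and trivial there. -/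
theorem leg13_Upsilon_mul_leg23 :
    leg13 Upsilon * ct (ct 1 F) E = ct (ct K F) E * leg13 Upsilon := by
  have h1 : ct (ct (1 : U) F) E = ct (ct 1 F) 1 * leg13 (ct 1 E) := by
    rw [leg13_ct, ct3_mul_of_even_right _ parity_one_eq _ parity_one_eq]
    simp only [one_mul, mul_one]
  have h2 : ct (ct K F) E = ct (ct 1 F) 1 * leg13 (ct K E) := by
    rw [leg13_ct, ct3_mul_of_even_right _ parity_K _ parity_one_eq]
    simp only [one_mul, mul_one]
  rw [h1, h2, ← mul_assoc, (leg13_Upsilon_commute_mid F).eq, mul_assoc, ← leg13_mul,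
    Upsilon_mul_E_right, leg13_mul, mul_assoc]

theorem leg13_Upsilon_mul_leg12 :
    leg13 Upsilon * ct (ct F E) 1 = ct (ct F E) Kinv * leg13 Upsilon := by
  have h1 : ct (ct F E) (1 : U) = leg13 (ct F 1) * ct (ct 1 E) 1 := by
    rw [leg13_ct, ct3_mul_of_even_left _ _ parity_one_eq _ parity_one_eq]
    simp only [one_mul, mul_one]
  have h2 : ct (ct F E) Kinv = leg13 (ct F Kinv) * ct (ct 1 E) 1 := by
    rw [leg13_ct, ct3_mul_of_even_left _ _ parity_one_eq _ parity_Kinv]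
    simp only [one_mul, mul_one]
  rw [h1, h2, ← mul_assoc, ← leg13_mul, Upsilon_mul_F_left, leg13_mul, mul_assoc,
    (leg13_Upsilon_commute_mid E).eq, mul_assoc]

namespace IsStandard

variable {D : HopfData PreU}

theorem comulId_upsilonLog (hD : IsStandard D) :
    D.comulId upsilonLog = leg13 upsilonLog + leg23 upsilonLog := by
  rw [leg13_upsilonLog, leg23_upsilonLog, upsilonLog, map_sub, D.comulId_ct, D.comulId_ct,
    hD.comul_H₁, hD.comul_H₂, add_ct, add_ct]
  abel

theorem idComul_upsilonLog (hD : IsStandard D) :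
    D.idComul upsilonLog = leg12 upsilonLog + leg13 upsilonLog := by
  rw [leg12_upsilonLog, leg13_upsilonLog, upsilonLog, map_sub, D.idComul_ct, D.idComul_ct,
    hD.comul_H₁, hD.comul_H₂]
  simp only [map_add, mul_add, leg1_mul_leg23_ct]
  abel

theorem comulId_mul (hD : IsStandard D) (x y : CTensor U U) :
    D.comulId (x * y) = D.comulId x * D.comulId y := by
  simp only [D.comulId_eq hD.comul_even, map_mul]

theorem comulId_one : D.comulId 1 = 1 := by
  rw [← ct_one_one, D.comulId_ct, comul_one]
  rfl

theorem idComul_one : D.idComul 1 = 1 := by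
  rw [← ct_one_one, D.idComul_ct, comul_one, leg1_mul_leg23_ct]
  rfl

theorem idComul_mul (hD : IsStandard D) (x y : CTensor U U) :
    D.idComul (x * y) = D.idComul x * D.idComul y := by
  simp only [D.idComul_eq hD.comul_even, map_mul]

theorem comulId_Upsilon (hD : IsStandard D) :
    D.comulId Upsilon = leg13 Upsilon * leg23 Upsilon := by
  rw [Upsilon_eq, leg13_hexp, leg23_hexp, ← HComp.hexp_add leg13_commute_leg23,
    ← hD.comulId_upsilonLog, D.comulId_eq hD.comul_even, D.comulId_eq hD.comul_even,
    HComp.algHom_hexp]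

theorem idComul_Upsilon (hD : IsStandard D) :
    D.idComul Upsilon = leg13 Upsilon * leg12 Upsilon := by
  rw [Upsilon_eq, leg13_hexp, leg12_hexp, ← HComp.hexp_add leg12_commute_leg13.symm,
    add_comm, ← hD.idComul_upsilonLog, D.idComul_eq hD.comul_even, D.idComul_eq hD.comul_even,
    HComp.algHom_hexp]

theorem comulId_R (hD : IsStandard D) : D.comulId R = leg13 R * leg23 R := by
  have h13 : leg13 Theta = 1 + (q - q⁻¹) • ct (ct F 1) E := by
    simp only [Theta, map_add, map_smul, leg13_ct, leg13_one]
  have h23 : leg23 Theta = 1 + (q - q⁻¹) • ct (ct 1 F) E := by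
    simp only [Theta, map_add, map_smul, leg23_ct, leg23_one]
  have hΘ : D.comulId Theta = 1 + (q - q⁻¹) • (ct (ct F 1) E + ct (ct K F) E) := by
    simp only [Theta, map_add, map_smul, D.comulId_ct, hD.comul_F, add_ct, comulId_one]
  have hzero : ct (ct F 1) E * ct (ct K F) E = 0 := by
    rw [ct_mul_of_odd_left _ _ parity_E, E_mul_E, ct_zero]
  simp only [R, hD.comulId_mul, leg13_mul, leg23_mul, hD.comulId_Upsilon, hΘ, h13, h23]
  exact one_add_smul_mul_conj _ hzero leg13_Upsilon_mul_leg23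

theorem idComul_R (hD : IsStandard D) : D.idComul R = leg13 R * leg12 R := by
  have h13 : leg13 Theta = 1 + (q - q⁻¹) • ct (ct F 1) E := by
    simp only [Theta, map_add, map_smul, leg13_ct, leg13_one]
  have h12 : leg12 Theta = 1 + (q - q⁻¹) • ct (ct F E) 1 := by
    simp only [Theta, map_add, map_smul, leg12_ct, leg12_one]
  have hFE : D.idComul (ct F E) = ct (ct F 1) E + ct (ct F E) Kinv := by
    simp only [D.idComul_ct, hD.comul_E, map_add, mul_add, leg1_mul_leg23_ct]
    rw [add_comm]
  have hΘ : D.idComul Theta = 1 + (q - q⁻¹) • (ct (ct F 1) E + ct (ct F E) Kinv) := by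
    simp only [Theta, map_add, map_smul, hFE, idComul_one]
  have hzero : ct (ct F 1) E * ct (ct F E) Kinv = 0 := by
    rw [ct_mul_of_even_right _ (by rw [parity_ct, parity_F, parity_E, neg_ct, ct_neg, neg_neg]),
      ct_mul_of_even_left _ _ parity_one_eq, F_mul_F, zero_ct, zero_ct]
  simp only [R, hD.idComul_mul, leg13_mul, leg12_mul, hD.idComul_Upsilon, hΘ, h13, h12]
  exact one_add_smul_mul_conj _ hzero leg13_Upsilon_mul_leg12

theorem isBraided (hD : IsStandard D) : D.IsBraided R where
  toIsHopfSuperalgebra := hD.isHopfSuperalgebra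
  even_R := parity_R
  isUnit_R := isUnit_R
  comul_op := hD.comul_op
  comul_id_R := hD.comulId_R
  id_comul_R := hD.idComul_R

end IsStandard

/-! ### The ribbon element -/

/-- The factor `K⁻¹ + (q - q⁻¹) E F` of the ribbon element. -/
def vFactor : U := Kinv + (q - q⁻¹) • (E * F)

/-- The exponent `H₂² - H₁²`. -/
def vLog : U := H₂ ^ 2 - H₁ ^ 2

/-- The factor `e^{ħ(H₂² - H₁²)}` of the ribbon element. -/
def vExp : U := HComp.hexp vLog

theorem v_eq : v = vFactor * vExp := rfl

theorem parity_vLog : parity vLog = vLog := by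
  rw [vLog, map_sub, map_pow, map_pow, parity_H₁, parity_H₂]

theorem parity_vExp : parity vExp = vExp := by
  rw [vExp, HComp.algHom_hexp, parity_vLog]

theorem parity_E_mul_F : parity (E * F) = E * F := by
  rw [map_mul, parity_E, parity_F, neg_mul_neg]

theorem parity_vFactor : parity vFactor = vFactor := by
  rw [vFactor, map_add, map_smul, parity_Kinv, parity_E_mul_F]

theorem parity_v : parity v = v := by rw [v_eq, map_mul, parity_vFactor, parity_vExp]

theorem E_mul_E_mul (x : U) : E * (E * x) = 0 := by rw [← mul_assoc, E_mul_E, zero_mul]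

theorem F_mul_F_mul (x : U) : F * (F * x) = 0 := by rw [← mul_assoc, F_mul_F, zero_mul]

theorem q_smul_EFE : (q - q⁻¹) • (E * F * E) = E * (K - Kinv) := by
  rw [mul_assoc, ← mul_smul_comm, q_smul_F_mul_E, mul_sub, mul_smul_comm, E_mul_E_mul, smul_zero,
    sub_zero]

theorem q_smul_FEF : (q - q⁻¹) • (F * E * F) = (K - Kinv) * F := by
  rw [← smul_mul_assoc, q_smul_F_mul_E, sub_mul, smul_mul_assoc, mul_assoc E, F_mul_F, mul_zero,
    smul_zero, sub_zero]

/-- On the left of `vFactor`, `E` sees only `K⁻¹`; on the right it produces `K`. The resulting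
discrepancy `K²` is what `vExp` compensates in the centrality of `v`. -/
theorem E_mul_vFactor : E * vFactor = E * Kinv := by
  rw [vFactor, mul_add, mul_smul_comm, E_mul_E_mul, smul_zero, add_zero]

theorem F_mul_vFactor : F * vFactor = F * K := by
  rw [vFactor, mul_add, mul_smul_comm, ← mul_assoc, q_smul_FEF, sub_mul, Kinv_mul F, K_mul F,
    add_sub_cancel]

theorem vFactor_mul_E : vFactor * E = E * K := by
  rw [vFactor, add_mul, smul_mul_assoc, q_smul_EFE, mul_sub, Kinv_mul E, add_sub_cancel]

theorem vFactor_mul_F : vFactor * F = F * Kinv := by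
  rw [vFactor, add_mul, smul_mul_assoc, mul_assoc, F_mul_F, mul_zero, smul_zero, add_zero,
    Kinv_mul F]

/-- Here `(H₂ - 1)² - (H₁ + 1)² = H₂² - H₁² - 2(H₁ + H₂)`. The shift is written as two nested
summands so that each gives one factor `K⁻¹` under `HComp.hexp_add`. -/
theorem vLog_mul_E : vLog * E = E * (-(H₁ + H₂) + (-(H₁ + H₂) + vLog)) := by
  rw [vLog, sub_mul, sq, sq, mul_assoc, mul_assoc, H₁_mul_E, H₂_mul_E, ← mul_assoc, ← mul_assoc,
    H₁_mul_E, H₂_mul_E]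
  noncomm_ring

theorem vLog_mul_F : vLog * F = F * ((H₁ + H₂) + ((H₁ + H₂) + vLog)) := by
  rw [vLog, sub_mul, sq, sq, mul_assoc, mul_assoc, H₁_mul_F, H₂_mul_F, ← mul_assoc, ← mul_assoc,
    H₁_mul_F, H₂_mul_F]
  noncomm_ring

theorem vExp_mul_E : vExp * E = E * (Kinv * (Kinv * vExp)) := by
  rw [vExp, HComp.hexp_semiconj vLog_mul_E, HComp.hexp_add (H_commute _).neg_left,
    HComp.hexp_add (H_commute _).neg_left, Kinv]

theorem vExp_mul_F : vExp * F = F * (K * (K * vExp)) := by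
  rw [vExp, HComp.hexp_semiconj vLog_mul_F, HComp.hexp_add (H_commute _),
    HComp.hexp_add (H_commute _), K]

theorem vLog_commute_H₁ : Commute vLog H₁ := by
  have h : Commute H₂ H₁ := H₁_mul_H₂.symm
  exact (h.pow_left 2).sub_left ((Commute.refl H₁).pow_left 2)

theorem vLog_commute_H₂ : Commute vLog H₂ := by
  have h : Commute H₁ H₂ := H₁_mul_H₂
  exact ((Commute.refl H₂).pow_left 2).sub_left (h.pow_left 2)

theorem EF_commute_H₁ : Commute (E * F) H₁ := by
  rw [Commute, SemiconjBy, ← mul_assoc, H₁_mul_E, mul_assoc, mul_assoc, add_mul, H₁_mul_F]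
  noncomm_ring

theorem EF_commute_H₂ : Commute (E * F) H₂ := by
  rw [Commute, SemiconjBy, ← mul_assoc, H₂_mul_E, mul_assoc, mul_assoc, sub_mul, H₂_mul_F]
  noncomm_ring

theorem vFactor_commute_H₁ : Commute vFactor H₁ :=
  (Kinv_commute H₁).add_left (EF_commute_H₁.smul_left _)

theorem vFactor_commute_H₂ : Commute vFactor H₂ :=
  (Kinv_commute H₂).add_left (EF_commute_H₂.smul_left _)

theorem v_commute (x : U) : Commute v x := by
  refine u_linearMap_ext (f := LinearMap.mulLeft Kh v) (g := LinearMap.mulRight Kh v)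
    (Subalgebra.centralizer Kh {v}) (fun g => ?_) (fun y hy => ?_) x
  · refine Subalgebra.mem_centralizer_iff Kh |>.mpr fun y hy => ?_
    rw [Set.mem_singleton_iff] at hy
    subst hy
    cases g
    · change v * E = E * v
      rw [v_eq, mul_assoc, vExp_mul_E, ← mul_assoc, vFactor_mul_E, ← mul_assoc E, E_mul_vFactor,
        mul_assoc, ← mul_assoc K, K_mul_Kinv, one_mul, mul_assoc]
    · change v * F = F * v
      rw [v_eq, mul_assoc, vExp_mul_F, ← mul_assoc, vFactor_mul_F, ← mul_assoc F, F_mul_vFactor,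
        mul_assoc, ← mul_assoc Kinv, Kinv_mul_K, one_mul, mul_assoc]
    · exact vFactor_commute_H₁.mul_left (HComp.hexp_commute vLog_commute_H₁)
    · exact vFactor_commute_H₂.mul_left (HComp.hexp_commute vLog_commute_H₂)
  · exact Subalgebra.mem_centralizer_iff Kh |>.mp hy _ rfl

theorem flip_Theta : flip Theta = 1 + (q - q⁻¹) • -ct E F := by
  rw [Theta, map_add, map_one, map_smul, flip_ct_of_odd_odd parity_F parity_E]

theorem flip_Upsilon : flip Upsilon = Upsilon := by
  rw [Upsilon_eq, HComp.algHom_hexp, flip_upsilonLog]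

theorem flip_R : flip R = (1 + (q - q⁻¹) • -ct E F) * Upsilon := by
  rw [R, map_mul, flip_Theta, flip_Upsilon]

theorem isUnit_monodromy : IsUnit (flip R * R) := (isUnit_R.map flip).mul isUnit_R

/-! ### The Drinfeld element, and `ε` and `S` on the ribbon element -/

namespace IsStandard

variable {D : HopfData PreU}

/-- Each `H_i` in the left tensor factor comes out on the far left with the sign of `S(H_i) = -H_i`,
while the one in the right factor stays on the far right. -/
theorem antipodeMul_mul_upsilonLog (hD : IsStandard D) (z : CTensor U U) :
    D.antipodeMul (z * upsilonLog) =
      H₂ * D.antipodeMul z * H₂ - H₁ * D.antipodeMul z * H₁ := by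
  refine ctensor_ext_apply (f := D.antipodeMul ∘ₗ LinearMap.mulRight Kh upsilonLog)
    (g := (LinearMap.mulRight Kh H₂ ∘ₗ LinearMap.mulLeft Kh H₂) ∘ₗ D.antipodeMul -
      (LinearMap.mulRight Kh H₁ ∘ₗ LinearMap.mulLeft Kh H₁) ∘ₗ D.antipodeMul) (fun a b => ?_) z
  simp only [LinearMap.comp_apply, LinearMap.sub_apply, LinearMap.mulRight_apply,
    LinearMap.mulLeft_apply]
  rw [upsilonLog, mul_sub, ct_mul_of_even_right _ parity_H₁, ct_mul_of_even_right _ parity_H₂,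
    map_sub, D.antipodeMul_ct, D.antipodeMul_ct, D.antipodeMul_ct,
    hD.antipode_mul_of_even_right _ parity_H₁, hD.antipode_mul_of_even_right _ parity_H₂,
    hD.antipode_H₁, hD.antipode_H₂]
  noncomm_ring

/-- When the value at `z` commutes with both `H_i`, the sandwiching is multiplication by `H₂² -
H₁²`. Iterating gives the powers, and summing the series gives the exponential. -/
theorem antipodeMul_mul_Upsilon (hD : IsStandard D) {z : CTensor U U}
    (h₁ : Commute (D.antipodeMul z) H₁) (h₂ : Commute (D.antipodeMul z) H₂) :
    D.antipodeMul (z * Upsilon) = D.antipodeMul z * vExp := by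
  have h : ∀ i : ℕ, D.antipodeMul (z * upsilonLog ^ i) = D.antipodeMul z * vLog ^ i := by
    intro i
    induction i with
    | zero => rw [pow_zero, pow_zero, mul_one, mul_one]
    | succ i ih =>
      have c₁ := (h₁.mul_left (vLog_commute_H₁.pow_left i)).eq
      have c₂ := (h₂.mul_left (vLog_commute_H₂.pow_left i)).eq
      rw [pow_succ, ← mul_assoc, hD.antipodeMul_mul_upsilonLog, ih, ← c₁, ← c₂, pow_succ,
        ← mul_assoc (D.antipodeMul z)]
      generalize D.antipodeMul z * vLog ^ i = y
      rw [vLog, sq, sq, mul_sub, mul_assoc _ H₂ H₂, mul_assoc _ H₁ H₁]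
  have h' := HComp.linearMap_hsum (D.antipodeMul ∘ₗ LinearMap.mulLeft Kh z)
    fun i => PowerSeries.C ((i.factorial : ℂ)⁻¹) • upsilonLog ^ i
  simp only [LinearMap.comp_apply, LinearMap.mulLeft_apply, map_smul, h] at h'
  rw [vExp, HComp.hexp, HComp.mul_hsum]
  simp only [mul_smul_comm]
  exact h'

theorem drinfeld_R (hD : IsStandard D) : D.drinfeld R = K * v := by
  have h : D.antipodeMul (1 + (q - q⁻¹) • -ct E F) = K * vFactor := by
    rw [map_add, map_smul, map_neg, ← ct_one_one, D.antipodeMul_ct, D.antipodeMul_ct,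
      hD.antipode_one, hD.antipode_E, vFactor, mul_add, K_mul_Kinv, mul_smul_comm, one_mul, neg_mul,
      neg_neg, ← K_mul E, mul_assoc]
  rw [HopfData.drinfeld, flip_R, hD.antipodeMul_mul_Upsilon, h, v_eq, mul_assoc]
  · rw [h]; exact (K_commute H₁).mul_left vFactor_commute_H₁
  · rw [h]; exact (K_commute H₂).mul_left vFactor_commute_H₂

theorem antipode_vLog (hD : IsStandard D) : D.antipode vLog = vLog := by
  rw [vLog, sq, sq, map_sub, hD.antipode_mul_of_even_left parity_H₁,
    hD.antipode_mul_of_even_left parity_H₂, hD.antipode_H₁, hD.antipode_H₂, neg_mul_neg,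
    neg_mul_neg]

theorem antipode_E_mul_F (hD : IsStandard D) : D.antipode (E * F) = -(F * E) := by
  rw [hD.antipode_mul_of_odd_left parity_E, parity_F, map_neg, hD.antipode_F, hD.antipode_E,
    neg_neg, mul_neg, mul_assoc, ← mul_assoc F, ← mul_assoc Kinv, Kinv_mul (F * E), mul_assoc,
    Kinv_mul_K, mul_one]

/-- The antipode gives `K - (q - q⁻¹)FE`, which is the same element by the `EF` relation. -/
theorem antipode_vFactor (hD : IsStandard D) : D.antipode vFactor = vFactor := by
  rw [vFactor, map_add, map_smul, hD.antipode_Kinv, hD.antipode_E_mul_F, smul_neg, q_smul_F_mul_E]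
  abel

theorem antipode_v (hD : IsStandard D) : D.antipode v = v := by
  rw [v_eq, hD.antipode_mul_of_even_left parity_vFactor, hD.antipode_vFactor, vExp,
    hD.antipode_hexp parity_vLog, hD.antipode_vLog]
  exact HComp.hexp_commute ((vFactor_commute_H₂.pow_right 2).sub_right
    (vFactor_commute_H₁.pow_right 2)).symm

theorem counit_v (hD : IsStandard D) : D.counit v = 1 := by
  have h : D.counit vLog = 0 := by
    rw [vLog, map_sub, map_pow, map_pow, hD.counit_H₁, hD.counit_H₂, sub_self]
  rw [v_eq, map_mul, vExp, counit_hexp _ h, vFactor, map_add, map_smul, map_mul, hD.counit_E,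
    zero_mul, smul_zero, hD.counit_Kinv, add_zero, mul_one]

theorem sq_v (hD : IsStandard D) : v ^ 2 = D.drinfeld R * D.antipode (D.drinfeld R) := by
  rw [hD.drinfeld_R, hD.antipode_mul_of_even_left parity_K, hD.antipode_v, hD.antipode_K,
    ← Kinv_mul v, K_mul v, mul_assoc, ← mul_assoc K, K_mul_Kinv, one_mul, sq]

end IsStandard

/-! ### The coproduct of the ribbon element -/

section

variable {A : Type*} [Ring A] [Algebra Kh A] (c : Kh)

/-- Multiplication by the conjugated `Θ` in `monodromy_factor_mul`: `t = FK ⊗ EK⁻¹`, `k = K⁻¹ ⊗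
K⁻¹`, and `a`, `b`, `d`, `e` are the four terms of `conj_comul_EF`. The term `d` is cancelled and `g
= FE ⊗ EF` appears. -/
theorem one_add_smul_mul_eq {t k a b d e f g : A} (hk : t * k = f) (ha : c • (t * a) = d - f)
    (hb : t * b = -g) (hd : t * d = 0) (he : t * e = 0) :
    (1 + c • t) * (k + c • (a + b - d + e)) = k + c • (a + e - c • g) + c • b := by
  have h : t * (k + c • (a + b - d + e)) = d - c • g := by
    simp only [mul_add, mul_sub, mul_smul_comm, hk, hb, hd, he, smul_add, ha, smul_zero,
      add_zero, sub_zero, smul_neg]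
    abel
  rw [one_add_smul_mul, h]
  simp only [smul_add, smul_sub]
  abel

/-- Here `s = E ⊗ F` and `Q = vFactor ⊗ vFactor`; the flipped `Θ` removes the leftover term `r =
EK⁻¹ ⊗ FK`. -/
theorem one_add_smul_neg_mul_eq {s Q r : A} (h : s * Q = r) (h0 : s * r = 0) :
    (1 + c • -s) * (Q + c • r) = Q := by
  rw [one_add_smul_mul, mul_add, neg_mul, neg_mul, mul_smul_comm, h, h0, smul_zero, neg_zero,
    add_zero, smul_neg, add_neg_cancel_right]

theorem mul_add_smul_conj {y k a b a' b' : A} (hk : y * k = k * y) (ha : y * a = a' * y)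
    (hb : y * b = b' * y) : y * (k + c • (a * b)) = (k + c • (a' * b')) * y := by
  rw [mul_add, add_mul, mul_smul_comm, smul_mul_assoc, hk, ← mul_assoc, ha, mul_assoc, hb,
    ← mul_assoc]

end

/-- With `y = Υ`, `z = Υ⁻¹`, `t = Θ`, `t'` the flipped `Θ`, `d = Δ(vFactor)` and `w = vExp ⊗ vExp`,
both copies of `Υ` are moved to the right until they meet the two copies of `Υ⁻¹` from `Δ(vExp)`. -/
theorem mul_conj_eq {A : Type*} [Ring A] {t' t t₂ y z d p r w : A} (h : y * t = t₂ * y)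
    (hd : y * (y * d) = p * (y * y))
    (hz : y * z = 1) (hr : t' * (t₂ * p) = r) :
    t' * y * (t * y) * (d * (z * (z * w))) = r * w := by
  have hyz : y * (y * (z * (z * w))) = w := by
    rw [← mul_assoc y z, hz, one_mul, ← mul_assoc, hz, one_mul]
  calc t' * y * (t * y) * (d * (z * (z * w)))
      = t' * ((y * t) * ((y * d) * (z * (z * w)))) := by simp only [mul_assoc]
    _ = t' * (t₂ * ((y * (y * d)) * (z * (z * w)))) := by rw [h]; simp only [mul_assoc]
    _ = t' * (t₂ * p) * (y * (y * (z * (z * w)))) := by rw [hd]; simp only [mul_assoc]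
    _ = r * w := by rw [hyz, hr]

theorem Upsilon_mul_FE : Upsilon * ct F E = ct (F * K) (E * Kinv) * Upsilon := by
  have h : ct F E = ct F 1 * ct 1 E := by
    rw [ct_mul_of_even_right _ parity_one_eq, mul_one, one_mul]
  rw [h, ← mul_assoc, Upsilon_mul_F_left, mul_assoc, Upsilon_mul_E_right, ← mul_assoc,
    ct_mul_of_even_right _ parity_K, Kinv_mul E]

theorem Upsilon_mul_Theta :
    Upsilon * Theta = (1 + (q - q⁻¹) • ct (F * K) (E * Kinv)) * Upsilon := by
  rw [Theta, mul_one_add_smul, one_add_smul_mul, Upsilon_mul_FE]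

theorem KK_commute (z : U) : Commute (K * K) z := (K_commute z).mul_left (K_commute z)

theorem Upsilon_sq_mul_comul_E :
    Upsilon * Upsilon * (ct E Kinv + ct 1 E) = (ct E K + ct (K * K) E) * (Upsilon * Upsilon) := by
  have h₁ : Upsilon * (ct E Kinv + ct 1 E) = (ct E 1 + ct K E) * Upsilon := by
    rw [mul_add, Upsilon_mul_ct_left Upsilon_mul_E_left parity_K Kinv_commute parity_Kinv,
      K_mul_Kinv, Upsilon_mul_E_right, add_mul]
  have h₂ : Upsilon * (ct E 1 + ct K E) = (ct E K + ct (K * K) E) * Upsilon := by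
    rw [mul_add, Upsilon_mul_E_left, Upsilon_mul_ct_right Upsilon_mul_E_right K_commute parity_K,
      add_mul]
  rw [mul_assoc, h₁, ← mul_assoc, h₂, mul_assoc]

theorem Upsilon_sq_mul_comul_F :
    Upsilon * Upsilon * (ct F 1 + ct K F) =
      (ct F (Kinv * Kinv) + ct Kinv F) * (Upsilon * Upsilon) := by
  have h₁ : Upsilon * (ct F 1 + ct K F) = (ct F Kinv + ct 1 F) * Upsilon := by
    rw [mul_add, Upsilon_mul_F_left, Upsilon_mul_ct_right Upsilon_mul_F_right K_commute parity_K,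
      Kinv_mul_K, add_mul]
  have h₂ : Upsilon * (ct F Kinv + ct 1 F) = (ct F (Kinv * Kinv) + ct Kinv F) * Upsilon := by
    rw [mul_add, Upsilon_mul_ct_left Upsilon_mul_F_left parity_Kinv Kinv_commute parity_Kinv,
      Upsilon_mul_F_right, add_mul]
  rw [mul_assoc, h₁, ← mul_assoc, h₂, mul_assoc]

theorem parity_E_mul_Kinv : parity (E * Kinv) = -(E * Kinv) := by
  rw [map_mul, parity_E, parity_Kinv, neg_mul]

theorem K_mul_Kinv_mul (x : U) : K * (Kinv * x) = x := by rw [← mul_assoc, K_mul_Kinv, one_mul]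

theorem Kinv_mul_K_mul (x : U) : Kinv * (K * x) = x := by rw [← mul_assoc, Kinv_mul_K, one_mul]

theorem conj_comul_EF :
    (ct E K + ct (K * K) E) * (ct F (Kinv * Kinv) + ct Kinv F) =
      ct (E * F) Kinv + ct (E * Kinv) (F * K) - ct (F * (K * K)) (E * (Kinv * Kinv)) +
        ct K (E * F) := by
  rw [add_mul, mul_add, mul_add, ct_mul_of_even_left _ _ parity_K, ct_mul_of_even_left _ _ parity_K,
    ct_mul_of_odd_odd _ parity_F parity_E, ct_mul_of_even_right _ parity_Kinv, K_mul_Kinv_mul,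
    mul_assoc K K Kinv, K_mul_Kinv, mul_one, K_mul F, (KK_commute F).eq]
  abel

/-- The coefficient of `EF` in the second leg is `vFactor = K - (q - q⁻¹)FE`; this alternative
expression produces the `FE ⊗ EF` term required by the monodromy computation. -/
theorem ct_vFactor :
    ct vFactor vFactor = ct Kinv Kinv + (q - q⁻¹) • (ct (E * F) Kinv + ct K (E * F) -
      (q - q⁻¹) • ct (F * E) (E * F)) := by
  have h : ct K (E * F) - (q - q⁻¹) • ct (F * E) (E * F) = ct vFactor (E * F) := by
    rw [← smul_ct, ← sub_ct, q_smul_F_mul_E, vFactor]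
    congr 1
    abel
  rw [add_sub_assoc, h]
  conv_lhs => rw [vFactor, ct_add, ct_smul, ← vFactor]
  conv_lhs => enter [1]; rw [vFactor, add_ct, smul_ct]
  rw [smul_add, add_assoc]

/-- This is what remains of the coproduct formula for `v` once all factors `Υ` have cancelled. The
terms vanish or combine through `E² = F² = 0` and the relation for `(q - q⁻¹)FEF`. -/
theorem monodromy_factor_mul :
    (1 + (q - q⁻¹) • -ct E F) * ((1 + (q - q⁻¹) • ct (F * K) (E * Kinv)) *
      (ct Kinv Kinv + (q - q⁻¹) • ((ct E K + ct (K * K) E) *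
        (ct F (Kinv * Kinv) + ct Kinv F)))) = ct vFactor vFactor := by
  have hk : ct (F * K) (E * Kinv) * ct Kinv Kinv = ct F (E * (Kinv * Kinv)) := by
    rw [ct_mul_of_even_right _ parity_Kinv, mul_assoc, K_mul_Kinv, mul_one, mul_assoc]
  have ha : (q - q⁻¹) • (ct (F * K) (E * Kinv) * ct (E * F) Kinv) =
      ct (F * (K * K)) (E * (Kinv * Kinv)) - ct F (E * (Kinv * Kinv)) := by
    rw [ct_mul_of_even_right _ parity_E_mul_F, mul_assoc E, ← smul_ct, ← sub_ct]
    congr 1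
    rw [mul_assoc, K_mul (E * F), ← mul_assoc, ← mul_assoc, ← smul_mul_assoc, q_smul_FEF, sub_mul,
      sub_mul, K_mul F, Kinv_mul F, mul_assoc, mul_assoc, Kinv_mul_K, mul_one]
  have hb : ct (F * K) (E * Kinv) * ct (E * Kinv) (F * K) = -ct (F * E) (E * F) := by
    rw [ct_mul_of_odd_odd _ parity_E_mul_Kinv parity_E_mul_Kinv, ← Kinv_mul E, mul_assoc F,
      K_mul_Kinv_mul, Kinv_mul E, ← K_mul F, mul_assoc E, Kinv_mul_K_mul]
  have hd : ct (F * K) (E * Kinv) * ct (F * (K * K)) (E * (Kinv * Kinv)) = 0 := by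
    rw [ct_mul_of_odd_left _ _ parity_E_mul_Kinv, mul_assoc E, ← mul_assoc Kinv, Kinv_mul E,
      mul_assoc E Kinv, E_mul_E_mul, ct_zero]
  have he : ct (F * K) (E * Kinv) * ct K (E * F) = 0 := by
    rw [ct_mul_of_even_right _ parity_K, mul_assoc E, Kinv_mul (E * F), mul_assoc E F, E_mul_E_mul,
      ct_zero]
  have hs : ct E F * ct vFactor vFactor = ct (E * Kinv) (F * K) := by
    rw [ct_mul_of_even_right _ parity_vFactor, E_mul_vFactor, F_mul_vFactor]
  have hs0 : ct E F * ct (E * Kinv) (F * K) = 0 := by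
    rw [ct_mul_of_odd_left _ _ parity_F, F_mul_F_mul, ct_zero]
  rw [conj_comul_EF, one_add_smul_mul_eq _ hk ha hb hd he, ← ct_vFactor,
    one_add_smul_neg_mul_eq _ hs hs0]

theorem upsilonLog_commute_vLog_left : Commute upsilonLog (ct vLog 1) := by
  rw [upsilonLog, Commute, SemiconjBy, sub_mul, mul_sub, ct_mul_of_even_right _ parity_vLog,
    ct_mul_of_even_right _ parity_vLog, ct_mul_of_even_right _ parity_H₁,
    ct_mul_of_even_right _ parity_H₂, vLog_commute_H₁.eq, vLog_commute_H₂.eq]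
  simp only [one_mul, mul_one]

theorem upsilonLog_commute_vLog_right : Commute upsilonLog (ct 1 vLog) := by
  rw [upsilonLog, Commute, SemiconjBy, sub_mul, mul_sub, ct_mul_of_even_right _ parity_one_eq,
    ct_mul_of_even_right _ parity_one_eq, ct_mul_of_even_right _ parity_H₁,
    ct_mul_of_even_right _ parity_H₂, vLog_commute_H₁.eq, vLog_commute_H₂.eq]
  simp only [one_mul, mul_one]

namespace IsStandard

variable {D : HopfData PreU}

/-- Squaring a primitive `H` yields the cross term `2 H ⊗ H`, so the difference of squares
contributes `-2(H₁ ⊗ H₁ - H₂ ⊗ H₂)`. This is the source of `Υ⁻²` in `Δ(vExp)`. -/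
theorem comul_vLog (hD : IsStandard D) :
    D.comul vLog = -upsilonLog + (-upsilonLog + (ct vLog 1 + ct 1 vLog)) := by
  have h {x : U} (hx : parity x = x) :
      (ct x 1 + ct 1 x) ^ 2 = ct (x ^ 2) 1 + ct 1 (x ^ 2) + (ct x x + ct x x) := by
    rw [sq, add_mul, mul_add, mul_add, ct_mul_of_even_right _ hx,
      ct_mul_of_even_right _ parity_one_eq, ct_mul_of_even_right _ hx,
      ct_mul_of_even_right _ parity_one_eq, sq]
    simp only [one_mul, mul_one]
    abel
  rw [vLog, map_sub, map_pow, map_pow, hD.comul_H₁, hD.comul_H₂, h parity_H₁, h parity_H₂,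
    upsilonLog, sub_ct, ct_sub]
  abel

theorem comul_vExp (hD : IsStandard D) :
    D.comul vExp = UpsilonInv * (UpsilonInv * ct vExp vExp) := by
  have h : Commute upsilonLog (ct vLog 1 + ct 1 vLog) :=
    upsilonLog_commute_vLog_left.add_right upsilonLog_commute_vLog_right
  rw [vExp, HComp.algHom_hexp, hD.comul_vLog,
    HComp.hexp_add ((Commute.refl upsilonLog).neg_right.add_right h).neg_left,
    HComp.hexp_add h.neg_left, HComp.hexp_add (ct_left_commute_right parity_vLog _), hexp_ct_left,
    hexp_ct_right, ct_mul_of_even_left _ _ parity_one_eq, one_mul, mul_one, UpsilonInv]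

theorem comul_vFactor (hD : IsStandard D) :
    D.comul vFactor =
      ct Kinv Kinv + (q - q⁻¹) • ((ct E Kinv + ct 1 E) * (ct F 1 + ct K F)) := by
  rw [vFactor, map_add, map_smul, map_mul, hD.comul_Kinv, hD.comul_E, hD.comul_F]

theorem Upsilon_sq_mul_comul_vFactor (hD : IsStandard D) :
    Upsilon * (Upsilon * D.comul vFactor) =
      (ct Kinv Kinv + (q - q⁻¹) • ((ct E K + ct (K * K) E) *
        (ct F (Kinv * Kinv) + ct Kinv F))) * (Upsilon * Upsilon) := by
  rw [← mul_assoc, hD.comul_vFactor]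
  exact mul_add_smul_conj _
    (ct_commute Kinv_commute Kinv_commute parity_Kinv parity_Kinv _).symm.eq
    Upsilon_sq_mul_comul_E Upsilon_sq_mul_comul_F

theorem monodromy_mul_comul_v (hD : IsStandard D) : flip R * R * D.comul v = ct v v := by
  have h : ct v v = ct vFactor vFactor * ct vExp vExp := by
    rw [ct_mul_of_even_left _ _ parity_vFactor, v_eq]
  rw [flip_R, R, v_eq, map_mul, hD.comul_vExp, ← v_eq, h]
  exact mul_conj_eq Upsilon_mul_Theta hD.Upsilon_sq_mul_comul_vFactor Upsilon_mul_inv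
    monodromy_factor_mul

theorem isRibbon (hD : IsStandard D) : D.IsRibbon R v where
  toIsBraided := hD.isBraided
  even_v := parity_v
  central_v x := (v_commute x).eq
  sq_v := hD.sq_v
  counit_v := hD.counit_v
  antipode_v := hD.antipode_v
  isUnit_monodromy := isUnit_monodromy
  comul_v := by
    rw [← hD.monodromy_mul_comul_v, Ring.inverse_mul_cancel_left _ _ isUnit_monodromy]

end IsStandard

end GL11

end

theorem mainTheorem5 :
    (GL11.K * GL11.Kinv = 1 ∧ GL11.Kinv * GL11.K = 1) ∧
    ∃ D : GL11.HopfData GL11.PreU,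
      GL11.IsStandard D ∧
      (∀ D' : GL11.HopfData GL11.PreU, GL11.IsStandard D' → D' = D) ∧
      GL11.v = GL11.Kinv * D.drinfeld GL11.R ∧
      GL11.v = D.drinfeld GL11.R * GL11.Kinv ∧
      D.IsRibbon GL11.R GL11.v := by
  have hD := GL11.isStandard_stdHopf
  have h : GL11.v = GL11.Kinv * GL11.stdHopf.drinfeld GL11.R := by
    rw [hD.drinfeld_R, GL11.Kinv_mul_K_mul]
  refine ⟨⟨GL11.K_mul_Kinv, GL11.Kinv_mul_K⟩, GL11.stdHopf, hD, fun D' hD' => hD'.unique hD, h, ?_,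
    hD.isRibbon⟩
  rw [← GL11.Kinv_mul]
  exact h
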